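/- \textbf{Setting.} Let $n\ge 1$ and let $\hat f(\xi)=\mathscr F f(\xi)=\int e^{-ix\cdot\xi}f(x)\,dx$ on $\mathbb R^n$. Fix a smooth $\rho:\mathbb R^n\to[0,1]$ with $\rho(\xi)=1$ for $|\xi|\le\sqrt n/2$ and $\rho(\xi)=0$ for $|\xi|\ge\sqrt n$, and for $k\in\mathbb Z^n$ put $$\sigma_k(\xi)=\frac{\rho(\xi-k)}{\sum_{l\in\mathbb Z^n}\rho(\xi-l)},\qquad \square_k=\mathscr F^{-1}\sigma_k\mathscr F .$$ For $s\in\mathbb R$, $1\le p,\gamma\le\infty$, $1\le q<\infty$, let $$\|f\|_{M^s_{p,q}}=\Big(\sum_{k}(1+|k|)^{sq}\|\square_kf\|_{L^p}^q\Big)^{1/q},\qquad \|f\|_{l^{s,q}_\square(L^\gamma(\mathbb R,L^p))}=\Big(\sum_{k}(1+|k|)^{sq}\|\square_kf\|_{L^\gamma(\mathbb R;L^p(\mathbb R^n))}^q\Big)^{1/q},$$ the first for $f\in\mathscr S'(\mathbb R^n)$, the second for time-dependent tempered distributions $t\mapsto f(t)\in\mathscr S'(\mathbb R^n)$, with $\square_k$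 acting in $x$ (an $L^p$ norm is $\infty$ for a distribution that is not an $L^p$ function). $L^\gamma(\mathbb R,M^s_{p,q})$ is normed by the $L^\gamma$ norm of $t\mapsto\|f(t)\|_{M^s_{p,q}}$; all time-dependent $f$ are assumed measurable in $t$. Let $P:\mathbb R^n\to\mathbb R$ be measurable and $U(t)=\mathscr F^{-1}e^{itP(\xi)}\mathscr F$, $t\in\mathbb R$. Let $2\le p<\infty$, $1\le q<\infty$, $\alpha,\delta\in\mathbb R$, $0<\mu<1$, let $p'$ be the conjugate exponent of $p$, and assume that for some constant $C_0$ $$\|U(t)f\|_{M^\alpha_{p,q}}\le C_0(1+|t|)^{-\mu}\|f\|_{M^{\alpha+\delta}_{p',q}}\qquad\text{for all }t\in\mathbb R,\ f\in M^{\alpha+\delta}_{p',q}.$$ Put $\gamma=2/\mu$, let $\gamma'$ be its conjugate exponent, and $$(\mathcal N f)(t)=\int_0^tU(t-\tau)f(\tau)\,d\tau,\qquad t\in\mathbb R,$$ the integral being absolutely convergent when tested against Schwartz functions. \textbf{Statement.} Let $s\in\mathbb R$. (1) There is a constant $C$ such that for every $f$ with $\|f\|_{l^{s+\delta,q}_\square(L^{\gamma'}(\mathbb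 R,L^{p'}))}<\infty$, $\mathcal N f$ is well defined and measurable in $t$, and $$\|\mathcal N f\|_{l^{s,q}_\square(L^{\gamma}(\mathbb R,L^p))}\le C\|f\|_{l^{s+\delta,q}_\square(L^{\gamma'}(\mathbb R,L^{p'}))}.$$ (2) If in addition $q\in[\gamma',\gamma]$, there is a constant $C$ such that for every $f\in L^{\gamma'}(\mathbb R,M^{s+\delta}_{p',q})$, $\mathcal N f$ is well defined and measurable in $t$, and $$\|\mathcal N f\|_{L^\gamma(\mathbb R,M^s_{p,q})}\le C\|f\|_{L^{\gamma'}(\mathbb R,M^{s+\delta}_{p',q})}.$$ -/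

import Mathlib

open scoped ENNReal NNReal SchwartzMap FourierTransform

noncomputable section

namespace ModSpace

/-- Euclidean space `ℝⁿ`. -/
abbrev Space (n : ℕ) := EuclideanSpace ℝ (Fin n)

/-- The lattice point `k ∈ ℤⁿ`, seen in `ℝⁿ`. -/
def latticePoint {n : ℕ} (k : Fin n → ℤ) : Space n :=
  WithLp.toLp 2 (fun i => (k i : ℝ))

/-- The cut-off functions `ρ` from which the uniform frequency decomposition is built. -/
structure IsCutoff {n : ℕ} (ρ : Space n → ℝ) : Prop where
  smooth : ContDiff ℝ (⊤ : ℕ∞) ρ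
  nonneg : ∀ ξ, 0 ≤ ρ ξ
  le_one : ∀ ξ, ρ ξ ≤ 1
  eq_one : ∀ ξ, ‖ξ‖ ≤ √(n : ℝ) / 2 → ρ ξ = 1
  eq_zero : ∀ ξ, √(n : ℝ) ≤ ‖ξ‖ → ρ ξ = 0

/-- `σ_k(ξ) = ρ(ξ - k) / ∑_l ρ(ξ - l)`; for each `ξ` the sum has finitely many nonzero terms. -/
def sigma {n : ℕ} (ρ : Space n → ℝ) (k : Fin n → ℤ) (ξ : Space n) : ℝ :=
  ρ (ξ - latticePoint k) / ∑' l : Fin n → ℤ, ρ (ξ - latticePoint l)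

/-- The frequency-uniform decomposition operator `□_k = 𝓕⁻¹ σ_k 𝓕` on tempered distributions,
for the Fourier transform with kernel `exp (-i x·ξ)`. In Mathlib's normalization, with kernel
`exp (-2πi x·ξ)`, its symbol is `ξ ↦ σ_k (2πξ)`. -/
def box {n : ℕ} (ρ : Space n → ℝ) (k : Fin n → ℤ) (f : 𝓢'(Space n, ℂ)) : 𝓢'(Space n, ℂ) :=
  TemperedDistribution.fourierMultiplierCLM ℂ
    (fun ξ : Space n => (sigma ρ k ((2 * Real.pi) • ξ) : ℂ)) f

/-- The `L^p` norm of a tempered distribution (`1 ≤ p`): the norm of the `L^p` function that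
represents it, and `∞` if there is none. -/
def lpNorm {n : ℕ} (p : ℝ≥0∞) (f : 𝓢'(Space n, ℂ)) : ℝ≥0∞ :=
  ⨅ (g : Space n → ℂ) (_ : MeasureTheory.MemLp g p MeasureTheory.volume)
    (_ : ∀ φ : 𝓢(Space n, ℂ), f φ = ∫ x, φ x * g x),
    MeasureTheory.eLpNorm g p MeasureTheory.volume

/-- The weighted `ℓ^q` norm over `ℤⁿ`, with weight `(1 + |k|)^s`. -/
def weightedSeqNorm {n : ℕ} (s : ℝ) (q : ℝ≥0∞) (a : (Fin n → ℤ) → ℝ≥0∞) : ℝ≥0∞ :=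
  if q = ⊤ then ⨆ k, ENNReal.ofReal ((1 + ‖latticePoint k‖) ^ s) * a k
  else (∑' k, (ENNReal.ofReal ((1 + ‖latticePoint k‖) ^ s) * a k) ^ q.toReal) ^ (1 / q.toReal)

/-- The norm of the modulation space `M^s_{p,q}`; the space is the set where it is finite. -/
def modNorm {n : ℕ} (ρ : Space n → ℝ) (s : ℝ) (p q : ℝ≥0∞) (f : 𝓢'(Space n, ℂ)) : ℝ≥0∞ :=
  weightedSeqNorm s q (fun k => lpNorm p (box ρ k f))

/-- A time-dependent tempered distribution that is measurable in time. -/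
def TimeMeasurable {n : ℕ} (f : ℝ → 𝓢'(Space n, ℂ)) : Prop :=
  ∀ φ : 𝓢(Space n, ℂ), MeasureTheory.AEStronglyMeasurable (fun t => f t φ) MeasureTheory.volume

/-- The norm of `L^γ(ℝ, M^s_{p,q})`. -/
def timeModNorm {n : ℕ} (ρ : Space n → ℝ) (γ : ℝ≥0∞) (s : ℝ) (p q : ℝ≥0∞)
    (f : ℝ → 𝓢'(Space n, ℂ)) : ℝ≥0∞ :=
  MeasureTheory.eLpNorm (fun t => modNorm ρ s p q (f t)) γ MeasureTheory.volume

/-- The norm of `l^{s,q}_□(L^γ(ℝ, L^p))`. -/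
def boxTimeNorm {n : ℕ} (ρ : Space n → ℝ) (s : ℝ) (q γ p : ℝ≥0∞)
    (f : ℝ → 𝓢'(Space n, ℂ)) : ℝ≥0∞ :=
  weightedSeqNorm s q
    (fun k => MeasureTheory.eLpNorm (fun t => lpNorm p (box ρ k (f t))) γ MeasureTheory.volume)

/-- `u = U(t) f`, where `U(t) = 𝓕⁻¹ exp(i t P(ξ)) 𝓕`: the Fourier transform of `f` is a function
`g`, and that of `u` is the function `exp(i t P) g`. Since `P` is only a measurable function, this
is asked of those `f` whose Fourier transform is a function; for `p ≤ 2` they include all of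
`M^s_{p,q}`. As in `box`, the argument of `P` is `2πξ` in Mathlib's normalization. -/
def IsPropagated {n : ℕ} (P : Space n → ℝ) (t : ℝ) (f u : 𝓢'(Space n, ℂ)) : Prop :=
  ∃ g : Space n → ℂ,
    (∀ φ : 𝓢(Space n, ℂ),
      MeasureTheory.Integrable (fun ξ => φ ξ * g ξ) MeasureTheory.volume) ∧
    (∀ φ : 𝓢(Space n, ℂ), (𝓕 f) φ = ∫ ξ, φ ξ * g ξ) ∧
    (∀ φ : 𝓢(Space n, ℂ), (𝓕 u) φ =
      ∫ ξ, φ ξ * (Complex.exp (Complex.I * ((t * P ((2 * Real.pi) • ξ) : ℝ) : ℂ)) * g ξ))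

/-- The decay hypothesis
`‖U(t) f‖_{M^α_{p,q}} ≲ (1 + |t|)^{-μ} ‖f‖_{M^{α+δ}_{p',q}}`, uniformly in `t ∈ ℝ`. -/
def HasDecay {n : ℕ} (ρ P : Space n → ℝ) (p p' q : ℝ≥0∞) (α δ μ : ℝ) : Prop :=
  ∃ C : ℝ≥0, ∀ (t : ℝ) (f u : 𝓢'(Space n, ℂ)),
    modNorm ρ (α + δ) p' q f < ⊤ → IsPropagated P t f u →
      modNorm ρ α p q u ≤ C * ENNReal.ofReal ((1 + |t|) ^ (-μ)) * modNorm ρ (α + δ) p' q f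

/-- `u = 𝒩 f`, that is, `u(t) = ∫₀ᵗ U(t - τ) f(τ) dτ` for all `t ∈ ℝ`, as an absolutely convergent
integral in the weak sense of tempered distributions; here `w t τ` is `U(t - τ) f(τ)`. -/
def IsDuhamel {n : ℕ} (P : Space n → ℝ) (f u : ℝ → 𝓢'(Space n, ℂ)) : Prop :=
  ∃ w : ℝ → ℝ → 𝓢'(Space n, ℂ), ∀ t : ℝ,
    (∀ᵐ τ ∂(MeasureTheory.volume.restrict (Set.uIoc 0 t)),
      IsPropagated P (t - τ) (f τ) (w t τ)) ∧
    ∀ φ : 𝓢(Space n, ℂ),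
      IntervalIntegrable (fun τ => w t τ φ) MeasureTheory.volume 0 t ∧
      u t φ = ∫ τ in (0 : ℝ)..t, w t τ φ

end ModSpace

end

/-! Everything reduces to one frequency block at a time. Applied to `box ρ k f`, both modulation
norms in the decay hypothesis collapse: only the boundedly many indices in `near k` contribute, and
their weights are comparable to powers of 1+|k|. The power α cancels, and what remains is ‖□_k
U(t)f‖_p ≤ C (1+|t|)^(-μ) (1+|k|)^δ ‖□_k f‖_{p'}, with C independent of k because the symbols are
translates of each other (`HasDecay.exists_lpNorm_box_le`).

Minkowski's inequality in the Duhamel integral then bounds ‖□_k u(t)‖_p by C (1+|k|)^δ times the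
convolution of (1+|t|)^(-μ) with ‖□_k f(τ)‖_{p'} (`IsDuhamel.lpNorm_box_le`). Convolution with this
kernel maps L^γ' to L^γ, since 1/γ' - 1/γ = 1 - μ (`hardyLittlewoodSobolev`). For (1) this is
applied to each block, and the results are summed in ℓ^q. For (2) Minkowski's inequality in ℓ^q
moves the sum inside the convolution, and Hardy–Littlewood–Sobolev is applied once, to the scalar
function τ ↦ ‖f(τ)‖_M.

The remaining work gives a meaning to the Duhamel integral when P is merely measurable. Since p' ≤
2, Bernstein and Plancherel show that each block of f(τ) has a function as Fourier transform. With a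
polynomial weight these add up to a function g_τ whose weighted L¹ norm is locally integrable in τ
(`IsCutoff.exists_fourier_isRepresentedBy`, `IsCutoff.exists_isFourierDensity`). Pairing
exp(i(t-τ)P) g_τ with Schwartz functions and integrating in τ defines u(t), which is weakly
continuous in t. Blocks are handled through their representatives x ↦ T(K(·-x)), K being the Fourier
transform of the symbol (`isRepresentedBy_mult`); this turns `lpNorm`, an infimum, into an integral
that is measurable in time. -/

noncomputable section

namespace ModSpace

open MeasureTheory Set Filter Topology

/-! ### Duality, Minkowski's inequality and joint measurability -/

section Lintegral

variable {X Y : Type*} [MeasurableSpace X] [MeasurableSpace Y]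

/-- The `L^p` norm is controlled by testing against functions in the dual space. -/
theorem lintegral_rpow_le_of_forall_lintegral_mul_le {μ : Measure X} [SigmaFinite μ] {p q : ℝ}
    (hpq : p.HolderConjugate q) {h : X → ℝ≥0∞} (hh : Measurable h) {M : ℝ≥0∞}
    (H : ∀ f : X → ℝ≥0∞, Measurable f →
      ∫⁻ x, h x * f x ∂μ ≤ M * (∫⁻ x, f x ^ q ∂μ) ^ (1 / q)) :
    (∫⁻ x, h x ^ p ∂μ) ^ (1 / p) ≤ M := by
  have hp0 := hpq.pos
  -- Cutting h off in height and to sets of finite measure makes its p-th power integrable, so that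
  -- it can be divided out below.
  set hN : ℕ → X → ℝ≥0∞ := fun N => (spanningSets μ N).indicator (fun x => min (h x) N)
    with hN_def
  have hNm : ∀ N, Measurable (hN N) := fun N =>
    (hh.min measurable_const).indicator (measurableSet_spanningSets μ N)
  have hNle : ∀ N x, hN N x ≤ h x := fun N x => by
    by_cases hx : x ∈ spanningSets μ N <;> simp [hN_def, hx]
  have hmono : Monotone hN := by
    intro a b hab x
    by_cases hx : x ∈ spanningSets μ a
    · have hx' := monotone_spanningSets μ hab hx
      simp only [hN_def, hx, hx', indicator_of_mem]
      exact min_le_min_left _ (by exact_mod_cast hab)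
    · simp [hN_def, hx]
  have hsup : ∀ x, ⨆ N, hN N x = h x := by
    intro x
    refine le_antisymm (iSup_le fun N => hNle N x) (le_of_forall_lt fun c hc => ?_)
    obtain ⟨n, hn⟩ := mem_iUnion.1 ((iUnion_spanningSets μ).symm ▸ mem_univ x :
      x ∈ ⋃ i, spanningSets μ i)
    obtain ⟨m, hm⟩ := ENNReal.exists_nat_gt (hc.ne_top)
    refine lt_iSup_iff.2 ⟨max n m, ?_⟩
    have hx' := monotone_spanningSets μ (le_max_left n m) hn
    simp only [hN_def, hx', indicator_of_mem]
    exact lt_min hc (hm.trans_le (by exact_mod_cast le_max_right n m))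
  have key : ∀ N, ∫⁻ x, hN N x ^ p ∂μ ≤ M ^ p := by
    intro N
    set I := ∫⁻ x, hN N x ^ p ∂μ with hI
    have hfin : I ≠ ⊤ := by
      refine ne_of_lt (lt_of_le_of_lt (b := ∫⁻ x in spanningSets μ N, (N : ℝ≥0∞) ^ p ∂μ) ?_ ?_)
      · rw [← lintegral_indicator (measurableSet_spanningSets μ N)]
        refine lintegral_mono fun x => ?_
        by_cases hx : x ∈ spanningSets μ N
        · simp only [hN_def, hx, indicator_of_mem]
          exact ENNReal.rpow_le_rpow (min_le_right _ _) hp0.le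
        · simp [hN_def, hx, hp0]
      · rw [setLIntegral_const]
        exact ENNReal.mul_lt_top (ENNReal.rpow_lt_top_of_nonneg hp0.le (by simp))
          (measure_spanningSets_lt_top μ N)
    have h1 : I ≤ M * I ^ (1 / q) := by
      -- The extremal function in Hölder's inequality: its q-th power is `hN N x ^ p`.
      have := H (fun x => hN N x ^ (p - 1)) ((hNm N).pow_const _)
      have e : ∀ x, (hN N x ^ (p - 1)) ^ q = hN N x ^ p := fun x => by
        rw [← ENNReal.rpow_mul, hpq.sub_one_mul_conj]
      simp only [e] at this
      refine le_trans (lintegral_mono fun x => ?_) this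
      calc hN N x ^ p = hN N x ^ (1 + (p - 1)) := by congr 1; ring
        _ = hN N x * hN N x ^ (p - 1) := by
            rw [ENNReal.rpow_add_of_nonneg _ _ zero_le_one hpq.sub_one_pos.le, ENNReal.rpow_one]
        _ ≤ _ := by gcongr; exact hNle N x
    rcases eq_or_ne I 0 with h0 | h0
    · simp [h0]
    have h2 : I ^ (1 / p) ≤ M := by
      have e : I = I ^ (1 / p) * I ^ (1 / q) := by
        rw [← ENNReal.rpow_add _ _ h0 hfin, one_div, one_div, hpq.inv_add_inv_eq_one,
          ENNReal.rpow_one]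
      have hq0 : I ^ (1 / q) ≠ 0 := by simp [ENNReal.rpow_eq_zero_iff, h0, hfin]
      have hqt : I ^ (1 / q) ≠ ⊤ := ENNReal.rpow_ne_top_of_nonneg (by
        have := hpq.symm.pos; positivity) hfin
      refine (ENNReal.mul_le_mul_iff_left hq0 hqt).1 ?_
      rwa [← e]
    calc I = (I ^ (1 / p)) ^ p := by
          rw [← ENNReal.rpow_mul, one_div_mul_cancel hp0.ne', ENNReal.rpow_one]
      _ ≤ M ^ p := ENNReal.rpow_le_rpow h2 hp0.le
  have : ∫⁻ x, h x ^ p ∂μ ≤ M ^ p := by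
    have e : ∀ x, h x ^ p = ⨆ N, hN N x ^ p := fun x => by
      rw [← hsup x]
      exact (ENNReal.orderIsoRpow p hp0).map_iSup _
    simp only [e]
    rw [lintegral_iSup (fun N => (hNm N).pow_const _)
      (fun a b hab x => ENNReal.rpow_le_rpow (hmono hab x) hp0.le)]
    exact iSup_le key
  calc _ ≤ (M ^ p) ^ (1 / p) := ENNReal.rpow_le_rpow this (by positivity)
    _ = M := by rw [← ENNReal.rpow_mul, mul_one_div_cancel hp0.ne', ENNReal.rpow_one]

/-- Minkowski's integral inequality. -/
theorem lintegral_rpow_lintegral_le {μ : Measure X} {ν : Measure Y} [SigmaFinite μ] [SigmaFinite ν]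
    {r : ℝ} (hr : 1 ≤ r) {F : X → Y → ℝ≥0∞} (hF : Measurable (Function.uncurry F)) :
    (∫⁻ x, (∫⁻ y, F x y ∂ν) ^ r ∂μ) ^ (1 / r) ≤ ∫⁻ y, (∫⁻ x, F x y ^ r ∂μ) ^ (1 / r) ∂ν := by
  rcases hr.eq_or_lt with rfl | hr1
  · simp only [ENNReal.rpow_one, div_one]
    exact (lintegral_lintegral_swap hF.aemeasurable).le
  have hpq := Real.HolderConjugate.conjExponent hr1
  refine lintegral_rpow_le_of_forall_lintegral_mul_le hpq hF.lintegral_prod_right' fun f hf => ?_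
  calc ∫⁻ x, (∫⁻ y, F x y ∂ν) * f x ∂μ = ∫⁻ x, ∫⁻ y, F x y * f x ∂ν ∂μ := by
        refine lintegral_congr fun x => ?_
        rw [lintegral_mul_const _ (hF.of_uncurry_left)]
    _ = ∫⁻ y, ∫⁻ x, F x y * f x ∂μ ∂ν :=
        lintegral_lintegral_swap (hF.mul (hf.comp measurable_fst)).aemeasurable
    _ ≤ ∫⁻ y, (∫⁻ x, F x y ^ r ∂μ) ^ (1 / r) *
          (∫⁻ x, f x ^ r.conjExponent ∂μ) ^ (1 / r.conjExponent) ∂ν :=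
        lintegral_mono fun y => ENNReal.lintegral_mul_le_Lp_mul_Lq μ hpq
          (hF.of_uncurry_right.aemeasurable) hf.aemeasurable
    _ = _ := lintegral_mul_const _ ((Measurable.lintegral_prod_left
          (f := fun x y => F x y ^ r) (hF.pow_const r)).pow_const _)

/-- Minkowski's integral inequality for a countable sum of powers. -/
theorem tsum_rpow_lintegral_le {ι : Type*} [Countable ι] {ν : Measure Y} [SigmaFinite ν]
    {r : ℝ} (hr : 1 ≤ r) {F : ι → Y → ℝ≥0∞} (hF : ∀ i, AEMeasurable (F i) ν) :
    (∑' i, (∫⁻ y, F i y ∂ν) ^ r) ^ (1 / r) ≤ ∫⁻ y, (∑' i, F i y ^ r) ^ (1 / r) ∂ν := by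
  let _ : MeasurableSpace ι := ⊤
  have : MeasurableSingletonClass ι := ⟨fun _ => trivial⟩
  have hG : Measurable (Function.uncurry fun i => (hF i).mk (F i)) :=
    measurable_from_prod_countable_right fun i => (hF i).measurable_mk
  have h1 := lintegral_rpow_lintegral_le (μ := Measure.count) (ν := ν) hr hG
  simp only [lintegral_count] at h1
  have h2 : ∀ᵐ y ∂ν, ∀ i, F i y = (hF i).mk (F i) y := ae_all_iff.2 fun i => (hF i).ae_eq_mk
  calc _ = (∑' i, (∫⁻ y, (hF i).mk (F i) y ∂ν) ^ r) ^ (1 / r) := by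
        simp only [fun i => lintegral_congr_ae (hF i).ae_eq_mk]
    _ ≤ _ := h1
    _ = _ := lintegral_congr_ae (by filter_upwards [h2] with y hy; simp [hy])

/-- A family that is almost everywhere measurable in one variable and, for almost every value of
that variable, continuous in the other one has a jointly measurable version. -/
theorem exists_stronglyMeasurable_uncurry {ν : Measure Y} {Z : Type*} [TopologicalSpace Z]
    [TopologicalSpace.MetrizableSpace Z] [SecondCountableTopology Z] [MeasurableSpace Z]
    [OpensMeasurableSpace Z] {h : Z → Y → ℂ} (hm : ∀ z, AEStronglyMeasurable (h z) ν)
    (hc : ∀ᵐ y ∂ν, Continuous fun z => h z y) :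
    ∃ h' : Z → Y → ℂ, StronglyMeasurable (Function.uncurry h') ∧ ∀ᵐ y ∂ν, ∀ z, h z y = h' z y := by
  obtain ⟨D, hDc, hDd⟩ := TopologicalSpace.exists_countable_dense Z
  have h1 : ∀ᵐ y ∂ν, (Continuous fun z => h z y) ∧ ∀ z ∈ D, h z y = (hm z).mk (h z) y :=
    hc.and ((ae_ball_iff hDc).2 fun z _ => (hm z).ae_eq_mk)
  -- The family is set to zero on a measurable null set containing all bad y; elsewhere each value
  -- is a limit of values on the countable dense set D.
  set N := toMeasurable ν {y | ¬ ((Continuous fun z => h z y) ∧ ∀ z ∈ D, h z y = (hm z).mk (h z) y)}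
    with hN
  have hNm : MeasurableSet N := measurableSet_toMeasurable _ _
  have hN0 : ν N = 0 := by rw [hN, measure_toMeasurable]; exact ae_iff.1 h1
  have hgood : ∀ y ∉ N, (Continuous fun z => h z y) ∧ ∀ z ∈ D, h z y = (hm z).mk (h z) y := by
    intro y hy
    by_contra hcon
    exact hy (subset_toMeasurable ν _ hcon)
  set h' : Z → Y → ℂ := fun z => Nᶜ.indicator (h z) with hh'
  have hc' : ∀ y, Continuous fun z => h' z y := by
    intro y
    by_cases hy : y ∈ N
    · simpa [hh', hy] using continuous_const
    · simpa [hh', hy] using (hgood y hy).1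
  have hD : ∀ z ∈ D, StronglyMeasurable (h' z) := by
    intro z hz
    have : h' z = Nᶜ.indicator ((hm z).mk (h z)) := by
      funext y
      by_cases hy : y ∈ N
      · simp [hh', hy]
      · simp [hh', hy, (hgood y hy).2 z hz]
    rw [this]
    exact (hm z).stronglyMeasurable_mk.indicator hNm.compl
  refine ⟨h', stronglyMeasurable_uncurry_of_continuous_of_stronglyMeasurable hc' fun z => ?_, ?_⟩
  · let _ := TopologicalSpace.metrizableSpaceMetric Z
    obtain ⟨u, hu, hlim⟩ := mem_closure_iff_seq_limit.1 (hDd z)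
    refine stronglyMeasurable_of_tendsto atTop (fun n => hD _ (hu n)) ?_
    rw [tendsto_pi_nhds]
    exact fun y => ((hc' y).tendsto z).comp hlim
  · filter_upwards [measure_eq_zero_iff_ae_notMem.1 hN0] with y hy z
    simp [hh', hy]

end Lintegral

/-! ### The Hardy–Littlewood–Sobolev inequality for (1+|t|)^(-μ) -/

section HardyLittlewoodSobolev

/-- The kernel `(1 + |t|)^{-μ}`. -/
def decayKernel (μ t : ℝ) : ℝ≥0∞ := ENNReal.ofReal ((1 + |t|) ^ (-μ))

theorem measurable_decayKernel (μ : ℝ) : Measurable (decayKernel μ) := by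
  unfold decayKernel; fun_prop

theorem decayKernel_neg (μ t : ℝ) : decayKernel μ (-t) = decayKernel μ t := by
  simp [decayKernel]

theorem decayKernel_le {μ t : ℝ} (hμ : 0 < μ) (ht : 0 < t) :
    decayKernel μ t ≤ ENNReal.ofReal (t ^ (-μ)) := by
  refine ENNReal.ofReal_le_ofReal ?_
  rw [abs_of_pos ht]
  exact Real.rpow_le_rpow_of_nonpos ht (by linarith) (by linarith)

theorem lintegral_le_two_mul_of_even {φ : ℝ → ℝ≥0∞} (hφ : ∀ x, φ (-x) = φ x) :
    ∫⁻ x, φ x = 2 * ∫⁻ x in Ioi 0, φ x := by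
  have h1 : ∫⁻ x in Iic 0, φ x = ∫⁻ x in Ioi 0, φ x := by
    have := (Measure.measurePreserving_neg (volume : Measure ℝ)).setLIntegral_comp_preimage_emb
      (MeasurableEquiv.neg ℝ).measurableEmbedding φ (Ici 0)
    rw [setLIntegral_congr Ioi_ae_eq_Ici, ← this]
    simp [hφ]
  rw [← lintegral_add_compl φ (measurableSet_Ioi (a := (0 : ℝ))), compl_Ioi, h1, two_mul]

/-- Since μ < 1, the majorant |x|^(-μ) is integrable at the origin. -/
theorem lintegral_decayKernel_near {μ : ℝ} (hμ0 : 0 < μ) (hμ1 : μ < 1) {R : ℝ} (hR : 0 < R)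
    (t : ℝ) :
    ∫⁻ τ, {s | |s| < R}.indicator (decayKernel μ) (t - τ) ≤
      ENNReal.ofReal (2 / (1 - μ)) * ENNReal.ofReal (R ^ (1 - μ)) := by
  rw [lintegral_sub_left_eq_self ({s | |s| < R}.indicator (decayKernel μ)) t,
    lintegral_le_two_mul_of_even fun x => by simp [indicator, decayKernel_neg]]
  have h1 : ∫⁻ x in Ioi 0, {s | |s| < R}.indicator (decayKernel μ) x ≤
      ∫⁻ x in Ioc 0 R, ENNReal.ofReal (x ^ (-μ)) := by
    rw [← lintegral_indicator measurableSet_Ioi, ← lintegral_indicator measurableSet_Ioc]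
    refine lintegral_mono fun x => ?_
    by_cases hx : 0 < x
    · by_cases hxR : x < R
      · simpa [indicator, hx, hxR, hxR.le, abs_of_pos hx] using decayKernel_le hμ0 hx
      · simp [indicator, hx, hxR, abs_of_pos hx]
    · simp [indicator, hx]
  have h2 : ∫⁻ x in Ioc 0 R, ENNReal.ofReal (x ^ (-μ)) = ENNReal.ofReal (R ^ (1 - μ) / (1 - μ)) := by
    rw [← ofReal_integral_eq_lintegral_ofReal]
    · rw [← intervalIntegral.integral_of_le hR.le, integral_rpow (Or.inl (by linarith)),
        Real.zero_rpow (by linarith), neg_add_eq_sub, sub_zero]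
    · exact (intervalIntegral.intervalIntegrable_rpow' (by linarith)).1
    · filter_upwards [ae_restrict_mem measurableSet_Ioc] with x hx
      exact Real.rpow_nonneg hx.1.le _
  calc _ ≤ 2 * ENNReal.ofReal (R ^ (1 - μ) / (1 - μ)) := by rw [← h2]; gcongr
    _ = _ := by
      rw [show (2 : ℝ≥0∞) = ENNReal.ofReal 2 by simp, ← ENNReal.ofReal_mul (by norm_num),
        ← ENNReal.ofReal_mul (div_nonneg (by norm_num) (by linarith))]
      congr 1; ring

/-- The exponent 2/μ turns the majorant x^(-μ) into x^(-2), whose tail integral is 1/R. -/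
theorem lintegral_decayKernel_far {μ : ℝ} (hμ0 : 0 < μ) {R : ℝ} (hR : 0 < R) (t : ℝ) :
    ∫⁻ τ, {s | R ≤ |s|}.indicator (decayKernel μ) (t - τ) ^ (2 / μ) ≤
      ENNReal.ofReal (2 * R⁻¹) := by
  rw [lintegral_sub_left_eq_self (fun x => {s | R ≤ |s|}.indicator (decayKernel μ) x ^ (2 / μ)) t,
    lintegral_le_two_mul_of_even fun x => by simp [indicator, decayKernel_neg]]
  have h2μ : 0 < 2 / μ := by positivity
  have h1 : ∫⁻ x in Ioi 0, {s | R ≤ |s|}.indicator (decayKernel μ) x ^ (2 / μ) ≤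
      ∫⁻ x in Ioi R, ENNReal.ofReal (x ^ (-2 : ℝ)) := by
    rw [setLIntegral_congr (Ioi_ae_eq_Ici (a := R)), ← lintegral_indicator measurableSet_Ioi,
      ← lintegral_indicator measurableSet_Ici]
    refine lintegral_mono fun x => ?_
    by_cases hx : 0 < x
    · by_cases hxR : R ≤ x
      · simp only [indicator, mem_Ioi, hx, mem_ofPred_eq, abs_of_pos hx, hxR, mem_Ici, if_true]
        calc decayKernel μ x ^ (2 / μ) ≤ ENNReal.ofReal (x ^ (-μ)) ^ (2 / μ) :=
              ENNReal.rpow_le_rpow (decayKernel_le hμ0 hx) h2μ.le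
          _ = _ := by
            rw [ENNReal.ofReal_rpow_of_pos (by positivity), ← Real.rpow_mul hx.le]
            congr 2; field_simp
      · simp [indicator, hx, hxR, abs_of_pos hx, h2μ]
    · simp [indicator, hx]
  have h2 : ∫⁻ x in Ioi R, ENNReal.ofReal (x ^ (-2 : ℝ)) = ENNReal.ofReal R⁻¹ := by
    rw [← ofReal_integral_eq_lintegral_ofReal]
    · rw [integral_Ioi_rpow_of_lt (by norm_num) hR]
      norm_num [Real.rpow_neg_one]
    · exact integrableOn_Ioi_rpow_of_lt (by norm_num) hR
    · filter_upwards [ae_restrict_mem measurableSet_Ioi] with x hx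
      exact Real.rpow_nonneg (hR.trans hx).le _
  calc _ ≤ 2 * ENNReal.ofReal R⁻¹ := by rw [← h2]; gcongr
    _ = _ := by rw [ENNReal.ofReal_mul (by norm_num)]; simp

/-- Truncated potential estimate behind the Hardy–Littlewood–Sobolev inequality. -/
theorem lintegral_decayKernel_mul_truncation_le {μ : ℝ} (hμ0 : 0 < μ) (hμ1 : μ < 1) :
    ∃ C : ℝ≥0, ∀ g : ℝ → ℝ≥0∞, Measurable g → ∫⁻ τ, g τ ^ (2 / (2 - μ)) ≤ 1 →
      ∀ (A : ℝ≥0∞) (t : ℝ), ∫⁻ τ, decayKernel μ (t - τ) * {τ | g τ ≤ A}.indicator g τ ≤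
        C * A ^ (μ / (2 - μ)) := by
  have hμ2 : 0 < 2 - μ := by linarith
  -- The first two summands come from the near and far parts of the kernel; the 1 makes the constant
  -- visibly nonzero for the case A = ⊤.
  refine ⟨Real.toNNReal (2 / (1 - μ)) + Real.toNNReal (2 ^ (μ / 2)) + 1, fun g hg hg1 A t => ?_⟩
  rcases eq_or_ne A 0 with rfl | hA0
  · have : ∀ τ, {τ | g τ ≤ 0}.indicator g τ = 0 := fun τ => by
      by_cases h : g τ = 0 <;> simp [indicator, h]
    simp only [this]
    simp
  rcases eq_or_ne A ⊤ with rfl | hAt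
  · rw [ENNReal.top_rpow_of_pos (by positivity), ENNReal.mul_top (by simp)]
    exact le_top
  lift A to ℝ≥0 using hAt
  have hA : (0 : ℝ) < A := by
    have : A ≠ 0 := by simpa using hA0
    positivity
  set a : ℝ := NNReal.toReal A with ha
  have hAa : (A : ℝ≥0∞) = ENNReal.ofReal a := by simp [ha]
  -- This radius balances the near bound A R^(1-μ) against the far bound R^(-μ/2): both become
  -- multiples of A^(μ/(2-μ)).
  set R : ℝ := a ^ (-(2 / (2 - μ))) with hR
  have hR0 : 0 < R := by positivity
  have hconj : (2 / μ).HolderConjugate (2 / (2 - μ)) := by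
    rw [Real.holderConjugate_iff]
    refine ⟨by rw [lt_div_iff₀ hμ0]; linarith, by field_simp; ring⟩
  have hpt : ∀ τ, decayKernel μ (t - τ) * {τ | g τ ≤ A}.indicator g τ ≤
      {s | |s| < R}.indicator (decayKernel μ) (t - τ) * A +
      {s | R ≤ |s|}.indicator (decayKernel μ) (t - τ) * g τ := by
    intro τ
    by_cases h : |t - τ| < R
    · refine le_add_right ?_
      simp only [indicator, mem_ofPred_eq, h, if_true]
      gcongr
      split_ifs with h' <;> simp [h']
    · refine le_add_left ?_
      simp only [indicator, mem_ofPred_eq, not_lt.1 h, if_true]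
      gcongr
      split_ifs with h' <;> simp
  have hm1 : Measurable fun τ => {s | |s| < R}.indicator (decayKernel μ) (t - τ) :=
    ((measurable_decayKernel μ).indicator (measurableSet_lt measurable_norm measurable_const)).comp
      (measurable_const.sub measurable_id)
  have hm2 : Measurable fun τ => {s | R ≤ |s|}.indicator (decayKernel μ) (t - τ) :=
    ((measurable_decayKernel μ).indicator (measurableSet_le measurable_const measurable_norm)).comp
      (measurable_const.sub measurable_id)
  have hb1 : ∫⁻ τ, {s | |s| < R}.indicator (decayKernel μ) (t - τ) * A ≤
      ENNReal.ofReal (2 / (1 - μ)) * (A : ℝ≥0∞) ^ (μ / (2 - μ)) := by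
    rw [lintegral_mul_const _ hm1]
    refine (mul_le_mul_left (lintegral_decayKernel_near hμ0 hμ1 hR0 t) _).trans_eq ?_
    rw [mul_assoc, hAa, ENNReal.ofReal_rpow_of_pos hA, ← ENNReal.ofReal_mul (by positivity)]
    congr 2
    rw [hR, ← Real.rpow_mul hA.le]
    nth_rewrite 2 [← Real.rpow_one a]
    rw [← Real.rpow_add hA]
    congr 1; field_simp; ring
  have hb2 : ∫⁻ τ, {s | R ≤ |s|}.indicator (decayKernel μ) (t - τ) * g τ ≤
      ENNReal.ofReal (2 ^ (μ / 2)) * (A : ℝ≥0∞) ^ (μ / (2 - μ)) := by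
    refine (ENNReal.lintegral_mul_le_Lp_mul_Lq volume hconj hm2.aemeasurable
      hg.aemeasurable).trans ?_
    calc _ ≤ (ENNReal.ofReal (2 * R⁻¹)) ^ (1 / (2 / μ)) * 1 ^ (1 / (2 / (2 - μ))) := by
          gcongr
          exact lintegral_decayKernel_far hμ0 hR0 t
      _ = _ := by
        rw [ENNReal.one_rpow, mul_one, hAa, ENNReal.ofReal_rpow_of_pos (by positivity),
          ENNReal.ofReal_rpow_of_pos hA, ← ENNReal.ofReal_mul (by positivity), one_div_div,
          Real.mul_rpow (by norm_num) (by positivity), hR, ← Real.rpow_neg hA.le,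
          ← Real.rpow_mul hA.le]
        congr 3
        field_simp
  calc _ ≤ _ := lintegral_mono hpt
    _ = _ := lintegral_add_left (hm1.mul_const _) _
    _ ≤ _ := add_le_add hb1 hb2
    _ ≤ _ := by
      rw [← add_mul]
      gcongr
      rw [ENNReal.ofReal, ENNReal.ofReal]
      exact_mod_cast le_self_add

/-- The diagonal case of the Hardy–Littlewood–Sobolev inequality on the line. -/
theorem hardyLittlewoodSobolev {μ : ℝ} (hμ0 : 0 < μ) (hμ1 : μ < 1) :
    ∃ C : ℝ≥0, ∀ g : ℝ → ℝ≥0∞, AEMeasurable g →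
      (∫⁻ t, (∫⁻ τ, decayKernel μ (t - τ) * g τ) ^ (2 / μ)) ^ (1 / (2 / μ)) ≤
        C * (∫⁻ τ, g τ ^ (2 / (2 - μ))) ^ (1 / (2 / (2 - μ))) := by
  have hμ2 : 0 < 2 - μ := by linarith
  set r := 2 / (2 - μ) with hr
  have hr0 : 0 < r := by positivity
  have hconj : (2 / μ).HolderConjugate r := by
    rw [Real.holderConjugate_iff]
    refine ⟨by rw [lt_div_iff₀ hμ0]; linarith, by rw [hr]; field_simp; ring⟩
  obtain ⟨C, hC⟩ := lintegral_decayKernel_mul_truncation_le hμ0 hμ1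
  have hker : Measurable fun z : ℝ × ℝ => decayKernel μ (z.1 - z.2) :=
    (measurable_decayKernel μ).comp (measurable_fst.sub measurable_snd)
  -- Where g τ ≤ f t, integrating first in τ gives a multiple of (f t)^(μ/(2-μ)); together with the
  -- remaining factor f t this is (f t)^r.
  have hone : ∀ g f : ℝ → ℝ≥0∞, Measurable g → Measurable f → ∫⁻ τ, g τ ^ r ≤ 1 →
      ∫⁻ τ, f τ ^ r ≤ 1 →
      ∫⁻ t, ∫⁻ τ, decayKernel μ (t - τ) * {τ | g τ ≤ f t}.indicator g τ * f t ≤ C := by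
    intro g f hg hf hg1 hf1
    have e : ∀ x : ℝ≥0∞, x ^ (μ / (2 - μ)) * x = x ^ r := fun x => by
      nth_rewrite 2 [← ENNReal.rpow_one x]
      rw [← ENNReal.rpow_add_of_nonneg _ _ (by positivity) zero_le_one]
      congr 1; rw [hr]; field_simp; ring
    calc _ ≤ ∫⁻ t, C * f t ^ r := by
          refine lintegral_mono fun t => ?_
          rw [lintegral_mul_const]
          · refine (mul_le_mul_left (hC g hg hg1 (f t) t) _).trans_eq ?_
            rw [mul_assoc, e]
          · exact (hker.of_uncurry_left (f := fun a b => decayKernel μ (a - b))).mul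
              (hg.indicator (measurableSet_le hg measurable_const))
      _ ≤ C := by
          rw [lintegral_const_mul _ (hf.pow_const _)]
          exact (mul_le_mul_right hf1 _).trans_eq (mul_one _)
  have hbil : ∀ g f : ℝ → ℝ≥0∞, Measurable g → Measurable f → ∫⁻ τ, g τ ^ r ≤ 1 →
      ∫⁻ τ, f τ ^ r ≤ 1 → ∫⁻ t, ∫⁻ τ, decayKernel μ (t - τ) * g τ * f t ≤ 2 * C := by
    intro g f hg hf hg1 hf1
    have hmeas : ∀ a b : ℝ → ℝ≥0∞, Measurable a → Measurable b → Measurable fun z : ℝ × ℝ =>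
        decayKernel μ (z.1 - z.2) * {τ | a τ ≤ b z.1}.indicator a z.2 * b z.1 := by
      intro a b ha hb
      refine (hker.mul ?_).mul (hb.comp measurable_fst)
      exact (ha.comp measurable_snd).indicator
        (measurableSet_le (ha.comp measurable_snd) (hb.comp measurable_fst))
    -- The kernel is even, so the region f t ≤ g τ is the previous case with the two functions
    -- exchanged.
    calc _ ≤ ∫⁻ t, ∫⁻ τ, (decayKernel μ (t - τ) * {τ | g τ ≤ f t}.indicator g τ * f t +
            decayKernel μ (τ - t) * {t | f t ≤ g τ}.indicator f t * g τ) := by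
          refine lintegral_mono fun t => lintegral_mono fun τ => ?_
          rcases le_total (g τ) (f t) with h | h
          · refine le_add_right ?_
            simp [indicator, h]
          · refine le_add_left ?_
            rw [← neg_sub t τ, decayKernel_neg]
            simp only [indicator, mem_ofPred_eq, h, if_true]
            rw [mul_right_comm]
      _ = (∫⁻ t, ∫⁻ τ, decayKernel μ (t - τ) * {τ | g τ ≤ f t}.indicator g τ * f t) +
            ∫⁻ t, ∫⁻ τ, decayKernel μ (τ - t) * {t | f t ≤ g τ}.indicator f t * g τ := by
          rw [← lintegral_add_left (hmeas g f hg hf).lintegral_prod_right']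
          exact lintegral_congr fun t =>
            lintegral_add_left ((hmeas g f hg hf).comp measurable_prodMk_left) _
      _ ≤ C + C := by
          refine add_le_add (hone g f hg hf hg1 hf1) ?_
          rw [lintegral_lintegral_swap]
          · exact hone f g hf hg hf1 hg1
          · exact ((hmeas f g hf hg).comp measurable_swap).aemeasurable
      _ = _ := (two_mul _).symm
  have hae : ∀ g : ℝ → ℝ≥0∞, Measurable g → ∫⁻ τ, g τ ^ r = 0 → ∀ᵐ τ, g τ = 0 := by
    intro g hg h0
    filter_upwards [(lintegral_eq_zero_iff (hg.pow_const r)).1 h0] with τ hτ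
    simpa [ENNReal.rpow_eq_zero_iff, hr0, hr0.le, hr0.not_gt] using hτ
  have hscale : ∀ g : ℝ → ℝ≥0∞, Measurable g → ∫⁻ τ, g τ ^ r ≠ 0 → ∫⁻ τ, g τ ^ r ≠ ⊤ →
      ∫⁻ τ, (((∫⁻ τ, g τ ^ r) ^ (1 / r))⁻¹ * g τ) ^ r ≤ 1 := by
    intro g hg h0 ht
    simp only [ENNReal.mul_rpow_of_nonneg _ _ hr0.le]
    rw [lintegral_const_mul _ (hg.pow_const r), ENNReal.inv_rpow, ← ENNReal.rpow_mul,
      one_div_mul_cancel hr0.ne', ENNReal.rpow_one, ENNReal.inv_mul_cancel h0 ht]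
  have hmain : ∀ g f : ℝ → ℝ≥0∞, Measurable g → Measurable f →
      ∫⁻ t, (∫⁻ τ, decayKernel μ (t - τ) * g τ) * f t ≤
        (2 * C + 1) * (∫⁻ τ, g τ ^ r) ^ (1 / r) * (∫⁻ τ, f τ ^ r) ^ (1 / r) := by
    intro g f hg hf
    -- Zero and infinite norms are split off because the normalization divides by them.
    rcases eq_or_ne (∫⁻ τ, g τ ^ r) 0 with hg0 | hg0
    · have h1 : ∀ t, ∫⁻ τ, decayKernel μ (t - τ) * g τ = 0 := fun t => by
        rw [← lintegral_zero (μ := volume) (α := ℝ)]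
        exact lintegral_congr_ae (by filter_upwards [hae g hg hg0] with τ hτ; simp [hτ])
      simp [h1]
    rcases eq_or_ne (∫⁻ τ, f τ ^ r) 0 with hf0 | hf0
    · refine (le_of_eq ?_).trans zero_le
      rw [← lintegral_zero (μ := volume) (α := ℝ)]
      exact lintegral_congr_ae (by filter_upwards [hae f hf hf0] with τ hτ; simp [hτ])
    set X := (∫⁻ τ, g τ ^ r) ^ (1 / r) with hX
    set Y := (∫⁻ τ, f τ ^ r) ^ (1 / r) with hY
    have hr0' : 0 < 1 / r := by positivity
    have hX0 : X ≠ 0 := by simp [hX, ENNReal.rpow_eq_zero_iff, hg0, hr0.le]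
    have hY0 : Y ≠ 0 := by simp [hY, ENNReal.rpow_eq_zero_iff, hf0, hr0.le]
    rcases eq_or_ne (∫⁻ τ, g τ ^ r) ⊤ with hgt | hgt
    · rw [hX, hgt, ENNReal.top_rpow_of_pos hr0', ENNReal.mul_top (by simp), ENNReal.top_mul hY0]
      exact le_top
    rcases eq_or_ne (∫⁻ τ, f τ ^ r) ⊤ with hft | hft
    · rw [hY, hft, ENNReal.top_rpow_of_pos hr0', ENNReal.mul_top (mul_ne_zero (by simp) hX0)]
      exact le_top
    have hXt : X ≠ ⊤ := ENNReal.rpow_ne_top_of_nonneg hr0'.le hgt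
    have hYt : Y ≠ ⊤ := ENNReal.rpow_ne_top_of_nonneg hr0'.le hft
    have hb := hbil (fun τ => X⁻¹ * g τ) (fun t => Y⁻¹ * f t) (hg.const_mul _) (hf.const_mul _)
      (hscale g hg hg0 hgt) (hscale f hf hf0 hft)
    have hmg : ∀ t, Measurable fun τ => decayKernel μ (t - τ) * g τ := fun t =>
      (hker.of_uncurry_left (f := fun a b => decayKernel μ (a - b))).mul hg
    have hmI : Measurable fun t => (∫⁻ τ, decayKernel μ (t - τ) * g τ) * f t :=
      (Measurable.lintegral_prod_right' (f := fun z : ℝ × ℝ => decayKernel μ (z.1 - z.2) * g z.2)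
        (hker.mul (hg.comp measurable_snd))).mul hf
    have heq : ∀ t, ∫⁻ τ, decayKernel μ (t - τ) * (X⁻¹ * g τ) * (Y⁻¹ * f t) =
        X⁻¹ * Y⁻¹ * ((∫⁻ τ, decayKernel μ (t - τ) * g τ) * f t) := fun t => by
      rw [← lintegral_mul_const _ (hmg t), ← lintegral_const_mul _ ((hmg t).mul_const _)]
      exact lintegral_congr fun τ => by ring
    simp only [heq] at hb
    rw [lintegral_const_mul _ hmI] at hb
    set I := ∫⁻ t, (∫⁻ τ, decayKernel μ (t - τ) * g τ) * f t
    calc I = X * Y * (X⁻¹ * Y⁻¹ * I) := by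
          rw [← mul_assoc, mul_mul_mul_comm, ENNReal.mul_inv_cancel hX0 hXt,
            ENNReal.mul_inv_cancel hY0 hYt, one_mul, one_mul]
      _ ≤ X * Y * (2 * C) := by gcongr
      _ ≤ X * Y * (2 * C + 1) := by gcongr; exact le_self_add
      _ = _ := by ring
  refine ⟨2 * C + 1, fun g hg => ?_⟩
  have hm := hg.measurable_mk
  have e1 : ∫⁻ τ, g τ ^ r = ∫⁻ τ, hg.mk g τ ^ r :=
    lintegral_congr_ae (by filter_upwards [hg.ae_eq_mk] with τ hτ; rw [hτ])
  have e2 : ∀ t, ∫⁻ τ, decayKernel μ (t - τ) * g τ = ∫⁻ τ, decayKernel μ (t - τ) * hg.mk g τ :=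
    fun t => lintegral_congr_ae (by filter_upwards [hg.ae_eq_mk] with τ hτ; rw [hτ])
  simp only [e1, e2]
  refine lintegral_rpow_le_of_forall_lintegral_mul_le hconj
    (Measurable.lintegral_prod_right' (f := fun z : ℝ × ℝ => decayKernel μ (z.1 - z.2) *
      hg.mk g z.2) (hker.mul (hm.comp measurable_snd))) fun f hf => ?_
  have := hmain _ f hm hf
  push_cast
  exact this

end HardyLittlewoodSobolev

end ModSpace

namespace ModSpace

open MeasureTheory Set Filter Topology SchwartzMap

/-! ### Exchanging a functional with a weak integral -/

section WeakIntegral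

/-- A functional that is bounded by a seminorm commutes with weak integrals that converge
absolutely with respect to that seminorm. -/
theorem integral_mul_apply_eq_of_seminorm {S I X : Type*} [AddCommGroup S] [Module ℂ S]
    (ℓ : I → S →ₗ[ℂ] ℂ) (T : S →ₗ[ℂ] ℂ) (q : Seminorm ℂ S) (hℓ : ∀ i f, ‖ℓ i f‖ ≤ q f)
    (hq : ∀ f B, 0 ≤ B → (∀ i, ‖ℓ i f‖ ≤ B) → q f ≤ B) (C : ℝ) (hT : ∀ f, ‖T f‖ ≤ C * q f)
    [TopologicalSpace X] [SecondCountableTopology X] [MeasurableSpace X] [OpensMeasurableSpace X]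
    {ν : Measure X} (Φ : X → S)
    (hΦ : ∀ x₀, Tendsto (fun x => q (Φ x - Φ x₀)) (𝓝 x₀) (𝓝 0)) (w : X → ℂ) (hw : Continuous w)
    (hint : Integrable (fun x => ‖w x‖ * q (Φ x)) ν) (ψ : S)
    (hψ : ∀ i, ∫ x, w x * ℓ i (Φ x) ∂ν = ℓ i ψ) :
    Integrable (fun x => w x * T (Φ x)) ν ∧ T ψ = ∫ x, w x * T (Φ x) ∂ν := by
  -- Evaluating all ℓ i at once embeds S, modulo the kernel of q, isometrically into ℓ^∞, where
  -- Bochner integrals are available.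
  let ι : S →ₗ[ℂ] lp (fun _ : I => ℂ) ⊤ :=
    { toFun := fun f => ⟨fun i => ℓ i f, memℓp_infty ⟨q f, by rintro _ ⟨i, rfl⟩; exact hℓ i f⟩⟩
      map_add' := fun f g => by ext i; exact map_add (ℓ i) f g
      map_smul' := fun c f => by ext i; exact map_smul (ℓ i) c f }
  have hι : ∀ f i, ι f i = ℓ i f := fun f i => rfl
  have hnorm : ∀ f, ‖ι f‖ = q f := fun f =>
    le_antisymm (lp.norm_le_of_forall_le (apply_nonneg q f) (hℓ · f))
      (hq f _ (norm_nonneg _) fun i => by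
        rw [← hι]; exact lp.norm_apply_le_norm ENNReal.top_ne_zero (ι f) i)
  have hker : ∀ f, ι f = 0 → T f = 0 := fun f hf => by
    have := hT f
    rw [← hnorm, hf, norm_zero, mul_zero] at this
    exact norm_le_zero_iff.1 this
  -- T factors through the image of ι and is bounded there; Hahn–Banach extends it to the complete
  -- space in which the integral is formed.
  obtain ⟨L, hL⟩ : ∃ L : lp (fun _ : I => ℂ) ⊤ →L[ℂ] ℂ, ∀ f, L (ι f) = T f := by
    let e : (S ⧸ LinearMap.ker ι) ≃ₗ[ℂ] LinearMap.range ι := ι.quotKerEquivRange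
    let T' : LinearMap.range ι →ₗ[ℂ] ℂ :=
      ((LinearMap.ker ι).liftQ T fun f hf => hker f hf) ∘ₗ e.symm.toLinearMap
    have hT' : ∀ f, T' ⟨ι f, LinearMap.mem_range_self ι f⟩ = T f := fun f => by
      have : e.symm ⟨ι f, LinearMap.mem_range_self ι f⟩ = Submodule.Quotient.mk f := by
        rw [LinearEquiv.symm_apply_eq]; rfl
      simp only [T', LinearMap.comp_apply, LinearEquiv.coe_coe, this]
      exact Submodule.liftQ_apply _ _ _
    let T'' : StrongDual ℂ (LinearMap.range ι) := T'.mkContinuous C (by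
      rintro ⟨_, f, rfl⟩
      rw [hT']
      simpa [hnorm] using hT f)
    obtain ⟨L, hL, -⟩ := exists_extension_norm_eq _ T''
    exact ⟨L, fun f => (hL ⟨ι f, LinearMap.mem_range_self ι f⟩).trans (hT' f)⟩
  have hcont : Continuous fun x => ι (Φ x) := by
    rw [continuous_iff_continuousAt]
    intro x₀
    rw [ContinuousAt, tendsto_iff_norm_sub_tendsto_zero]
    simpa only [← map_sub, hnorm] using hΦ x₀
  have hbi : Integrable (fun x => w x • ι (Φ x)) ν := by
    refine hint.mono' (hw.smul hcont).aestronglyMeasurable (ae_of_all _ fun x => ?_)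
    rw [norm_smul, hnorm]
  have hJ : ∫ x, w x • ι (Φ x) ∂ν = ι ψ := by
    ext i
    rw [hι, ← hψ i]
    let ev : lp (fun _ : I => ℂ) ⊤ →L[ℂ] ℂ := LinearMap.mkContinuous
      { toFun := fun f => f i, map_add' := fun _ _ => rfl, map_smul' := fun _ _ => rfl } 1
      (fun f => by rw [one_mul]; exact lp.norm_apply_le_norm ENNReal.top_ne_zero f i)
    have := ev.integral_comp_comm hbi
    exact this.symm
  have h1 := L.integral_comp_comm hbi
  have h2 := L.integrable_comp hbi
  simp only [map_smul, hL, smul_eq_mul, hJ] at h1 h2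
  exact ⟨h2, h1.symm⟩

end WeakIntegral

/-! ### Translates of Schwartz functions -/

section Translation

variable {V : Type*} [NormedAddCommGroup V] [NormedSpace ℝ V]

/-- Follows from ‖y‖ ≤ (1+‖y-z‖)(1+‖x‖). Keeping z separate from x covers both a translate itself
and all points of a segment between two translation vectors. -/
theorem norm_pow_mul_iteratedFDeriv_translate_le (K : 𝓢(V, ℂ)) (k m : ℕ) :
    ∃ C, 0 ≤ C ∧ ∀ x y z : V, ‖z‖ ≤ ‖x‖ →
      ‖y‖ ^ k * ‖iteratedFDeriv ℝ m K (y - z)‖ ≤ C * (1 + ‖x‖) ^ k := by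
  refine ⟨2 ^ k * (Finset.Iic (k, m)).sup (fun m => SchwartzMap.seminorm ℝ m.1 m.2) K,
    by positivity, fun x y z hz => ?_⟩
  have h1 := one_add_le_sup_seminorm_apply (𝕜 := ℝ) (m := (k, m)) le_rfl le_rfl K (y - z)
  have h2 : ‖y‖ ≤ (1 + ‖y - z‖) * (1 + ‖x‖) := by
    have : ‖y‖ ≤ ‖y - z‖ + ‖z‖ := by simpa using norm_add_le (y - z) z
    nlinarith [norm_nonneg (y - z), norm_nonneg x]
  calc _ ≤ ((1 + ‖y - z‖) * (1 + ‖x‖)) ^ k * ‖iteratedFDeriv ℝ m K (y - z)‖ := by gcongr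
    _ = ((1 + ‖y - z‖) ^ k * ‖iteratedFDeriv ℝ m K (y - z)‖) * (1 + ‖x‖) ^ k := by
        rw [mul_pow]; ring
    _ ≤ _ := by gcongr

theorem iteratedFDeriv_compSubConstCLM (K : 𝓢(V, ℂ)) (m : ℕ) (x y : V) :
    iteratedFDeriv ℝ m (compSubConstCLM ℂ x K) y = iteratedFDeriv ℝ m K (y - x) :=
  iteratedFDeriv_comp_sub (𝕜 := ℝ) (f := K) m x y

theorem seminorm_compSubConstCLM_le (K : 𝓢(V, ℂ)) (k m : ℕ) :
    ∃ C, 0 ≤ C ∧ ∀ x : V,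
      SchwartzMap.seminorm ℂ k m (compSubConstCLM ℂ x K) ≤ C * (1 + ‖x‖) ^ k := by
  obtain ⟨C, hC, h⟩ := norm_pow_mul_iteratedFDeriv_translate_le K k m
  refine ⟨C, hC, fun x => seminorm_le_bound ℂ k m _ (by positivity) fun y => ?_⟩
  rw [iteratedFDeriv_compSubConstCLM]
  exact h x y x le_rfl

/-- Mean value inequality for the m-th derivative along the segment from y - x' to y - x, at the
cost of one more derivative of K. -/
theorem seminorm_compSubConstCLM_sub_le (K : 𝓢(V, ℂ)) (k m : ℕ) :
    ∃ C, 0 ≤ C ∧ ∀ x x' : V,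
      SchwartzMap.seminorm ℂ k m (compSubConstCLM ℂ x K - compSubConstCLM ℂ x' K) ≤
        C * (1 + (‖x‖ + ‖x'‖)) ^ k * ‖x - x'‖ := by
  obtain ⟨C, hC, h⟩ := norm_pow_mul_iteratedFDeriv_translate_le K k (m + 1)
  refine ⟨C, hC, fun x x' => seminorm_le_bound ℂ k m _ (by positivity) fun y => ?_⟩
  have e : iteratedFDeriv ℝ m (compSubConstCLM ℂ x K - compSubConstCLM ℂ x' K : 𝓢(V, ℂ)) y =
      iteratedFDeriv ℝ m K (y - x) - iteratedFDeriv ℝ m K (y - x') := by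
    rw [← iteratedFDeriv_compSubConstCLM, ← iteratedFDeriv_compSubConstCLM]
    exact iteratedFDeriv_sub_apply ((compSubConstCLM ℂ x K).smooth m).contDiffAt
      ((compSubConstCLM ℂ x' K).smooth m).contDiffAt
  rw [e]
  set B := C * (1 + (‖x‖ + ‖x'‖)) ^ k
  rcases (pow_nonneg (norm_nonneg y) k).eq_or_lt with h0 | hpos
  · rw [← h0, zero_mul]; positivity
  have hseg : ∀ z ∈ segment ℝ (y - x') (y - x), ‖fderiv ℝ (iteratedFDeriv ℝ m K) z‖ ≤
      B / ‖y‖ ^ k := by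
    intro z hz
    rw [norm_fderiv_iteratedFDeriv, le_div_iff₀' hpos]
    obtain ⟨a, b, ha, hb, hab, rfl⟩ := hz
    have hx0 : ‖a • x' + b • x‖ ≤ ‖(‖x‖ + ‖x'‖)‖ := by
      rw [Real.norm_of_nonneg (by positivity)]
      calc _ ≤ ‖a • x'‖ + ‖b • x‖ := norm_add_le _ _
        _ = a * ‖x'‖ + b * ‖x‖ := by rw [norm_smul_of_nonneg ha, norm_smul_of_nonneg hb]
        _ ≤ _ := by nlinarith [norm_nonneg x, norm_nonneg x']
    have e2 : a • (y - x') + b • (y - x) = y - (a • x' + b • x) := by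
      rw [smul_sub, smul_sub, sub_add_sub_comm, ← add_smul, hab, one_smul]
    rw [e2]
    rcases le_total ‖x‖ ‖x'‖ with hxx | hxx
    · refine (h x' y _ ?_).trans ?_
      · calc _ ≤ a * ‖x'‖ + b * ‖x‖ := by
              refine (norm_add_le _ _).trans_eq ?_
              rw [norm_smul_of_nonneg ha, norm_smul_of_nonneg hb]
          _ ≤ a * ‖x'‖ + b * ‖x'‖ := by gcongr
          _ = _ := by rw [← add_mul, hab, one_mul]
      · simp only [B]; gcongr; linarith [norm_nonneg x]
    · refine (h x y _ ?_).trans ?_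
      · calc _ ≤ a * ‖x'‖ + b * ‖x‖ := by
              refine (norm_add_le _ _).trans_eq ?_
              rw [norm_smul_of_nonneg ha, norm_smul_of_nonneg hb]
          _ ≤ a * ‖x‖ + b * ‖x‖ := by gcongr
          _ = _ := by rw [← add_mul, hab, one_mul]
      · simp only [B]; gcongr; linarith [norm_nonneg x']
  have hmv := (convex_segment (𝕜 := ℝ) (y - x') (y - x)).norm_image_sub_le_of_norm_fderiv_le
    (f := iteratedFDeriv ℝ m K)
    (fun z _ => ((K.smooth ⊤).differentiable_iteratedFDeriv
      (mod_cast ENat.natCast_lt_top m)) z) hseg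
    (left_mem_segment ℝ _ _) (right_mem_segment ℝ _ _)
  rw [sub_sub_sub_cancel_left, norm_sub_rev x' x] at hmv
  calc _ ≤ ‖y‖ ^ k * (B / ‖y‖ ^ k * ‖x - x'‖) := by gcongr
    _ = _ := by field_simp

theorem continuous_compSubConstCLM (K : 𝓢(V, ℂ)) :
    Continuous fun x : V => compSubConstCLM ℂ x K := by
  rw [continuous_iff_continuousAt]
  intro x₀
  refine ((schwartz_withSeminorms ℂ V ℂ).tendsto_nhds _ _).2 fun i ε hε => ?_
  obtain ⟨C, hC, h⟩ := seminorm_compSubConstCLM_sub_le K i.1 i.2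
  have hlim : Tendsto (fun x : V => C * (1 + (‖x‖ + ‖x₀‖)) ^ i.1 * ‖x - x₀‖) (𝓝 x₀) (𝓝 0) := by
    have : Continuous fun x : V => C * (1 + (‖x‖ + ‖x₀‖)) ^ i.1 * ‖x - x₀‖ := by fun_prop
    simpa using this.tendsto x₀
  filter_upwards [hlim.eventually (gt_mem_nhds hε)] with x hx
  exact (h x x₀).trans_lt hx

open LineDeriv in
theorem iteratedLineDerivOp_compSubConstCLM (K : 𝓢(V, ℂ)) {m : ℕ} (v : Fin m → V) (x y : V) :
    (∂^{v} (compSubConstCLM ℂ x K)) y = (∂^{v} K) (y - x) := by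
  rw [iteratedLineDerivOp_eq_iteratedFDeriv, iteratedLineDerivOp_eq_iteratedFDeriv,
    iteratedFDeriv_compSubConstCLM]

end Translation

/-! ### Tempered distributions applied to convolutions -/

section Convolution

open LineDeriv

variable {V : Type*} [NormedAddCommGroup V] [InnerProductSpace ℝ V] [FiniteDimensional ℝ V]
  [MeasurableSpace V] [BorelSpace V]

/-- Convolution of scalar Schwartz functions. -/
def conv (K φ : 𝓢(V, ℂ)) : 𝓢(V, ℂ) :=
  SchwartzMap.convolution (ContinuousLinearMap.mul ℂ ℂ) K φ

theorem conv_apply (K φ : 𝓢(V, ℂ)) (y : V) : conv K φ y = ∫ x, φ x * K (y - x) := by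
  rw [conv, SchwartzMap.convolution_apply, MeasureTheory.convolution_eq_swap]
  simp [mul_comm]

theorem fourier_conv (K φ : 𝓢(V, ℂ)) (ξ : V) : 𝓕 (conv K φ) ξ = 𝓕 K ξ * 𝓕 φ ξ := by
  rw [conv, SchwartzMap.fourier_convolution]; simp

/-- On the Fourier side the derivative is multiplication by a scalar factor, which may be attached
to K instead of to the whole product. -/
theorem lineDerivOp_conv (K φ : 𝓢(V, ℂ)) (v : V) : ∂_{v} (conv K φ) = conv (∂_{v} K) φ := by
  have h : (fun ξ : V => (inner ℝ ξ v : ℝ)).HasTemperateGrowth := by fun_prop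
  apply (FourierTransform.fourierEquiv ℂ 𝓢(V, ℂ)).injective
  ext ξ
  change 𝓕 (∂_{v} (conv K φ)) ξ = 𝓕 (conv (∂_{v} K) φ) ξ
  rw [fourier_conv, SchwartzMap.fourier_lineDerivOp_eq, SchwartzMap.fourier_lineDerivOp_eq]
  simp [h, fourier_conv]
  ring

theorem iteratedLineDerivOp_conv (K φ : 𝓢(V, ℂ)) {m : ℕ} (v : Fin m → V) :
    ∂^{v} (conv K φ) = conv (∂^{v} K) φ := by
  induction m with
  | zero => simp
  | succ m ih => rw [iteratedLineDerivOp_succ_left, ih, lineDerivOp_conv,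
      iteratedLineDerivOp_succ_left]

/-- A tempered distribution applied to a convolution is a weak integral. -/
theorem apply_conv (T : 𝓢'(V, ℂ)) (K φ : 𝓢(V, ℂ)) :
    Integrable (fun x => φ x * T (compSubConstCLM ℂ x K)) ∧
      T (conv K φ) = ∫ x, φ x * T (compSubConstCLM ℂ x K) := by
  obtain ⟨s, C, -, hTC⟩ := Seminorm.bound_of_continuous (schwartz_withSeminorms ℂ V ℂ)
    ((normSeminorm ℂ ℂ).comp (T : 𝓢(V, ℂ) →ₗ[ℂ] ℂ)) (by
      exact continuous_norm.comp (map_continuous T))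
  -- The seminorm q below is the supremum of the absolute values of these normalized directional
  -- derivatives. If some direction is zero, the inverse is 0 and the functional vanishes.
  let ℓ : (Σ i : s, V × (Fin i.1.2 → V)) → 𝓢(V, ℂ) →ₗ[ℂ] ℂ := fun j =>
    { toFun := fun f => ((‖j.2.1‖ ^ j.1.1.1 * (∏ a, ‖j.2.2 a‖)⁻¹ : ℝ) : ℂ) * (∂^{j.2.2} f) j.2.1
      map_add' := fun f g => by simp [iteratedLineDerivOp_add, mul_add]
      map_smul' := fun c f => by simp [iteratedLineDerivOp_smul]; ring }
  have hℓn : ∀ j f, ‖ℓ j f‖ =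
      ‖j.2.1‖ ^ j.1.1.1 * ((∏ a, ‖j.2.2 a‖)⁻¹ * ‖iteratedFDeriv ℝ j.1.1.2 f j.2.1 j.2.2‖) := by
    intro j f
    rw [← iteratedLineDerivOp_eq_iteratedFDeriv, ← mul_assoc]
    change ‖((‖j.2.1‖ ^ j.1.1.1 * (∏ a, ‖j.2.2 a‖)⁻¹ : ℝ) : ℂ) * (∂^{j.2.2} f) j.2.1‖ = _
    rw [norm_mul, Complex.norm_real, Real.norm_of_nonneg (by positivity)]
  set q : Seminorm ℂ 𝓢(V, ℂ) := s.sup (schwartzSeminormFamily ℂ V ℂ)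
  have hqc : Continuous q := Seminorm.continuous_finsetSup fun i _ =>
    (schwartz_withSeminorms ℂ V ℂ).continuous_seminorm i
  have hqle : ∀ i ∈ s, ∀ f, SchwartzMap.seminorm ℂ i.1 i.2 f ≤ q f := fun i hi f =>
    Seminorm.le_def.1 (Finset.le_sup (f := schwartzSeminormFamily ℂ V ℂ) hi) f
  refine integral_mul_apply_eq_of_seminorm ℓ (T : 𝓢(V, ℂ) →ₗ[ℂ] ℂ) q ?_ ?_ C
    (fun f => Seminorm.le_def.1 hTC f) _ ?_ _ φ.continuous ?_ _ ?_
  · intro j f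
    rw [hℓn]
    refine le_trans ?_ ((le_seminorm ℂ j.1.1.1 j.1.1.2 f j.2.1).trans (hqle _ j.1.2 f))
    gcongr
    refine inv_mul_le_of_le_mul₀ (by positivity) (by positivity) ?_
    rw [mul_comm]
    exact ContinuousMultilinearMap.le_opNorm _ _
  · intro f B hB h
    refine Seminorm.finset_sup_apply_le hB fun i hi => seminorm_le_bound ℂ _ _ _ hB fun y => ?_
    have : ‖(‖y‖ ^ i.1) • iteratedFDeriv ℝ i.2 f y‖ ≤ B := by
      refine ContinuousMultilinearMap.opNorm_le_bound hB fun v => ?_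
      have hv := h ⟨⟨i, hi⟩, y, v⟩
      rw [hℓn] at hv
      rw [smul_apply, norm_smul, norm_pow, norm_norm]
      rcases (Finset.prod_nonneg fun a _ => norm_nonneg (v a) :
        0 ≤ ∏ a, ‖v a‖).eq_or_lt with h0 | hpos
      · have := (iteratedFDeriv ℝ i.2 f y).le_opNorm v
        rw [← h0, mul_zero] at this ⊢
        rw [le_antisymm this (norm_nonneg _), mul_zero]
      · calc _ = ‖y‖ ^ i.1 * ((∏ a, ‖v a‖)⁻¹ * ‖iteratedFDeriv ℝ i.2 f y v‖) * ∏ a, ‖v a‖ := by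
              field_simp
          _ ≤ _ := by gcongr
    rwa [norm_smul, norm_pow, norm_norm] at this
  · intro x₀
    have : Continuous fun x => q (compSubConstCLM ℂ x K - compSubConstCLM ℂ x₀ K) :=
      hqc.comp ((continuous_compSubConstCLM K).sub continuous_const)
    simpa using this.tendsto x₀
  -- The seminorms of the translates grow polynomially in x, which the decay of φ absorbs.
  · have hb : ∃ N : ℕ, ∃ D, ∀ x : V, q (compSubConstCLM ℂ x K) ≤ D * (1 + ‖x‖) ^ N := by
      choose D hD h using fun i : ℕ × ℕ => seminorm_compSubConstCLM_le K i.1 i.2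
      refine ⟨s.sup Prod.fst, ∑ i ∈ s, D i, fun x => ?_⟩
      have hs := Finset.sum_nonneg fun i (_ : i ∈ s) => hD i
      refine Seminorm.finset_sup_apply_le (by positivity) fun i hi => ?_
      refine (h i x).trans ?_
      have h1 := Finset.single_le_sum (fun i _ => hD i) hi
      have h2 : i.1 ≤ s.sup Prod.fst := Finset.le_sup (f := Prod.fst) hi
      have h3 : (1 : ℝ) ≤ 1 + ‖x‖ := by linarith [norm_nonneg x]
      have := hD i
      gcongr
    obtain ⟨N, D, hD⟩ := hb
    have hint : Integrable (fun x => D * ((2 : ℝ) ^ N * (‖x‖ ^ N * ‖φ x‖ + ‖x‖ ^ 0 * ‖φ x‖))) :=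
      (((φ.integrable_pow_mul volume N).add (φ.integrable_pow_mul volume 0)).const_mul _).const_mul _
    refine hint.mono' ((φ.continuous.norm.mul
      (hqc.comp (continuous_compSubConstCLM K))).aestronglyMeasurable) (ae_of_all _ fun x => ?_)
    have hD0 : 0 ≤ D := by
      have := (apply_nonneg q _).trans (hD 0)
      simpa using this
    have h2 : (1 + ‖x‖) ^ N ≤ 2 ^ N * (‖x‖ ^ N + 1) := by
      have h := add_pow_le (norm_nonneg x) zero_le_one N
      rw [one_pow] at h
      rw [add_comm 1]
      refine h.trans ?_
      gcongr
      · norm_num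
      · omega
    rw [Real.norm_of_nonneg (by positivity)]
    calc _ ≤ ‖φ x‖ * (D * (2 ^ N * (‖x‖ ^ N + 1))) := by
          gcongr; exact (hD x).trans (by gcongr)
      _ = _ := by ring
  · intro j
    change ∫ x, φ x * (((‖j.2.1‖ ^ j.1.1.1 * (∏ a, ‖j.2.2 a‖)⁻¹ : ℝ) : ℂ) *
      (∂^{j.2.2} (compSubConstCLM ℂ x K)) j.2.1) =
      ((‖j.2.1‖ ^ j.1.1.1 * (∏ a, ‖j.2.2 a‖)⁻¹ : ℝ) : ℂ) * (∂^{j.2.2} (conv K φ)) j.2.1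
    rw [iteratedLineDerivOp_conv, conv_apply, ← integral_const_mul]
    refine integral_congr_ae (ae_of_all _ fun x => ?_)
    simp only [iteratedLineDerivOp_compSubConstCLM]
    ring

end Convolution

end ModSpace

namespace ModSpace

open MeasureTheory Set Filter Topology SchwartzMap

variable {n : ℕ}

/-! ### Distributions represented by functions, and `lpNorm` -/

section Representation

/-- The tempered distribution `f` is the function `g`. -/
def IsRepresentedBy (f : 𝓢'(Space n, ℂ)) (g : Space n → ℂ) : Prop :=
  ∀ φ : 𝓢(Space n, ℂ), Integrable (fun x => φ x * g x) ∧ f φ = ∫ x, φ x * g x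

theorem exists_schwartz_eq_one_on_closedBall (R : ℝ) :
    ∃ φ : 𝓢(Space n, ℂ), (∀ x ∈ Metric.closedBall (0 : Space n) R, φ x = 1) ∧
      HasCompactSupport φ := by
  let b : ContDiffBump (0 : Space n) := ⟨|R| + 1, |R| + 2, by positivity, by linarith⟩
  have hs : HasCompactSupport fun x => (b x : ℂ) := b.hasCompactSupport.comp_left Complex.ofReal_zero
  have hd : ContDiff ℝ (⊤ : ℕ∞) fun x => (b x : ℂ) := Complex.ofRealCLM.contDiff.comp b.contDiff
  refine ⟨hs.toSchwartzMap hd, fun x hx => ?_, hs⟩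
  have : b x = 1 := b.one_of_mem_closedBall
    (Metric.closedBall_subset_closedBall (by simp only [b]; linarith [le_abs_self R]) hx)
  change (b x : ℂ) = 1
  simp [this]

theorem IsRepresentedBy.locallyIntegrable {f : 𝓢'(Space n, ℂ)} {g : Space n → ℂ}
    (h : IsRepresentedBy f g) : LocallyIntegrable g := by
  rw [locallyIntegrable_iff]
  intro K hK
  obtain ⟨R, hR⟩ := hK.isBounded.subset_closedBall 0
  obtain ⟨φ, hφ, -⟩ := exists_schwartz_eq_one_on_closedBall (n := n) R
  refine ((h φ).1.integrableOn (s := K)).congr_fun (fun x hx => ?_) hK.measurableSet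
  simp [hφ x (hR hx)]

theorem IsRepresentedBy.ae_eq {f : 𝓢'(Space n, ℂ)} {g₁ g₂ : Space n → ℂ}
    (h₁ : IsRepresentedBy f g₁) (h₂ : IsRepresentedBy f g₂) : g₁ =ᵐ[volume] g₂ := by
  refine ae_eq_of_integral_contDiff_smul_eq h₁.locallyIntegrable h₂.locallyIntegrable
    fun φ hφ hs => ?_
  have hs' : HasCompactSupport fun x => (φ x : ℂ) := hs.comp_left Complex.ofReal_zero
  have hd : ContDiff ℝ (⊤ : ℕ∞) fun x => (φ x : ℂ) := Complex.ofRealCLM.contDiff.comp hφ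
  have := (h₁ (hs'.toSchwartzMap hd)).2.symm.trans (h₂ (hs'.toSchwartzMap hd)).2
  simpa using this

theorem IsRepresentedBy.congr {f : 𝓢'(Space n, ℂ)} {g₁ g₂ : Space n → ℂ}
    (h₁ : IsRepresentedBy f g₁) (h : g₁ =ᵐ[volume] g₂) : IsRepresentedBy f g₂ := by
  intro φ
  have e : (fun x => φ x * g₁ x) =ᵐ[volume] fun x => φ x * g₂ x := by
    filter_upwards [h] with x hx; rw [hx]
  exact ⟨(h₁ φ).1.congr e, (h₁ φ).2.trans (integral_congr_ae e)⟩

theorem integrable_schwartz_mul {p : ℝ≥0∞} (hp : 1 ≤ p) {g : Space n → ℂ}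
    (hg : MemLp g p volume) (φ : 𝓢(Space n, ℂ)) : Integrable (fun x => φ x * g x) := by
  have : ENNReal.HolderConjugate p (ENNReal.conjExponent p) := ENNReal.HolderConjugate.conjExponent hp
  have h := (φ.memLp (ENNReal.conjExponent p) volume).mul (r := 1) hg
    (hpqr := ENNReal.HolderTriple.symm)
  exact (memLp_one_iff_integrable.1 h).congr (ae_of_all _ fun x => mul_comm _ _)

theorem isRepresentedBy_of_memLp {p : ℝ≥0∞} (hp : 1 ≤ p) {f : 𝓢'(Space n, ℂ)}
    {g : Space n → ℂ} (hg : MemLp g p volume) (h : ∀ φ : 𝓢(Space n, ℂ), f φ = ∫ x, φ x * g x) :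
    IsRepresentedBy f g :=
  fun φ => ⟨integrable_schwartz_mul hp hg φ, h φ⟩

theorem lpNorm_le_eLpNorm {p : ℝ≥0∞} {f : 𝓢'(Space n, ℂ)} {g : Space n → ℂ}
    (hg : MemLp g p volume) (h : IsRepresentedBy f g) : lpNorm p f ≤ eLpNorm g p volume :=
  iInf_le_of_le g (iInf_le_of_le hg (iInf_le_of_le (fun φ => (h φ).2) le_rfl))

/-- Every competitor in the infimum defining `lpNorm` agrees with g almost everywhere, so the
infimum is read off from g; if the norm of g is infinite there is no competitor. -/
theorem IsRepresentedBy.lpNorm_eq {p : ℝ≥0∞} (hp : 1 ≤ p) {f : 𝓢'(Space n, ℂ)} {g : Space n → ℂ}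
    (hm : AEStronglyMeasurable g volume) (h : IsRepresentedBy f g) :
    lpNorm p f = eLpNorm g p volume := by
  refine le_antisymm ?_ (le_iInf fun g' => le_iInf fun hg' => le_iInf fun h' => ?_)
  · rcases eq_or_ne (eLpNorm g p volume) ⊤ with ht | ht
    · rw [ht]; exact le_top
    · exact lpNorm_le_eLpNorm ⟨hm, ht.lt_top⟩ h
  · exact (eLpNorm_congr_ae (h.ae_eq (isRepresentedBy_of_memLp hp hg' h'))).le

theorem exists_isRepresentedBy {p : ℝ≥0∞} (hp : 1 ≤ p) {f : 𝓢'(Space n, ℂ)}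
    (h : lpNorm p f < ⊤) : ∃ g : Space n → ℂ, StronglyMeasurable g ∧ MemLp g p volume ∧
      IsRepresentedBy f g ∧ lpNorm p f = eLpNorm g p volume := by
  simp only [lpNorm, iInf_lt_iff] at h
  obtain ⟨g, hg, hr, -⟩ := h
  have hr' := (isRepresentedBy_of_memLp hp hg hr).congr hg.1.ae_eq_mk
  exact ⟨_, hg.1.stronglyMeasurable_mk, hg.ae_eq hg.1.ae_eq_mk, hr',
    hr'.lpNorm_eq hp hg.1.stronglyMeasurable_mk.aestronglyMeasurable⟩

theorem lpNorm_zero {p : ℝ≥0∞} (hp : 1 ≤ p) : lpNorm p (0 : 𝓢'(Space n, ℂ)) = 0 := by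
  have : IsRepresentedBy (0 : 𝓢'(Space n, ℂ)) 0 := fun φ => by simp
  rw [this.lpNorm_eq hp aestronglyMeasurable_zero, eLpNorm_zero]

theorem lpNorm_add_le {p : ℝ≥0∞} (hp : 1 ≤ p) (f₁ f₂ : 𝓢'(Space n, ℂ)) :
    lpNorm p (f₁ + f₂) ≤ lpNorm p f₁ + lpNorm p f₂ := by
  rcases eq_or_ne (lpNorm p f₁) ⊤ with h₁ | h₁
  · simp [h₁]
  rcases eq_or_ne (lpNorm p f₂) ⊤ with h₂ | h₂
  · simp [h₂]
  obtain ⟨g₁, -, hg₁, hr₁, e₁⟩ := exists_isRepresentedBy hp (lt_top_iff_ne_top.2 h₁)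
  obtain ⟨g₂, -, hg₂, hr₂, e₂⟩ := exists_isRepresentedBy hp (lt_top_iff_ne_top.2 h₂)
  have hr : IsRepresentedBy (f₁ + f₂) (g₁ + g₂) := fun φ => by
    simp only [Pi.add_apply, mul_add]
    refine ⟨(hr₁ φ).1.add (hr₂ φ).1, ?_⟩
    rw [integral_add (hr₁ φ).1 (hr₂ φ).1, ← (hr₁ φ).2, ← (hr₂ φ).2]
    rfl
  rw [e₁, e₂]
  exact (lpNorm_le_eLpNorm (hg₁.add hg₂) hr).trans (eLpNorm_add_le hg₁.1 hg₂.1 hp)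

theorem lpNorm_sum_le {p : ℝ≥0∞} (hp : 1 ≤ p) {ι : Type*} (s : Finset ι)
    (f : ι → 𝓢'(Space n, ℂ)) : lpNorm p (∑ i ∈ s, f i) ≤ ∑ i ∈ s, lpNorm p (f i) := by
  classical
  induction s using Finset.induction_on with
  | empty => simp [lpNorm_zero hp]
  | insert a s ha ih =>
    rw [Finset.sum_insert ha, Finset.sum_insert ha]
    exact (lpNorm_add_le hp _ _).trans (by gcongr)

/-- A linear functional controlled by a weighted sup norm is a tempered distribution. -/
theorem exists_temperedDistribution (A : 𝓢(Space n, ℂ) → ℂ)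
    (hadd : ∀ f g, A (f + g) = A f + A g) (hsmul : ∀ (a : ℂ) f, A (a • f) = a * A f)
    (N : ℕ) (C : ℝ) (hC : 0 ≤ C)
    (hbound : ∀ (f : 𝓢(Space n, ℂ)) (B : ℝ), 0 ≤ B → (∀ x, (1 + ‖x‖) ^ N * ‖f x‖ ≤ B) →
      ‖A f‖ ≤ C * B) : ∃ T : 𝓢'(Space n, ℂ), ∀ φ, T φ = A φ := by
  have hb : ∃ (s : Finset (ℕ × ℕ)) (C : ℝ), 0 ≤ C ∧ ∀ f : 𝓢(Space n, ℂ),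
      ‖A f‖ ≤ C * s.sup (schwartzSeminormFamily ℂ (Space n) ℂ) f := by
    refine ⟨Finset.Iic (N, 0), C * 2 ^ N, by positivity, fun f => ?_⟩
    rw [mul_assoc]
    refine hbound f _ (by positivity) fun x => ?_
    have := one_add_le_sup_seminorm_apply (𝕜 := ℂ) (m := (N, 0)) le_rfl le_rfl f x
    rwa [norm_iteratedFDeriv_zero] at this
  exact ⟨ContinuousLinearMap.toPointwiseConvergenceCLM _ _ _ _
    (mkCLMtoNormedSpace (𝕜 := ℂ) (𝕜' := ℂ) (σ := RingHom.id ℂ) A hadd hsmul hb), fun φ => rfl⟩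

/-- Cutting off a Schwartz function at a large scale is a small perturbation of it. -/
theorem exists_cutoff_seminorm_sub_le (φ : 𝓢(Space n, ℂ)) :
    ∃ φ' : ℕ → 𝓢(Space n, ℂ), (∀ j, HasCompactSupport (φ' j)) ∧
      ∀ k m : ℕ, ∃ C, 0 ≤ C ∧ ∀ j : ℕ,
        SchwartzMap.seminorm ℂ k m (φ' j - φ) ≤ C * ((j : ℝ) + 1)⁻¹ := by
  obtain ⟨b, hb1, hbs⟩ := exists_schwartz_eq_one_on_closedBall (n := n) 1
  let L : ℕ → (Space n →L[ℝ] Space n) := fun j => ((j : ℝ) + 1)⁻¹ • ContinuousLinearMap.id ℝ _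
  have hLx : ∀ j x, L j x = ((j : ℝ) + 1)⁻¹ • x := fun j x => rfl
  have hj0 : ∀ j : ℕ, 0 < ((j : ℝ) + 1)⁻¹ := fun j => by positivity
  have hL1 : ∀ j, ‖L j‖ ≤ 1 := fun j => by
    refine ContinuousLinearMap.opNorm_le_bound _ zero_le_one fun x => ?_
    rw [hLx, norm_smul_of_nonneg (hj0 j).le]
    gcongr
    exact inv_le_one_of_one_le₀ (by linarith [(j.cast_nonneg : (0 : ℝ) ≤ j)])
  have hcs : ∀ j, HasCompactSupport fun x => b (L j x) * φ x := fun j => by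
    refine HasCompactSupport.mul_right ?_
    exact hbs.comp_homeomorph (Homeomorph.smulOfNeZero (((j : ℝ) + 1)⁻¹) (hj0 j).ne')
  have hsm : ∀ j, ContDiff ℝ (⊤ : ℕ∞) fun x => b (L j x) := fun j =>
    (b.smooth ⊤).comp (L j).contDiff
  let φ' : ℕ → 𝓢(Space n, ℂ) := fun j => (hcs j).toSchwartzMap ((hsm j).mul (φ.smooth ⊤))
  refine ⟨φ', hcs, fun k m => ?_⟩
  -- The error is φ times the dilate of η, which vanishes for ‖x‖ < j + 1; elsewhere the factor
  -- ‖x‖/(j+1) ≥ 1 may be inserted, which yields the rate.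
  let η : Space n → ℂ := fun x => b x - 1
  have hη : ContDiff ℝ (⊤ : ℕ∞) η := (b.smooth ⊤).sub contDiff_const
  have hηb : ∀ i : ℕ, ∃ D, 0 ≤ D ∧ ∀ x, ‖iteratedFDeriv ℝ i η x‖ ≤ D := by
    intro i
    refine ⟨SchwartzMap.seminorm ℝ 0 i b + 1, by positivity, fun x => ?_⟩
    have e : iteratedFDeriv ℝ i η x = iteratedFDeriv ℝ i b x -
        iteratedFDeriv ℝ i (fun _ : Space n => (1 : ℂ)) x :=
      iteratedFDeriv_sub_apply ((b.smooth i).contDiffAt) contDiff_const.contDiffAt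
    rw [e]
    refine (norm_sub_le _ _).trans (add_le_add (norm_iteratedFDeriv_le_seminorm ℝ b i x) ?_)
    rcases eq_or_ne i 0 with rfl | hi
    · rw [norm_iteratedFDeriv_zero, norm_one]
    · rw [iteratedFDeriv_const_of_ne hi]; simp
  choose D hD0 hD using hηb
  set C := ∑ i ∈ Finset.range (m + 1), (m.choose i : ℝ) * D i *
    SchwartzMap.seminorm ℝ (k + 1) (m - i) φ with hC
  have hC0 : 0 ≤ C := Finset.sum_nonneg fun i _ => by have := hD0 i; positivity
  refine ⟨C, hC0, fun j => seminorm_le_bound ℂ k m _ (by have := hj0 j; positivity) fun x => ?_⟩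
  have efun : ⇑(φ' j - φ) = fun x => η (L j x) * φ x := by
    funext x
    change b (L j x) * φ x - φ x = (b (L j x) - 1) * φ x
    ring
  rw [efun]
  rcases lt_or_ge (‖L j x‖) 1 with hx | hx
  · have hev : (fun x => η (L j x) * φ x) =ᶠ[𝓝 x] fun _ => 0 := by
      have : ∀ᶠ y in 𝓝 x, ‖L j y‖ < 1 :=
        ((L j).continuous.norm.tendsto x).eventually (gt_mem_nhds hx)
      filter_upwards [this] with y hy
      have : b (L j y) = 1 := hb1 _ (by simpa using hy.le)
      simp [η, this]
    have h0 : iteratedFDeriv ℝ m (fun x => η (L j x) * φ x) x = 0 := by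
      rw [(hev.iteratedFDeriv ℝ m).eq_of_nhds, iteratedFDeriv_fun_zero]; rfl
    rw [h0, norm_zero, mul_zero]
    have := hj0 j
    positivity
  · have hx1 : 1 ≤ ((j : ℝ) + 1)⁻¹ * ‖x‖ := by
      rwa [hLx, norm_smul_of_nonneg (hj0 j).le] at hx
    have hm := norm_iteratedFDeriv_mul_le (𝕜 := ℝ) (n := m) (hη.comp (L j).contDiff) (φ.smooth ⊤) x
      (mod_cast le_top)
    have hcomp : ∀ i, ‖iteratedFDeriv ℝ i (η ∘ L j) x‖ ≤ D i := fun i => by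
      rw [(L j).iteratedFDeriv_comp_right hη x (mod_cast le_top)]
      refine (ContinuousMultilinearMap.norm_compContinuousLinearMap_le _ _).trans ?_
      refine (mul_le_of_le_one_right (norm_nonneg _) ?_).trans (hD i _)
      exact Finset.prod_le_one (fun _ _ => norm_nonneg _) fun _ _ => hL1 j
    calc _ ≤ ‖x‖ ^ k * ∑ i ∈ Finset.range (m + 1), (m.choose i : ℝ) *
            ‖iteratedFDeriv ℝ i (η ∘ L j) x‖ * ‖iteratedFDeriv ℝ (m - i) φ x‖ := by
          gcongr; exact hm
      _ ≤ ‖x‖ ^ k * ∑ i ∈ Finset.range (m + 1), (m.choose i : ℝ) *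
            D i * ‖iteratedFDeriv ℝ (m - i) φ x‖ := by
          gcongr with i _; exact hcomp i
      _ ≤ (‖x‖ ^ k * ∑ i ∈ Finset.range (m + 1), (m.choose i : ℝ) *
            D i * ‖iteratedFDeriv ℝ (m - i) φ x‖) * (((j : ℝ) + 1)⁻¹ * ‖x‖) := by
          refine le_mul_of_one_le_right ?_ hx1
          exact mul_nonneg (by positivity) (Finset.sum_nonneg fun i _ => by
            have := hD0 i; positivity)
      _ = (∑ i ∈ Finset.range (m + 1), (m.choose i : ℝ) *
            D i * (‖x‖ ^ (k + 1) * ‖iteratedFDeriv ℝ (m - i) φ x‖)) * ((j : ℝ) + 1)⁻¹ := by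
          rw [Finset.mul_sum, Finset.sum_mul, Finset.sum_mul]
          refine Finset.sum_congr rfl fun i _ => ?_
          ring
      _ ≤ _ := by
          have := hj0 j
          rw [hC]
          gcongr with i _
          · exact mul_nonneg (by positivity) (hD0 i)
          · exact le_seminorm ℝ (k + 1) (m - i) φ x

/-- A tempered distribution is determined by its values on compactly supported functions. -/
theorem apply_eq_zero_of_forall_hasCompactSupport (T : 𝓢'(Space n, ℂ))
    (h : ∀ φ : 𝓢(Space n, ℂ), HasCompactSupport φ → T φ = 0) (φ : 𝓢(Space n, ℂ)) : T φ = 0 := by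
  obtain ⟨φ', hs, hb⟩ := exists_cutoff_seminorm_sub_le φ
  have hlim : Tendsto φ' atTop (𝓝 φ) := by
    refine ((schwartz_withSeminorms ℂ (Space n) ℂ).tendsto_nhds _ _).2 fun i ε hε => ?_
    obtain ⟨C, -, hC⟩ := hb i.1 i.2
    have h0 : Tendsto (fun j : ℕ => C * ((j : ℝ) + 1)⁻¹) atTop (𝓝 0) := by
      simpa using (tendsto_one_div_add_atTop_nhds_zero_nat (𝕜 := ℝ)).const_mul C
    filter_upwards [h0.eventually (gt_mem_nhds hε)] with j hj
    exact (hC j).trans_lt hj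
  have h1 : Tendsto (fun j => T (φ' j)) atTop (𝓝 (T φ)) := ((map_continuous T).tendsto φ).comp hlim
  simp only [fun j => h (φ' j) (hs j)] at h1
  exact (tendsto_nhds_unique h1 tendsto_const_nhds)

end Representation

/-! ### Multipliers, Young, Bernstein and Plancherel -/

section Multiplier

/-- The Fourier multiplier with symbol `χ`. -/
def mult (χ : 𝓢(Space n, ℂ)) : 𝓢'(Space n, ℂ) →L[ℂ] 𝓢'(Space n, ℂ) :=
  TemperedDistribution.fourierMultiplierCLM ℂ χ

/-- The product of two Schwartz functions. -/
def prodS (χ φ : 𝓢(Space n, ℂ)) : 𝓢(Space n, ℂ) := smulLeftCLM ℂ χ φ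

@[simp] theorem prodS_apply (χ φ : 𝓢(Space n, ℂ)) (x : Space n) : prodS χ φ x = χ x * φ x := by
  simp [prodS, smulLeftCLM_apply_apply χ.hasTemperateGrowth]

theorem fourier_mult_apply (χ φ : 𝓢(Space n, ℂ)) (T : 𝓢'(Space n, ℂ)) :
    (𝓕 (mult χ T)) φ = (𝓕 T) (prodS χ φ) := by
  simp [mult, prodS, TemperedDistribution.fourier_apply]

/-- Moving the Fourier transforms onto the test function turns multiplication by the symbol into
convolution. The kernel is not reflected, since `𝓕 (𝓕 χ)` at -ξ is χ at ξ. -/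
theorem mult_apply (χ φ : 𝓢(Space n, ℂ)) (T : 𝓢'(Space n, ℂ)) :
    mult χ T φ = T (conv (𝓕 χ) φ) := by
  have h : 𝓕 (prodS χ (𝓕⁻ φ)) = conv (𝓕 χ) φ := by
    have e := FourierTransform.fourier_fourierInv_eq (F := 𝓢(Space n, ℂ)) (conv (𝓕 χ) φ)
    rw [← e]
    congr 1
    ext ξ
    rw [prodS_apply, fourierInv_coe, fourierInv_coe, Real.fourierInv_eq_fourier_neg,
      Real.fourierInv_eq_fourier_neg, ← fourier_coe, ← fourier_coe, fourier_conv, fourier_coe (𝓕 χ),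
      ← Real.fourierInv_eq_fourier_neg, ← fourierInv_coe, FourierTransform.fourierInv_fourier_eq]
  rw [← h]
  rfl

/-- The smooth function that represents `mult χ T`. -/
def smoothRep (χ : 𝓢(Space n, ℂ)) (T : 𝓢'(Space n, ℂ)) (x : Space n) : ℂ :=
  T (compSubConstCLM ℂ x (𝓕 χ))

theorem continuous_smoothRep (χ : 𝓢(Space n, ℂ)) (T : 𝓢'(Space n, ℂ)) :
    Continuous (smoothRep χ T) :=
  (map_continuous T).comp (continuous_compSubConstCLM (𝓕 χ))

theorem isRepresentedBy_mult (χ : 𝓢(Space n, ℂ)) (T : 𝓢'(Space n, ℂ)) :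
    IsRepresentedBy (mult χ T) (smoothRep χ T) := fun φ => by
  rw [mult_apply]
  exact apply_conv T (𝓕 χ) φ

theorem lpNorm_mult {p : ℝ≥0∞} (hp : 1 ≤ p) (χ : 𝓢(Space n, ℂ)) (T : 𝓢'(Space n, ℂ)) :
    lpNorm p (mult χ T) = eLpNorm (smoothRep χ T) p volume :=
  (isRepresentedBy_mult χ T).lpNorm_eq hp (continuous_smoothRep χ T).aestronglyMeasurable

theorem smoothRep_eq_integral {T : 𝓢'(Space n, ℂ)} {g : Space n → ℂ} (h : IsRepresentedBy T g)
    (χ : 𝓢(Space n, ℂ)) (x : Space n) : smoothRep χ T x = ∫ y, 𝓕 χ (y - x) * g y :=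
  (h _).2

/-- Hölder's inequality; translation invariance of the norm of the kernel makes the bound uniform in
x. -/
theorem enorm_smoothRep_le {p p' : ℝ≥0∞} [hpp : ENNReal.HolderConjugate p' p]
    {T : 𝓢'(Space n, ℂ)} (hT : lpNorm p T < ⊤) (χ : 𝓢(Space n, ℂ)) (x : Space n) :
    ‖smoothRep χ T x‖ₑ ≤ eLpNorm (𝓕 χ : 𝓢(Space n, ℂ)) p' volume * lpNorm p T := by
  have hp : 1 ≤ p := (ENNReal.HolderConjugate.symm (p := p') (q := p)).one_le
  obtain ⟨g, hgm, hg, hr, e⟩ := exists_isRepresentedBy hp hT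
  rw [smoothRep_eq_integral hr, e]
  have hK : eLpNorm (fun y => 𝓕 χ (y - x)) p' volume =
      eLpNorm (𝓕 χ : 𝓢(Space n, ℂ)) p' volume :=
    eLpNorm_comp_measurePreserving (𝓕 χ).continuous.aestronglyMeasurable
      (measurePreserving_sub_right volume x)
  calc _ ≤ ∫⁻ y, ‖𝓕 χ (y - x) * g y‖ₑ := enorm_integral_le_lintegral_enorm _
    _ = eLpNorm (fun y => 𝓕 χ (y - x) * g y) 1 volume := eLpNorm_one_eq_lintegral_enorm.symm
    _ ≤ _ := by
      rw [← hK]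
      exact eLpNorm_smul_le_mul_eLpNorm (r := 1) (φ := fun y => 𝓕 χ (y - x)) hg.1
        (((𝓕 χ).continuous.comp (continuous_sub_right x)).aestronglyMeasurable)

/-- Young's inequality for a multiplier with integrable kernel. -/
theorem lpNorm_mult_le {p : ℝ≥0∞} (hp : 1 ≤ p) (hpt : p ≠ ⊤) {T : 𝓢'(Space n, ℂ)}
    (hT : lpNorm p T < ⊤) (χ : 𝓢(Space n, ℂ)) :
    lpNorm p (mult χ T) ≤ eLpNorm (𝓕 χ : 𝓢(Space n, ℂ)) 1 volume * lpNorm p T := by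
  obtain ⟨g, hgm, hg, hr, e⟩ := exists_isRepresentedBy hp hT
  have hp0 : p ≠ 0 := (zero_lt_one.trans_le hp).ne'
  have hpr : 1 ≤ p.toReal := by rwa [← ENNReal.ofReal_le_iff_le_toReal hpt, ENNReal.ofReal_one]
  rw [lpNorm_mult hp, e, eLpNorm_eq_lintegral_rpow_enorm_toReal hp0 hpt]
  have hm : Measurable (Function.uncurry fun x z : Space n => ‖𝓕 χ z‖ₑ * ‖g (z + x)‖ₑ) :=
    (((𝓕 χ).continuous.measurable.comp measurable_snd).enorm).mul
      ((hgm.measurable.comp (measurable_snd.add measurable_fst)).enorm)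
  calc _ ≤ (∫⁻ x, (∫⁻ z, ‖𝓕 χ z‖ₑ * ‖g (z + x)‖ₑ) ^ p.toReal) ^ (1 / p.toReal) := by
        gcongr with x
        rw [smoothRep_eq_integral hr]
        refine (enorm_integral_le_lintegral_enorm _).trans_eq ?_
        rw [← lintegral_add_right_eq_self _ x]
        simp [enorm_mul]
    _ ≤ ∫⁻ z, (∫⁻ x, (‖𝓕 χ z‖ₑ * ‖g (z + x)‖ₑ) ^ p.toReal) ^ (1 / p.toReal) :=
        lintegral_rpow_lintegral_le hpr hm
    _ = ∫⁻ z, ‖𝓕 χ z‖ₑ * eLpNorm g p volume := by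
        refine lintegral_congr fun z => ?_
        have hpr0 : 0 < p.toReal := by linarith
        simp only [ENNReal.mul_rpow_of_nonneg _ _ hpr0.le]
        have hz : Measurable fun x => ‖g (z + x)‖ₑ ^ p.toReal :=
          ((hgm.measurable.comp (measurable_const.add measurable_id)).enorm).pow_const _
        rw [lintegral_const_mul _ hz,
          ENNReal.mul_rpow_of_nonneg _ _ (by positivity), ← ENNReal.rpow_mul,
          mul_one_div_cancel hpr0.ne', ENNReal.rpow_one,
          lintegral_add_left_eq_self (fun x => ‖g x‖ₑ ^ p.toReal) z,
          eLpNorm_eq_lintegral_rpow_enorm_toReal hp0 hpt]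
    _ = _ := by
        rw [lintegral_mul_const _ (𝓕 χ).continuous.measurable.enorm, eLpNorm_one_eq_lintegral_enorm]

/-- Bernstein's inequality: a band-limited `L^p` function, `p ≤ 2`, is in `L²`. -/
theorem lpNorm_two_le {p p' : ℝ≥0∞} [hpp : ENNReal.HolderConjugate p' p] (hp2 : p ≤ 2)
    {T : 𝓢'(Space n, ℂ)} (hT : lpNorm p T < ⊤) (θ : 𝓢(Space n, ℂ)) (hθ : mult θ T = T) :
    lpNorm 2 T ≤ eLpNorm (𝓕 θ : 𝓢(Space n, ℂ)) p' volume ^ (1 - p.toReal / 2) * lpNorm p T := by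
  have hp : 1 ≤ p := (ENNReal.HolderConjugate.symm (p := p') (q := p)).one_le
  have hpt : p ≠ ⊤ := ne_top_of_le_ne_top (by simp) hp2
  have hp0 : p ≠ 0 := (zero_lt_one.trans_le hp).ne'
  have hpr : 1 ≤ p.toReal := by rwa [← ENNReal.ofReal_le_iff_le_toReal hpt, ENNReal.ofReal_one]
  have hpr2 : p.toReal ≤ 2 := by simpa using ENNReal.toReal_mono (by simp) hp2
  set A := eLpNorm (𝓕 θ : 𝓢(Space n, ℂ)) p' volume
  set L := lpNorm p T with hL
  have hsup := enorm_smoothRep_le (p' := p') hT θ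
  have hLe : L = eLpNorm (smoothRep θ T) p volume := by rw [← lpNorm_mult hp, hθ]
  have h2 : lpNorm 2 T = eLpNorm (smoothRep θ T) 2 volume := by
    rw [← lpNorm_mult one_le_two, hθ]
  have hLp : ∫⁻ x, ‖smoothRep θ T x‖ₑ ^ p.toReal = L ^ p.toReal := by
    rw [hLe, eLpNorm_eq_lintegral_rpow_enorm_toReal hp0 hpt, ← ENNReal.rpow_mul,
      one_div_mul_cancel (by linarith), ENNReal.rpow_one]
  rw [h2, eLpNorm_eq_lintegral_rpow_enorm_toReal (by simp) (by simp), ENNReal.toReal_ofNat]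
  have hpos : 0 ≤ 2 - p.toReal := by linarith
  -- Interpolation between L^p and L^∞: of the two powers of the modulus, 2 - p are bounded by the
  -- supremum and p are integrated.
  calc _ ≤ (∫⁻ x, (A * L) ^ (2 - p.toReal) * ‖smoothRep θ T x‖ₑ ^ p.toReal) ^ ((1 : ℝ) / 2) := by
        gcongr with x
        calc ‖smoothRep θ T x‖ₑ ^ (2 : ℝ) = ‖smoothRep θ T x‖ₑ ^ ((2 - p.toReal) + p.toReal) := by
              congr 1; ring
          _ = ‖smoothRep θ T x‖ₑ ^ (2 - p.toReal) * ‖smoothRep θ T x‖ₑ ^ p.toReal :=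
              ENNReal.rpow_add_of_nonneg _ _ hpos (by linarith)
          _ ≤ _ := by gcongr; exact hsup x
    _ = ((A * L) ^ (2 - p.toReal) * L ^ p.toReal) ^ ((1 : ℝ) / 2) := by
        rw [lintegral_const_mul, hLp]
        exact (continuous_smoothRep θ T).measurable.enorm.pow_const _
    _ = (A ^ (2 - p.toReal) * L ^ (2 : ℝ)) ^ ((1 : ℝ) / 2) := by
        rw [ENNReal.mul_rpow_of_nonneg _ _ hpos, mul_assoc,
          ← ENNReal.rpow_add_of_nonneg _ _ hpos (by linarith), sub_add_cancel]
    _ = _ := by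
        rw [ENNReal.mul_rpow_of_nonneg _ _ (by norm_num), ← ENNReal.rpow_mul, ← ENNReal.rpow_mul]
        rw [show (2 - p.toReal) * (1 / 2) = 1 - p.toReal / 2 by ring]
        norm_num

/-- Plancherel's theorem. -/
theorem exists_fourier_isRepresentedBy {T : 𝓢'(Space n, ℂ)} (hT : lpNorm 2 T < ⊤) :
    ∃ g : Space n → ℂ, MemLp g 2 volume ∧ IsRepresentedBy (𝓕 T) g ∧
      eLpNorm g 2 volume = lpNorm 2 T := by
  obtain ⟨h, -, hh, hr, e⟩ := exists_isRepresentedBy one_le_two hT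
  have hTh : T = (hh.toLp h : 𝓢'(Space n, ℂ)) := by
    ext φ
    rw [(hr φ).2, Lp.toTemperedDistribution_apply]
    refine integral_congr_ae ?_
    filter_upwards [hh.coeFn_toLp] with x hx
    rw [hx, smul_eq_mul]
  refine ⟨(𝓕 (hh.toLp h) : Lp ℂ 2 volume), Lp.memLp _, ?_, ?_⟩
  · refine isRepresentedBy_of_memLp one_le_two (Lp.memLp _) fun φ => ?_
    rw [hTh, Lp.fourier_toTemperedDistribution_eq, Lp.toTemperedDistribution_apply]
    rfl
  · rw [e, ← ENNReal.ofReal_toReal (Lp.eLpNorm_ne_top _), ← Lp.norm_def, Lp.norm_fourier_eq,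
      Lp.norm_toLp, ENNReal.ofReal_toReal hh.2.ne]

end Multiplier

end ModSpace

namespace ModSpace

open MeasureTheory Set Filter Topology SchwartzMap

variable {n : ℕ}

/-! ### Lattice points and polynomial weights -/

section Lattice

theorem latticePoint_apply (k : Fin n → ℤ) (i : Fin n) : latticePoint k i = (k i : ℝ) := rfl

theorem latticePoint_add (k l : Fin n → ℤ) :
    latticePoint (k + l) = latticePoint k + latticePoint l := by
  ext i; simp [latticePoint_apply]

theorem latticePoint_sub (k l : Fin n → ℤ) :
    latticePoint (k - l) = latticePoint k - latticePoint l := by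
  ext i; simp [latticePoint_apply]

theorem latticePoint_zero : latticePoint (0 : Fin n → ℤ) = 0 := by
  ext i; simp [latticePoint_apply]

theorem finite_norm_sub_latticePoint_le (x : Space n) (R : ℝ) :
    {k : Fin n → ℤ | ‖x - latticePoint k‖ ≤ R}.Finite := by
  refine (Set.finite_Icc (fun i => ⌊x i - R⌋) (fun i => ⌈x i + R⌉)).subset fun k hk => ?_
  have h : ∀ i, |x i - k i| ≤ R := fun i => (PiLp.norm_apply_le (x - latticePoint k) i).trans hk
  constructor
  · intro i
    have := (abs_le.1 (h i)).2
    have : ((⌊x i - R⌋ : ℤ) : ℝ) ≤ (k i : ℝ) := (Int.floor_le _).trans (by linarith)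
    exact_mod_cast this
  · intro i
    have := (abs_le.1 (h i)).1
    have : (k i : ℝ) ≤ ((⌈x i + R⌉ : ℤ) : ℝ) := le_trans (by linarith) (Int.le_ceil _)
    exact_mod_cast this

/-- Rounding every coordinate leaves at most half the diagonal of the unit cube, which is the radius
on which ρ is 1. -/
theorem exists_norm_sub_latticePoint_le (x : Space n) :
    ∃ k : Fin n → ℤ, ‖x - latticePoint k‖ ≤ √(n : ℝ) / 2 := by
  refine ⟨fun i => round (x i), ?_⟩
  rw [EuclideanSpace.norm_eq]
  have h : ∀ i, ‖(x - latticePoint fun i => round (x i)) i‖ ^ 2 ≤ (1 / 2) ^ 2 := fun i => by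
    gcongr
    exact abs_sub_round (x i)
  calc _ ≤ √(∑ _i : Fin n, ((1 : ℝ) / 2) ^ 2) := Real.sqrt_le_sqrt (Finset.sum_le_sum fun i _ => h i)
    _ = _ := by
      rw [Finset.sum_const, Finset.card_univ, Fintype.card_fin, nsmul_eq_mul,
        Real.sqrt_mul (by positivity), Real.sqrt_sq (by norm_num)]
      ring

theorem summable_one_add_norm_latticePoint (a : ℝ) :
    ∃ N : ℕ, Summable fun k : Fin n → ℤ => (1 + ‖latticePoint k‖) ^ (a - N) := by
  let b := (EuclideanSpace.basisFun (Fin n) ℝ).toBasis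
  let L := Submodule.span ℤ (Set.range b)
  -- For summability the exponent a - N has to lie below minus the rank of the lattice.
  obtain ⟨N, hN⟩ := exists_nat_gt (a + Module.finrank ℤ L)
  have hr : a - N < -(Module.finrank ℤ L : ℝ) := by linarith
  have hr0 : a - N < 0 := hr.trans_le (by simp)
  have hmem : ∀ k : Fin n → ℤ, latticePoint k ∈ L := fun k => by
    have : latticePoint k = ∑ i, k i • b i := by
      ext j
      simp [b, latticePoint_apply, Finset.sum_apply, Pi.single_apply]
    rw [this]
    exact Submodule.sum_mem _ fun i _ => Submodule.smul_mem _ _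
      (Submodule.subset_span (Set.mem_range_self i))
  have hinj : Function.Injective fun k : Fin n → ℤ => (⟨latticePoint k, hmem k⟩ : L) := by
    intro k l h
    funext i
    have := congrArg (fun z : L => (z : Space n) i) h
    simpa [latticePoint_apply] using this
  have h1 := (ZLattice.summable_norm_rpow L (a - N) hr).comp_injective hinj
  -- In the lattice sum the origin contributes 0, because 0 to a negative power is 0; this indicator
  -- restores the term k = 0.
  have h2 : Summable fun k : Fin n → ℤ => if k = 0 then (1 : ℝ) else 0 :=
    summable_of_hasFiniteSupport ((Set.finite_singleton 0).subset fun k hk => by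
      by_contra h; simp at h; simp [h] at hk)
  refine ⟨N, Summable.of_nonneg_of_le (fun k => by positivity) (fun k => ?_) (h1.add h2)⟩
  by_cases hk : k = 0
  · subst hk
    simp only [Function.comp_apply, Submodule.coe_norm, latticePoint_zero, norm_zero, add_zero,
      Real.one_rpow, if_true]
    linarith [Real.rpow_nonneg (le_refl (0 : ℝ)) (a - N)]
  · simp only [hk, if_false, add_zero, Function.comp_apply]
    have : 0 < ‖latticePoint k‖ := norm_pos_iff.2 fun h => hk (hinj (by
      ext1; simp [h, latticePoint_zero]))
    change (1 + ‖latticePoint k‖) ^ (a - N) ≤ ‖latticePoint k‖ ^ (a - N)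
    exact Real.rpow_le_rpow_of_nonpos this (by linarith) hr0.le

/-- The inequality 1+‖u‖ ≤ (1+R)(1+‖v‖) holds with x and y in either order, which settles both signs
of a. -/
theorem rpow_one_add_norm_le {x y : Space n} {R : ℝ} (h : ‖x - y‖ ≤ R) (a : ℝ) :
    (1 + ‖x‖) ^ a ≤ (1 + R) ^ |a| * (1 + ‖y‖) ^ a := by
  have hR : 0 ≤ R := (norm_nonneg _).trans h
  have key : ∀ u v : Space n, ‖u - v‖ ≤ R → 1 + ‖u‖ ≤ (1 + R) * (1 + ‖v‖) := fun u v huv => by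
    have : ‖u‖ ≤ ‖u - v‖ + ‖v‖ := by simpa using norm_add_le (u - v) v
    nlinarith [norm_nonneg v]
  rcases le_total 0 a with ha | ha
  · rw [abs_of_nonneg ha, ← Real.mul_rpow (by positivity) (by positivity)]
    exact Real.rpow_le_rpow (by positivity) (key x y h) ha
  · rw [abs_of_nonpos ha]
    have := Real.rpow_le_rpow_of_nonpos (by positivity) (key y x (by rwa [norm_sub_rev])) ha
    rw [Real.mul_rpow (by positivity) (by positivity)] at this
    rw [Real.rpow_neg (by positivity), ← div_eq_inv_mul, le_div_iff₀ (by positivity), mul_comm]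
    exact this

end Lattice

/-! ### The uniform frequency decomposition and almost orthogonality -/

section Symbol

variable {ρ : Space n → ℝ}

theorem IsCutoff.finite_support (hρ : IsCutoff ρ) (ξ : Space n) :
    {l : Fin n → ℤ | ρ (ξ - latticePoint l) ≠ 0}.Finite :=
  (finite_norm_sub_latticePoint_le ξ √(n : ℝ)).subset fun l hl => by
    by_contra h
    exact hl (hρ.eq_zero _ (not_le.1 h).le)

theorem IsCutoff.summable (hρ : IsCutoff ρ) (ξ : Space n) :
    Summable fun l : Fin n → ℤ => ρ (ξ - latticePoint l) :=
  summable_of_hasFiniteSupport (hρ.finite_support ξ)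

theorem IsCutoff.one_le_tsum (hρ : IsCutoff ρ) (ξ : Space n) :
    1 ≤ ∑' l : Fin n → ℤ, ρ (ξ - latticePoint l) := by
  obtain ⟨k, hk⟩ := exists_norm_sub_latticePoint_le ξ
  rw [← hρ.eq_one _ hk]
  exact (hρ.summable ξ).le_tsum k fun l _ => hρ.nonneg _

theorem IsCutoff.contDiff_tsum (hρ : IsCutoff ρ) :
    ContDiff ℝ (⊤ : ℕ∞) fun ξ => ∑' l : Fin n → ℤ, ρ (ξ - latticePoint l) := by
  rw [contDiff_iff_contDiffAt]
  intro ξ₀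
  -- The extra 1 lets one finite index set serve the whole unit ball around ξ₀.
  let A := (finite_norm_sub_latticePoint_le ξ₀ (√(n : ℝ) + 1)).toFinset
  have h : (fun ξ => ∑' l : Fin n → ℤ, ρ (ξ - latticePoint l)) =ᶠ[𝓝 ξ₀]
      fun ξ => ∑ l ∈ A, ρ (ξ - latticePoint l) := by
    filter_upwards [Metric.ball_mem_nhds ξ₀ one_pos] with ξ hξ
    refine tsum_eq_sum fun l hl => hρ.eq_zero _ ?_
    have h1 : √(n : ℝ) + 1 < ‖ξ₀ - latticePoint l‖ := by simpa [A] using hl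
    have h2 : ‖ξ₀ - ξ‖ < 1 := by rw [← dist_eq_norm, dist_comm]; exact hξ
    have h3 : ‖ξ₀ - latticePoint l‖ ≤ ‖ξ₀ - ξ‖ + ‖ξ - latticePoint l‖ := by
      simpa using norm_add_le (ξ₀ - ξ) (ξ - latticePoint l)
    linarith
  refine ContDiffAt.congr_of_eventuallyEq ?_ h
  exact (ContDiff.sum fun l _ => hρ.smooth.comp (contDiff_id.sub contDiff_const)).contDiffAt

theorem IsCutoff.contDiff_sigma (hρ : IsCutoff ρ) (k : Fin n → ℤ) :
    ContDiff ℝ (⊤ : ℕ∞) (sigma ρ k) :=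
  (hρ.smooth.comp (contDiff_id.sub contDiff_const)).div hρ.contDiff_tsum fun ξ =>
    (zero_lt_one.trans_le (hρ.one_le_tsum ξ)).ne'

theorem sigma_eq_sigma_zero (k : Fin n → ℤ) (ξ : Space n) :
    sigma ρ k ξ = sigma ρ 0 (ξ - latticePoint k) := by
  simp only [sigma, latticePoint_zero, sub_zero]
  congr 1
  rw [← (Equiv.addLeft k).tsum_eq]
  simp [latticePoint_add, sub_add_eq_sub_sub]

theorem IsCutoff.hasSum_sigma (hρ : IsCutoff ρ) (ξ : Space n) :
    HasSum (fun k => sigma ρ k ξ) 1 := by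
  have := (hρ.summable ξ).hasSum.div_const (∑' l : Fin n → ℤ, ρ (ξ - latticePoint l))
  rwa [div_self (zero_lt_one.trans_le (hρ.one_le_tsum ξ)).ne'] at this

theorem IsCutoff.norm_sub_le_of_sigma_ne_zero (hρ : IsCutoff ρ) {k : Fin n → ℤ} {ξ : Space n}
    (h : sigma ρ k ξ ≠ 0) : ‖ξ - latticePoint k‖ ≤ √(n : ℝ) := by
  by_contra hc
  exact h (by simp [sigma, hρ.eq_zero _ (not_le.1 hc).le])

theorem norm_two_pi_smul_sub (k : Fin n → ℤ) (ξ : Space n) :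
    ‖(2 * Real.pi) • ξ - latticePoint k‖ = 2 * Real.pi * ‖ξ - (2 * Real.pi)⁻¹ • latticePoint k‖ := by
  have hpi : 0 < 2 * Real.pi := by positivity
  rw [← Real.norm_of_nonneg hpi.le, ← norm_smul, smul_sub, Real.norm_of_nonneg hpi.le, smul_smul,
    mul_inv_cancel₀ hpi.ne', one_smul]

theorem IsCutoff.hasCompactSupport_symbol (hρ : IsCutoff ρ) (k : Fin n → ℤ) :
    HasCompactSupport fun ξ : Space n => (sigma ρ k ((2 * Real.pi) • ξ) : ℂ) := by
  have hpi : 0 < 2 * Real.pi := by positivity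
  refine HasCompactSupport.of_support_subset_isCompact
    (isCompact_closedBall ((2 * Real.pi)⁻¹ • latticePoint k) (√(n : ℝ) / (2 * Real.pi)))
    fun ξ hξ => ?_
  have := hρ.norm_sub_le_of_sigma_ne_zero (k := k) (ξ := (2 * Real.pi) • ξ)
    (by simpa using hξ)
  rw [norm_two_pi_smul_sub] at this
  rw [mem_closedBall_iff_norm, le_div_iff₀' hpi]
  exact this

/-- The symbol of `box ρ k`, as a Schwartz function. -/
def IsCutoff.symbol (hρ : IsCutoff ρ) (k : Fin n → ℤ) : 𝓢(Space n, ℂ) :=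
  (hρ.hasCompactSupport_symbol k).toSchwartzMap
    (Complex.ofRealCLM.contDiff.comp ((hρ.contDiff_sigma k).comp (contDiff_const_smul _)))

theorem IsCutoff.symbol_apply (hρ : IsCutoff ρ) (k : Fin n → ℤ) (ξ : Space n) :
    hρ.symbol k ξ = (sigma ρ k ((2 * Real.pi) • ξ) : ℂ) := rfl

theorem IsCutoff.box_eq (hρ : IsCutoff ρ) (k : Fin n → ℤ) (f : 𝓢'(Space n, ℂ)) :
    box ρ k f = mult (hρ.symbol k) f := rfl

/-- The centre of the support of the `k`-th symbol. -/
def centre (k : Fin n → ℤ) : Space n := (2 * Real.pi)⁻¹ • latticePoint k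

theorem IsCutoff.symbol_eq (hρ : IsCutoff ρ) (k : Fin n → ℤ) :
    hρ.symbol k = compSubConstCLM ℂ (centre k) (hρ.symbol 0) := by
  ext ξ
  rw [compSubConstCLM_apply, hρ.symbol_apply, hρ.symbol_apply, sigma_eq_sigma_zero, centre,
    smul_sub, smul_smul, mul_inv_cancel₀ (by positivity), one_smul]

theorem IsCutoff.norm_sub_centre_le (hρ : IsCutoff ρ) {k : Fin n → ℤ} {ξ : Space n}
    (h : hρ.symbol k ξ ≠ 0) : ‖ξ - centre k‖ ≤ √(n : ℝ) / (2 * Real.pi) := by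
  have hpi : 0 < 2 * Real.pi := by positivity
  rw [hρ.symbol_apply] at h
  have := hρ.norm_sub_le_of_sigma_ne_zero (k := k) (ξ := (2 * Real.pi) • ξ) (by simpa using h)
  rw [norm_two_pi_smul_sub] at this
  rwa [le_div_iff₀' hpi]

theorem IsCutoff.hasSum_symbol (hρ : IsCutoff ρ) (ξ : Space n) :
    HasSum (fun k => hρ.symbol k ξ) 1 := by
  have := (hρ.hasSum_sigma ((2 * Real.pi) • ξ)).mapL Complex.ofRealCLM
  simpa [hρ.symbol_apply] using this

/-- The indices whose symbols may overlap with the `k`-th one. -/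
def near (k : Fin n → ℤ) : Finset (Fin n → ℤ) :=
  (finite_norm_sub_latticePoint_le (latticePoint k) (2 * √(n : ℝ))).toFinset

theorem mem_near {k l : Fin n → ℤ} :
    l ∈ near k ↔ ‖latticePoint k - latticePoint l‖ ≤ 2 * √(n : ℝ) := by
  simp [near]

theorem card_near (k : Fin n → ℤ) : (near k).card = (near (0 : Fin n → ℤ)).card := by
  have : near k = (near (0 : Fin n → ℤ)).map (Equiv.addLeft k).toEmbedding := by
    ext l
    simp only [Finset.mem_map_equiv, mem_near, Equiv.addLeft_symm, Equiv.coe_addLeft,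
      latticePoint_zero, zero_sub, norm_neg]
    rw [neg_add_eq_sub, latticePoint_sub, norm_sub_rev]
  rw [this, Finset.card_map]

theorem IsCutoff.symbol_mul_symbol (hρ : IsCutoff ρ) {k l : Fin n → ℤ} (h : l ∉ near k)
    (ξ : Space n) : hρ.symbol l ξ * hρ.symbol k ξ = 0 := by
  by_contra hne
  have h1 := hρ.norm_sub_le_of_sigma_ne_zero (k := l) (ξ := (2 * Real.pi) • ξ)
    (by simpa [hρ.symbol_apply] using left_ne_zero_of_mul hne)
  have h2 := hρ.norm_sub_le_of_sigma_ne_zero (k := k) (ξ := (2 * Real.pi) • ξ)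
    (by simpa [hρ.symbol_apply] using right_ne_zero_of_mul hne)
  refine h (mem_near.2 ?_)
  set ζ := (2 * Real.pi) • ξ
  calc ‖latticePoint k - latticePoint l‖ = ‖(ζ - latticePoint l) - (ζ - latticePoint k)‖ := by
        congr 1; abel
    _ ≤ ‖ζ - latticePoint l‖ + ‖ζ - latticePoint k‖ := norm_sub_le _ _
    _ ≤ _ := by linarith

theorem IsCutoff.sum_near_mul (hρ : IsCutoff ρ) (k : Fin n → ℤ) (ξ : Space n) :
    ∑ l ∈ near k, hρ.symbol l ξ * hρ.symbol k ξ = hρ.symbol k ξ := by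
  have h := (hρ.hasSum_symbol ξ).mul_right (hρ.symbol k ξ)
  rw [one_mul] at h
  exact (hasSum_sum_of_ne_finset_zero fun l hl => hρ.symbol_mul_symbol hl ξ).unique h

/-- A function of compact support is a finite sum of its localizations. -/
theorem IsCutoff.exists_sum_prodS (hρ : IsCutoff ρ) {φ : 𝓢(Space n, ℂ)} (hφ : HasCompactSupport φ) :
    ∃ A : Finset (Fin n → ℤ), (∀ k ∉ A, prodS (hρ.symbol k) φ = 0) ∧
      ∑ k ∈ A, prodS (hρ.symbol k) φ = φ := by
  obtain ⟨R, hR⟩ := hφ.isCompact.isBounded.subset_closedBall 0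
  let A := (finite_norm_sub_latticePoint_le (0 : Space n) (2 * Real.pi * R + √(n : ℝ))).toFinset
  have hA : ∀ k ∉ A, ∀ ξ, hρ.symbol k ξ * φ ξ = 0 := by
    intro k hk ξ
    by_contra hne
    have h1 := hρ.norm_sub_le_of_sigma_ne_zero (k := k) (ξ := (2 * Real.pi) • ξ)
      (by simpa [hρ.symbol_apply] using left_ne_zero_of_mul hne)
    have h2 : ‖ξ‖ ≤ R := by
      simpa using hR (subset_tsupport _ (right_ne_zero_of_mul hne))
    refine hk ?_
    simp only [A, Set.Finite.mem_toFinset, mem_ofPred_eq, zero_sub, norm_neg]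
    calc ‖latticePoint k‖ = ‖(2 * Real.pi) • ξ - ((2 * Real.pi) • ξ - latticePoint k)‖ := by simp
      _ ≤ ‖(2 * Real.pi) • ξ‖ + ‖(2 * Real.pi) • ξ - latticePoint k‖ := norm_sub_le _ _
      _ ≤ _ := by rw [norm_smul_of_nonneg (by positivity)]; gcongr
  refine ⟨A, fun k hk => by ext ξ; simpa using hA k hk ξ, ?_⟩
  ext ξ
  have h := (hρ.hasSum_symbol ξ).mul_right (φ ξ)
  rw [one_mul] at h
  rw [← (hasSum_sum_of_ne_finset_zero (s := A) fun k hk => hA k hk ξ).unique h]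
  simp

/-- The Fourier transform of a translate has the same absolute value. -/
theorem eLpNorm_fourier_compSubConstCLM (χ : 𝓢(Space n, ℂ)) (a : Space n) (p : ℝ≥0∞) :
    eLpNorm (𝓕 (compSubConstCLM ℂ a χ) : 𝓢(Space n, ℂ)) p volume =
      eLpNorm (𝓕 χ : 𝓢(Space n, ℂ)) p volume := by
  refine eLpNorm_congr_norm_ae (ae_of_all _ fun ξ => ?_)
  have h := congrFun (VectorFourier.fourierIntegral_comp_add_right Real.fourierChar volume
    (innerₗ (Space n)) χ (-a)) ξ
  have e : (𝓕 (compSubConstCLM ℂ a χ) : 𝓢(Space n, ℂ)) ξ =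
      VectorFourier.fourierIntegral Real.fourierChar volume (innerₗ (Space n))
        (χ ∘ fun v => v + -a) ξ := by
    rw [fourier_coe]
    congr 1
  rw [e, h, Circle.norm_smul]
  rfl

theorem mult_mult (χ₁ χ₂ : 𝓢(Space n, ℂ)) (f : 𝓢'(Space n, ℂ)) :
    mult χ₁ (mult χ₂ f) = mult (prodS χ₁ χ₂) f := by
  have e : (χ₂ : Space n → ℂ) * χ₁ = prodS χ₁ χ₂ := by
    funext x; simp [mul_comm]
  rw [mult, mult, TemperedDistribution.fourierMultiplierCLM_fourierMultiplierCLM_apply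
    χ₂.hasTemperateGrowth χ₁.hasTemperateGrowth, e]
  rfl

theorem mult_sum {ι : Type*} (s : Finset ι) (χ : ι → 𝓢(Space n, ℂ)) (f : 𝓢'(Space n, ℂ)) :
    mult (∑ i ∈ s, χ i) f = ∑ i ∈ s, mult (χ i) f := by
  have e : ⇑(∑ i ∈ s, χ i) = fun x => ∑ i ∈ s, χ i x := by funext x; simp
  have := TemperedDistribution.fourierMultiplierCLM_sum ℂ (g := fun i => ⇑(χ i)) (s := s)
    fun i _ => (χ i).hasTemperateGrowth
  have h2 := congrArg (fun L : 𝓢'(Space n, ℂ) →L[ℂ] 𝓢'(Space n, ℂ) => L f) this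
  simp only [sum_apply] at h2
  rw [mult, e]
  exact h2

theorem mult_zero (f : 𝓢'(Space n, ℂ)) : mult 0 f = 0 := by
  ext φ
  rw [mult_apply]
  have : conv (𝓕 (0 : 𝓢(Space n, ℂ))) φ = 0 := by ext y; simp [conv_apply, FourierTransform.fourier_zero]
  rw [this, map_zero]; rfl

theorem IsCutoff.mult_symbol_eq_zero (hρ : IsCutoff ρ) {k l : Fin n → ℤ} (h : l ∉ near k)
    (f : 𝓢'(Space n, ℂ)) : mult (hρ.symbol l) (mult (hρ.symbol k) f) = 0 := by
  rw [mult_mult]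
  have : prodS (hρ.symbol l) (hρ.symbol k) = 0 := by
    ext ξ; simpa using hρ.symbol_mul_symbol h ξ
  rw [this, mult_zero]

theorem IsCutoff.sum_near_mult (hρ : IsCutoff ρ) (k : Fin n → ℤ) (f : 𝓢'(Space n, ℂ)) :
    ∑ l ∈ near k, mult (hρ.symbol l) (mult (hρ.symbol k) f) = mult (hρ.symbol k) f := by
  simp only [mult_mult]
  have : ∑ l ∈ near k, prodS (hρ.symbol l) (hρ.symbol k) = hρ.symbol k := by
    ext ξ
    simpa using hρ.sum_near_mul k ξ
  rw [← mult_sum, this]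

end Symbol

end ModSpace

namespace ModSpace

open MeasureTheory Set Filter Topology SchwartzMap

variable {n : ℕ}

/-! ### Weighted sequence norms -/

section WeightedSum

theorem weightedSeqNorm_of_ne_top {s : ℝ} {q : ℝ≥0∞} (hq : q ≠ ⊤) (a : (Fin n → ℤ) → ℝ≥0∞) :
    weightedSeqNorm s q a =
      (∑' k, (ENNReal.ofReal ((1 + ‖latticePoint k‖) ^ s) * a k) ^ q.toReal) ^ (1 / q.toReal) :=
  if_neg hq

theorem le_weightedSeqNorm {s : ℝ} {q : ℝ≥0∞} (hq1 : 1 ≤ q) (hq : q ≠ ⊤)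
    (a : (Fin n → ℤ) → ℝ≥0∞) (k : Fin n → ℤ) :
    ENNReal.ofReal ((1 + ‖latticePoint k‖) ^ s) * a k ≤ weightedSeqNorm s q a := by
  have hq0 : 0 < q.toReal := ENNReal.toReal_pos (zero_lt_one.trans_le hq1).ne' hq
  rw [weightedSeqNorm_of_ne_top hq]
  refine le_trans (le_of_eq ?_) (ENNReal.rpow_le_rpow (ENNReal.le_tsum k) (by positivity))
  rw [← ENNReal.rpow_mul, mul_one_div_cancel hq0.ne', ENNReal.rpow_one]

theorem weightedSeqNorm_le_of_support {s : ℝ} {q : ℝ≥0∞} (hq1 : 1 ≤ q) (hq : q ≠ ⊤)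
    {a : (Fin n → ℤ) → ℝ≥0∞} {A : Finset (Fin n → ℤ)} (h0 : ∀ k ∉ A, a k = 0) {B : ℝ≥0∞}
    (hB : ∀ k ∈ A, ENNReal.ofReal ((1 + ‖latticePoint k‖) ^ s) * a k ≤ B) :
    weightedSeqNorm s q a ≤ (A.card : ℝ≥0∞) ^ (1 / q.toReal) * B := by
  have hq0 : 0 < q.toReal := ENNReal.toReal_pos (zero_lt_one.trans_le hq1).ne' hq
  rw [weightedSeqNorm_of_ne_top hq, tsum_eq_sum (s := A) fun k hk => by simp [h0 k hk, hq0]]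
  calc _ ≤ (∑ _k ∈ A, B ^ q.toReal) ^ (1 / q.toReal) := by
        gcongr with k hk
        exact hB k hk
    _ = _ := by
        rw [Finset.sum_const, nsmul_eq_mul, ENNReal.mul_rpow_of_nonneg _ _ (by positivity),
          ← ENNReal.rpow_mul, mul_one_div_cancel hq0.ne', ENNReal.rpow_one]

end WeightedSum

/-! ### Decay of a single frequency block -/

section Decay

variable {ρ P : Space n → ℝ}

theorem isRepresentedBy_fourier_mult {T : 𝓢'(Space n, ℂ)} {g : Space n → ℂ}
    (h : IsRepresentedBy (𝓕 T) g) (χ : 𝓢(Space n, ℂ)) :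
    IsRepresentedBy (𝓕 (mult χ T)) (fun ξ => χ ξ * g ξ) := fun φ => by
  have e : (fun ξ => φ ξ * (χ ξ * g ξ)) = fun ξ => prodS χ φ ξ * g ξ := by
    funext ξ; rw [prodS_apply]; ring
  rw [fourier_mult_apply, e]
  exact h _

/-- Both operators are multiplications on the Fourier side, hence they commute. -/
theorem IsPropagated.mult {t : ℝ} {f u : 𝓢'(Space n, ℂ)} (h : IsPropagated P t f u)
    (χ : 𝓢(Space n, ℂ)) : IsPropagated P t (mult χ f) (mult χ u) := by
  obtain ⟨g, h1, h2, h3⟩ := h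
  have hr := isRepresentedBy_fourier_mult (fun φ => ⟨h1 φ, h2 φ⟩ : IsRepresentedBy (𝓕 f) g) χ
  refine ⟨fun ξ => χ ξ * g ξ, fun φ => (hr φ).1, fun φ => (hr φ).2, fun φ => ?_⟩
  rw [fourier_mult_apply, h3]
  refine integral_congr_ae (ae_of_all _ fun ξ => ?_)
  simp only [prodS_apply]
  ring

/-- The symbols are translates of one, so their kernels have equal modulus. This makes the
multiplier bounds uniform in k. -/
theorem IsCutoff.eLpNorm_fourier_symbol (hρ : IsCutoff ρ) (k : Fin n → ℤ) (p : ℝ≥0∞) :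
    eLpNorm (𝓕 (hρ.symbol k) : 𝓢(Space n, ℂ)) p volume =
      eLpNorm (𝓕 (hρ.symbol 0) : 𝓢(Space n, ℂ)) p volume := by
  rw [hρ.symbol_eq k, eLpNorm_fourier_compSubConstCLM]

/-- The decay hypothesis, localized to one frequency block. -/
theorem HasDecay.exists_lpNorm_box_le (hρ : IsCutoff ρ) {p p' q : ℝ≥0∞} {α δ μ : ℝ}
    (hp : 1 ≤ p) (hp' : 1 ≤ p') (hpt' : p' ≠ ⊤) (hq : 1 ≤ q) (hqt : q ≠ ⊤)
    (h : HasDecay ρ P p p' q α δ μ) :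
    ∃ C : ℝ≥0, ∀ (k : Fin n → ℤ) (t : ℝ) (f w : 𝓢'(Space n, ℂ)), lpNorm p' (box ρ k f) < ⊤ →
      IsPropagated P t f w → lpNorm p (box ρ k w) ≤
        C * decayKernel μ t * (ENNReal.ofReal ((1 + ‖latticePoint k‖) ^ δ) *
          lpNorm p' (box ρ k f)) := by
  obtain ⟨C₀, hC₀⟩ := h
  set A := eLpNorm (𝓕 (hρ.symbol 0) : 𝓢(Space n, ℂ)) 1 volume with hA
  have hAt : A ≠ ⊤ := ((𝓕 (hρ.symbol 0) : 𝓢(Space n, ℂ)).eLpNorm_lt_top 1 volume).ne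
  set R : ℝ := 2 * √(n : ℝ) with hR
  have hR0 : 0 ≤ R := by positivity
  set c₁ := ENNReal.ofReal ((1 + R) ^ |α + δ|)
  set c₂ := ENNReal.ofReal ((1 + R) ^ |-α|)
  set N₀ : ℝ≥0∞ := ((near (0 : Fin n → ℤ)).card : ℝ≥0∞)
  -- N₀ * c₂ comes from reassembling a block from its neighbours (`hlow`), C₀ from the hypothesis,
  -- and the bracket from the modulation norm of a single block (`hup`).
  set K : ℝ≥0∞ := N₀ * c₂ * C₀ * (N₀ ^ (1 / q.toReal) * c₁ * A) with hK
  have hKt : K ≠ ⊤ := by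
    have h1 : N₀ ≠ ⊤ := ENNReal.natCast_ne_top _
    have h2 : N₀ ^ (1 / q.toReal) ≠ ⊤ := ENNReal.rpow_ne_top_of_nonneg (by positivity) h1
    have h3 : c₁ ≠ ⊤ := ENNReal.ofReal_ne_top
    have h4 : c₂ ≠ ⊤ := ENNReal.ofReal_ne_top
    finiteness
  refine ⟨K.toNNReal, fun k t f w hf hw => ?_⟩
  rw [ENNReal.coe_toNNReal hKt]
  set L := lpNorm p' (box ρ k f) with hL
  set y : ℝ := 1 + ‖latticePoint k‖ with hy
  have hy0 : 0 < y := by positivity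
  have hnear : ∀ l ∈ near k, ∀ a : ℝ, ENNReal.ofReal ((1 + ‖latticePoint l‖) ^ a) ≤
      ENNReal.ofReal ((1 + R) ^ |a|) * ENNReal.ofReal (y ^ a) := by
    intro l hl a
    rw [← ENNReal.ofReal_mul (by positivity)]
    refine ENNReal.ofReal_le_ofReal (rpow_one_add_norm_le ?_ a)
    rw [norm_sub_rev]; exact mem_near.1 hl
  have hup : modNorm ρ (α + δ) p' q (box ρ k f) ≤
      N₀ ^ (1 / q.toReal) * (c₁ * ENNReal.ofReal (y ^ (α + δ)) * (A * L)) := by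
    have hcard : N₀ = ((near k).card : ℝ≥0∞) := by rw [card_near]
    rw [hcard]
    refine weightedSeqNorm_le_of_support hq hqt (fun l hl => ?_) fun l hl => ?_
    · rw [hρ.box_eq, hρ.box_eq, hρ.mult_symbol_eq_zero hl, lpNorm_zero hp']
    · refine mul_le_mul' (hnear l hl _) ?_
      have := lpNorm_mult_le hp' hpt' hf (hρ.symbol l)
      rwa [hρ.eLpNorm_fourier_symbol] at this
  have hupt : modNorm ρ (α + δ) p' q (box ρ k f) < ⊤ := by
    refine hup.trans_lt ?_
    have h1 : N₀ ≠ ⊤ := ENNReal.natCast_ne_top _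
    have h2 : N₀ ^ (1 / q.toReal) ≠ ⊤ := ENNReal.rpow_ne_top_of_nonneg (by positivity) h1
    have h3 : c₁ ≠ ⊤ := ENNReal.ofReal_ne_top
    have h4 : L ≠ ⊤ := hf.ne
    finiteness
  -- The hypothesis is applied to the block and not to f, whose own modulation norm need not be
  -- finite.
  have hdec := hC₀ t _ _ hupt (hw.mult (hρ.symbol k))
  set M := modNorm ρ α p q (box ρ k w) with hM
  have hlow : lpNorm p (box ρ k w) ≤ N₀ * c₂ * ENNReal.ofReal (y ^ (-α)) * M := by
    have hterm : ∀ l ∈ near k, lpNorm p (box ρ l (box ρ k w)) ≤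
        c₂ * ENNReal.ofReal (y ^ (-α)) * M := by
      intro l hl
      have h1 := le_weightedSeqNorm (s := α) hq hqt (fun l => lpNorm p (box ρ l (box ρ k w))) l
      have hpos : 0 < 1 + ‖latticePoint l‖ := by positivity
      calc _ = ENNReal.ofReal ((1 + ‖latticePoint l‖) ^ (-α)) *
            (ENNReal.ofReal ((1 + ‖latticePoint l‖) ^ α) * lpNorm p (box ρ l (box ρ k w))) := by
            rw [← mul_assoc, ← ENNReal.ofReal_mul (by positivity), ← Real.rpow_add hpos,
              neg_add_cancel, Real.rpow_zero, ENNReal.ofReal_one, one_mul]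
        _ ≤ _ := mul_le_mul' (hnear l hl _) h1
    calc lpNorm p (box ρ k w) = lpNorm p (∑ l ∈ near k, box ρ l (box ρ k w)) := by
          simp only [hρ.box_eq, hρ.sum_near_mult]
      _ ≤ ∑ l ∈ near k, lpNorm p (box ρ l (box ρ k w)) := lpNorm_sum_le hp _ _
      _ ≤ ∑ _l ∈ near k, c₂ * ENNReal.ofReal (y ^ (-α)) * M := Finset.sum_le_sum hterm
      _ = _ := by
          rw [Finset.sum_const, nsmul_eq_mul, card_near]; ring
  have hyy : ENNReal.ofReal (y ^ (-α)) * ENNReal.ofReal (y ^ (α + δ)) = ENNReal.ofReal (y ^ δ) := by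
    rw [← ENNReal.ofReal_mul (by positivity), ← Real.rpow_add hy0, neg_add_cancel_left]
  calc _ ≤ _ := hlow
    _ ≤ N₀ * c₂ * ENNReal.ofReal (y ^ (-α)) * (C₀ * decayKernel μ t *
          (N₀ ^ (1 / q.toReal) * (c₁ * ENNReal.ofReal (y ^ (α + δ)) * (A * L)))) := by
        gcongr
        exact hdec.trans (by unfold decayKernel; gcongr)
    _ = K * decayKernel μ t *
          ((ENNReal.ofReal (y ^ (-α)) * ENNReal.ofReal (y ^ (α + δ))) * L) := by
        rw [hK]; ring
    _ = _ := by rw [hyy]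

end Decay

/-! ### The Fourier transform as a function of polynomial growth in mean -/

section FourierSide

/-- The weight `(1 + |ξ|)^{-N}`. -/
def wt (N : ℕ) (ξ : Space n) : ℝ≥0∞ := ENNReal.ofReal ((1 + ‖ξ‖) ^ (-(N : ℝ)))

theorem measurable_wt (N : ℕ) : Measurable (wt N : Space n → ℝ≥0∞) := by
  unfold wt; fun_prop

theorem exists_pow_mul_norm_le (φ : 𝓢(Space n, ℂ)) (N : ℕ) :
    ∃ B : ℝ, 0 ≤ B ∧ ∀ x, (1 + ‖x‖) ^ N * ‖φ x‖ ≤ B := by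
  refine ⟨2 ^ N * (Finset.Iic (N, 0)).sup (fun m => SchwartzMap.seminorm ℝ m.1 m.2) φ,
    by positivity, fun x => ?_⟩
  have := one_add_le_sup_seminorm_apply (𝕜 := ℝ) (m := (N, 0)) le_rfl le_rfl φ x
  rwa [norm_iteratedFDeriv_zero] at this

theorem lintegral_enorm_mul_le {φ : 𝓢(Space n, ℂ)} {N : ℕ} {B : ℝ} (hB : 0 ≤ B)
    (h : ∀ x, (1 + ‖x‖) ^ N * ‖φ x‖ ≤ B) (g : Space n → ℂ) :
    ∫⁻ ξ, ‖φ ξ * g ξ‖ₑ ≤ ENNReal.ofReal B * ∫⁻ ξ, wt N ξ * ‖g ξ‖ₑ := by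
  rw [← lintegral_const_mul' _ _ ENNReal.ofReal_ne_top]
  refine lintegral_mono fun ξ => ?_
  rw [enorm_mul, ← mul_assoc]
  gcongr
  rw [wt, ← ENNReal.ofReal_mul hB, ← ofReal_norm]
  refine ENNReal.ofReal_le_ofReal ?_
  rw [Real.rpow_neg (by positivity), Real.rpow_natCast, ← div_eq_mul_inv,
    le_div_iff₀ (by positivity), mul_comm]
  exact h ξ

theorem integrable_schwartz_mul_of_wt {g : Space n → ℂ} (hg : AEStronglyMeasurable g volume)
    {N : ℕ} (hN : ∫⁻ ξ, wt N ξ * ‖g ξ‖ₑ < ⊤) (φ : 𝓢(Space n, ℂ)) :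
    Integrable (fun ξ => φ ξ * g ξ) := by
  obtain ⟨B, hB, h⟩ := exists_pow_mul_norm_le φ N
  exact ⟨φ.continuous.aestronglyMeasurable.mul hg, (lintegral_enorm_mul_le hB h g).trans_lt
    (ENNReal.mul_lt_top ENNReal.ofReal_lt_top hN)⟩

theorem exists_isRepresentedBy_of_wt {g : Space n → ℂ} (hg : AEStronglyMeasurable g volume)
    {N : ℕ} (hN : ∫⁻ ξ, wt N ξ * ‖g ξ‖ₑ < ⊤) : ∃ D : 𝓢'(Space n, ℂ), IsRepresentedBy D g := by
  have hi := integrable_schwartz_mul_of_wt hg hN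
  obtain ⟨D, hD⟩ := exists_temperedDistribution (fun φ => ∫ ξ, φ ξ * g ξ)
    (fun φ ψ => by
      rw [← integral_add (hi φ) (hi ψ)]; simp [add_mul])
    (fun a φ => by rw [← integral_const_mul]; simp [mul_assoc]) N
    (∫⁻ ξ, wt N ξ * ‖g ξ‖ₑ).toReal ENNReal.toReal_nonneg
    (fun φ B hB h => by
      have h1 := (enorm_integral_le_lintegral_enorm (μ := volume) fun ξ => φ ξ * g ξ).trans
        (lintegral_enorm_mul_le hB h g)
      rw [← ENNReal.ofReal_toReal hN.ne, ← ENNReal.ofReal_mul hB, ← ofReal_norm,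
        ENNReal.ofReal_le_ofReal_iff (by positivity)] at h1
      rwa [mul_comm])
  exact ⟨D, fun φ => ⟨hi φ, hD φ⟩⟩

variable {ρ P : Space n → ℝ}

/-- If the frequency blocks of `T` are in `L^{p'}` with polynomially bounded norms, `p' ≤ 2`, then
the Fourier transform of `T` is a function. -/
theorem IsCutoff.exists_fourier_isRepresentedBy (hρ : IsCutoff ρ) {p p' : ℝ≥0∞}
    [hpp : ENNReal.HolderConjugate p p'] (hp2 : p' ≤ 2) (N : ℕ) :
    ∃ C : ℝ≥0, ∀ T : 𝓢'(Space n, ℂ), ∑' k, wt N (latticePoint k) * lpNorm p' (box ρ k T) < ⊤ →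
      ∃ g : Space n → ℂ, AEStronglyMeasurable g volume ∧ IsRepresentedBy (𝓕 T) g ∧
        ∫⁻ ξ, wt N ξ * ‖g ξ‖ₑ ≤ C * ∑' k, wt N (latticePoint k) * lpNorm p' (box ρ k T) := by
  set r : ℝ := √(n : ℝ) / (2 * Real.pi) with hr
  have hpi : 0 < 2 * Real.pi := by positivity
  have hr0 : 0 ≤ r := by positivity
  -- θ is 1 on the support of the symbol at the origin, so multiplication by its translates Θ k
  -- reproduces the blocks.
  obtain ⟨θ, hθ1, hθs⟩ := exists_schwartz_eq_one_on_closedBall (n := n) r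
  obtain ⟨r', hr'⟩ := hθs.isCompact.isBounded.subset_closedBall 0
  have hp' : 1 ≤ p' := (ENNReal.HolderConjugate.symm (p := p) (q := p')).one_le
  set Θ : (Fin n → ℤ) → 𝓢(Space n, ℂ) := fun k => compSubConstCLM ℂ (centre k) θ with hΘ
  have hΘs : ∀ k ξ, Θ k ξ ≠ 0 → ‖ξ - centre k‖ ≤ |r'| := fun k ξ h => by
    have : ξ - centre k ∈ Metric.closedBall (0 : Space n) r' := hr' (subset_tsupport _ h)
    exact (by simpa using this : ‖ξ - centre k‖ ≤ r').trans (le_abs_self _)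
  have hΘσ : ∀ k f, mult (Θ k) (mult (hρ.symbol k) f) = mult (hρ.symbol k) f := fun k f => by
    have : prodS (Θ k) (hρ.symbol k) = hρ.symbol k := by
      ext ξ
      rw [prodS_apply]
      by_cases h0 : hρ.symbol k ξ = 0
      · simp [h0]
      · have : Θ k ξ = 1 := hθ1 _ (by simpa using hρ.norm_sub_centre_le h0)
        rw [this, one_mul]
    rw [mult_mult, this]
  set c₁ : ℝ≥0∞ := ENNReal.ofReal ((1 + |r'|) ^ (N : ℝ) * (2 * Real.pi + 1) ^ (N : ℝ)) with hc₁
  have hwt : ∀ k ξ, Θ k ξ ≠ 0 → wt N ξ ≤ c₁ * wt N (latticePoint k) := by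
    intro k ξ h
    rw [wt, wt, hc₁, ← ENNReal.ofReal_mul (by positivity)]
    refine ENNReal.ofReal_le_ofReal ?_
    have h1 := rpow_one_add_norm_le (hΘs k ξ h) (-(N : ℝ))
    rw [abs_neg, Nat.abs_cast] at h1
    refine h1.trans ?_
    rw [mul_assoc]
    gcongr
    have h2 : 1 + ‖latticePoint k‖ ≤ (2 * Real.pi + 1) * (1 + ‖centre k‖) := by
      have : ‖latticePoint k‖ = 2 * Real.pi * ‖centre k‖ := by
        rw [centre, norm_smul, norm_inv, Real.norm_of_nonneg hpi.le, mul_inv_cancel_left₀ hpi.ne']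
      rw [this]
      nlinarith [norm_nonneg (centre k)]
    have h3 := Real.rpow_le_rpow (by positivity) h2 (Nat.cast_nonneg N)
    rw [Real.mul_rpow (by positivity) (by positivity)] at h3
    rw [Real.rpow_neg (by positivity), Real.rpow_neg (by positivity), ← div_eq_mul_inv,
      le_div_iff₀ (by positivity), inv_mul_le_iff₀ (by positivity), mul_comm]
    exact h3
  set A := eLpNorm (𝓕 θ : 𝓢(Space n, ℂ)) p volume ^ (1 - p'.toReal / 2)
  have hp'2 : p'.toReal ≤ 2 := by simpa using ENNReal.toReal_mono (by simp) hp2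
  have hAt : A ≠ ⊤ := ENNReal.rpow_ne_top_of_nonneg (by linarith)
    ((𝓕 θ : 𝓢(Space n, ℂ)).eLpNorm_lt_top p volume).ne
  set E := eLpNorm θ 2 volume
  have hEt : E ≠ ⊤ := (θ.eLpNorm_lt_top 2 volume).ne
  set K := c₁ * (E * A) with hK
  have hKt : K ≠ ⊤ := by
    have : c₁ ≠ ⊤ := ENNReal.ofReal_ne_top
    finiteness
  refine ⟨K.toNNReal, fun T hT => ?_⟩
  rw [ENNReal.coe_toNNReal hKt]
  have hfin : ∀ k, lpNorm p' (mult (hρ.symbol k) T) < ⊤ := fun k => by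
    have h1 := (ENNReal.le_tsum k).trans_lt hT
    by_contra h
    rw [hρ.box_eq, top_le_iff.1 (not_lt.1 h), ENNReal.mul_top] at h1
    · exact lt_irrefl _ h1
    · simp only [wt, ne_eq, ENNReal.ofReal_eq_zero, not_le]; positivity
  have hB : ∀ k, lpNorm 2 (mult (hρ.symbol k) T) ≤ A * lpNorm p' (mult (hρ.symbol k) T) := by
    intro k
    have := lpNorm_two_le (p' := p) hp2 (hfin k) (Θ k) (hΘσ k T)
    rwa [hΘ, eLpNorm_fourier_compSubConstCLM] at this
  have hB2 : ∀ k, lpNorm 2 (mult (hρ.symbol k) T) < ⊤ := fun k =>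
    (hB k).trans_lt (ENNReal.mul_lt_top hAt.lt_top (hfin k))
  choose G hG2 hGr hGn using fun k => ModSpace.exists_fourier_isRepresentedBy (hB2 k)
  -- G k is only determined almost everywhere; the factor Θ k gives it compact support at every
  -- point, so the sum over k is pointwise finite.
  set G' : (Fin n → ℤ) → Space n → ℂ := fun k ξ => Θ k ξ * G k ξ with hG'
  have hG'm : ∀ k, AEStronglyMeasurable (G' k) volume := fun k =>
    (Θ k).continuous.aestronglyMeasurable.mul (hG2 k).1
  have hG'r : ∀ k, IsRepresentedBy (𝓕 (mult (hρ.symbol k) T)) (G' k) := fun k => by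
    have := isRepresentedBy_fourier_mult (hGr k) (Θ k)
    rwa [hΘσ] at this
  have hG'w : ∀ k, ∫⁻ ξ, wt N ξ * ‖G' k ξ‖ₑ ≤
      K * (wt N (latticePoint k) * lpNorm p' (box ρ k T)) := by
    intro k
    have h1 : ∫⁻ ξ, ‖G' k ξ‖ₑ ≤ E * eLpNorm (G k) 2 volume := by
      have e : eLpNorm (Θ k) 2 volume = E :=
        eLpNorm_comp_measurePreserving θ.continuous.aestronglyMeasurable
          (measurePreserving_sub_right volume (centre k))
      rw [← eLpNorm_one_eq_lintegral_enorm, ← e]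
      exact eLpNorm_smul_le_mul_eLpNorm (r := 1) (φ := Θ k) (hG2 k).1
        (Θ k).continuous.aestronglyMeasurable
    calc _ ≤ ∫⁻ ξ, c₁ * wt N (latticePoint k) * ‖G' k ξ‖ₑ := by
          refine lintegral_mono fun ξ => ?_
          by_cases h0 : Θ k ξ = 0
          · simp [hG', h0]
          · gcongr; exact hwt k ξ h0
      _ = c₁ * wt N (latticePoint k) * ∫⁻ ξ, ‖G' k ξ‖ₑ :=
          lintegral_const_mul' _ _ (ENNReal.mul_ne_top ENNReal.ofReal_ne_top ENNReal.ofReal_ne_top)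
      _ ≤ c₁ * wt N (latticePoint k) * (E * (A * lpNorm p' (box ρ k T))) := by
          gcongr
          refine h1.trans ?_
          rw [hGn]
          gcongr
          exact hB k
      _ = _ := by rw [hK]; ring
  have hsupp : ∀ ξ, (Function.support fun k => G' k ξ).Finite := fun ξ => by
    refine (finite_norm_sub_latticePoint_le ((2 * Real.pi) • ξ) (2 * Real.pi * |r'|)).subset
      fun k hk => ?_
    rw [mem_ofPred_eq, norm_two_pi_smul_sub]
    gcongr
    exact hΘs k ξ (left_ne_zero_of_mul hk)
  have hsum : ∀ ξ, Summable fun k => G' k ξ := fun ξ => summable_of_hasFiniteSupport (hsupp ξ)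
  set g : Space n → ℂ := fun ξ => ∑' k, G' k ξ with hg
  have hgm : AEStronglyMeasurable g volume :=
    aestronglyMeasurable_of_tendsto_ae atTop
      (f := fun (s : Finset (Fin n → ℤ)) ξ => ∑ k ∈ s, G' k ξ)
      (fun s => Finset.aestronglyMeasurable_fun_sum s fun k _ => hG'm k)
      (ae_of_all _ fun ξ => (hsum ξ).hasSum)
  have hgw : ∫⁻ ξ, wt N ξ * ‖g ξ‖ₑ ≤
      K * ∑' k, wt N (latticePoint k) * lpNorm p' (box ρ k T) := by
    calc _ ≤ ∫⁻ ξ, ∑' k, wt N ξ * ‖G' k ξ‖ₑ := by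
          refine lintegral_mono fun ξ => ?_
          rw [ENNReal.tsum_mul_left]
          gcongr
          exact enorm_tsum_le_tsum_enorm
      _ = ∑' k, ∫⁻ ξ, wt N ξ * ‖G' k ξ‖ₑ :=
          lintegral_tsum fun k => (measurable_wt N).aemeasurable.mul (hG'm k).enorm
      _ ≤ ∑' k, K * (wt N (latticePoint k) * lpNorm p' (box ρ k T)) := ENNReal.tsum_le_tsum hG'w
      _ = _ := ENNReal.tsum_mul_left
  refine ⟨g, hgm, ?_, hgw⟩
  have hgt := hgw.trans_lt (ENNReal.mul_lt_top hKt.lt_top hT)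
  obtain ⟨D, hD⟩ := exists_isRepresentedBy_of_wt hgm hgt
  -- Test functions of compact support meet finitely many blocks, where both sides agree, and they
  -- determine a tempered distribution.
  have hDT : 𝓕 T = D := by
    rw [← sub_eq_zero]
    ext φ
    refine apply_eq_zero_of_forall_hasCompactSupport (𝓕 T - D) (fun φ hφ => ?_) φ
    obtain ⟨s, hs0, hs⟩ := hρ.exists_sum_prodS hφ
    have hblock : ∀ k, (𝓕 T) (prodS (hρ.symbol k) φ) = ∫ ξ, φ ξ * G' k ξ := fun k => by
      rw [← fourier_mult_apply, (hG'r k φ).2]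
    have h1 : (𝓕 T) φ = ∑ k ∈ s, ∫ ξ, φ ξ * G' k ξ := by
      rw [← hs, map_sum]
      simp only [hblock, hs]
    have h2 : HasSum (fun k => ∫ ξ, φ ξ * G' k ξ) (∫ ξ, φ ξ * g ξ) := by
      have hnorm : Summable fun k => ∫ ξ, ‖φ ξ * G' k ξ‖ := by
        obtain ⟨B, hB0, hB⟩ := exists_pow_mul_norm_le φ N
        have hle : ∀ k, ∫⁻ ξ, ‖φ ξ * G' k ξ‖ₑ ≤
            ENNReal.ofReal B * (K * (wt N (latticePoint k) * lpNorm p' (box ρ k T))) := fun k =>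
          (lintegral_enorm_mul_le hB0 hB _).trans (by gcongr; exact hG'w k)
        have hne : ∑' k, ∫⁻ ξ, ‖φ ξ * G' k ξ‖ₑ ≠ ⊤ := by
          refine ne_top_of_le_ne_top ?_ (ENNReal.tsum_le_tsum hle)
          rw [ENNReal.tsum_mul_left, ENNReal.tsum_mul_left]
          exact ENNReal.mul_ne_top ENNReal.ofReal_ne_top (ENNReal.mul_ne_top hKt hT.ne)
        refine (ENNReal.summable_toReal hne).congr fun k => ?_
        exact (integral_norm_eq_lintegral_enorm (hG'r k φ).1.1).symm
      have := hasSum_integral_of_summable_integral_norm (fun k => (hG'r k φ).1) hnorm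
      simpa only [tsum_mul_left] using this
    have h3 : HasSum (fun k => ∫ ξ, φ ξ * G' k ξ) (∑ k ∈ s, ∫ ξ, φ ξ * G' k ξ) :=
      hasSum_sum_of_ne_finset_zero fun k hk => by rw [← hblock, hs0 k hk, map_zero]
    change (𝓕 T) φ - D φ = 0
    rw [h1, (hD φ).2, h2.unique h3, sub_self]
  rw [hDT]
  exact hD

end FourierSide

end ModSpace

namespace ModSpace

open MeasureTheory Set Filter Topology SchwartzMap

variable {n : ℕ} {Y : Type*} [MeasurableSpace Y] {ν : Measure Y}

/-! ### Measurable families of distributions -/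

section Families

theorem exists_smoothRep_uncurry (χ : 𝓢(Space n, ℂ)) {T : Y → 𝓢'(Space n, ℂ)}
    (hT : ∀ φ : 𝓢(Space n, ℂ), AEStronglyMeasurable (fun y => T y φ) ν) :
    ∃ h : Space n → Y → ℂ, StronglyMeasurable (Function.uncurry h) ∧
      ∀ᵐ y ∂ν, ∀ x, smoothRep χ (T y) x = h x y :=
  exists_stronglyMeasurable_uncurry (fun _ => hT _)
    (ae_of_all _ fun y => continuous_smoothRep χ (T y))

theorem lpNorm_mult_eq_lintegral {p : ℝ≥0∞} (hp : 1 ≤ p) (hpt : p ≠ ⊤) (χ : 𝓢(Space n, ℂ))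
    (T : 𝓢'(Space n, ℂ)) :
    lpNorm p (mult χ T) = (∫⁻ x, ‖smoothRep χ T x‖ₑ ^ p.toReal) ^ (1 / p.toReal) := by
  rw [lpNorm_mult hp, eLpNorm_eq_lintegral_rpow_enorm_toReal (zero_lt_one.trans_le hp).ne' hpt]

theorem aemeasurable_lpNorm_mult {p : ℝ≥0∞} (hp : 1 ≤ p) (hpt : p ≠ ⊤) (χ : 𝓢(Space n, ℂ))
    {T : Y → 𝓢'(Space n, ℂ)}
    (hT : ∀ φ : 𝓢(Space n, ℂ), AEStronglyMeasurable (fun y => T y φ) ν) :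
    AEMeasurable (fun y => lpNorm p (mult χ (T y))) ν := by
  obtain ⟨h, hm, hh⟩ := exists_smoothRep_uncurry χ hT
  have hF : Measurable (Function.uncurry fun x y => ‖h x y‖ₑ ^ p.toReal) :=
    hm.enorm.pow_const _
  refine ⟨fun y => (∫⁻ x, ‖h x y‖ₑ ^ p.toReal) ^ (1 / p.toReal),
    hF.lintegral_prod_left'.pow_const _, ?_⟩
  filter_upwards [hh] with y hy
  simp only [lpNorm_mult_eq_lintegral hp hpt, hy]

/-- Minkowski's inequality for frequency-localized distributions. -/
theorem lpNorm_mult_le_lintegral [SFinite ν] [SigmaFinite ν] {p : ℝ≥0∞} (hp : 1 ≤ p)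
    (hpt : p ≠ ⊤) (χ : 𝓢(Space n, ℂ)) {T : Y → 𝓢'(Space n, ℂ)}
    (hT : ∀ φ : 𝓢(Space n, ℂ), AEStronglyMeasurable (fun y => T y φ) ν) {u : 𝓢'(Space n, ℂ)}
    (hu : ∀ φ : 𝓢(Space n, ℂ), ‖u φ‖ₑ ≤ ∫⁻ y, ‖T y φ‖ₑ ∂ν) :
    lpNorm p (mult χ u) ≤ ∫⁻ y, lpNorm p (mult χ (T y)) ∂ν := by
  obtain ⟨h, hm, hh⟩ := exists_smoothRep_uncurry χ hT
  have hp1 : 1 ≤ p.toReal := by simpa using ENNReal.toReal_mono hpt hp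
  have hF : Measurable (Function.uncurry fun x y => ‖h x y‖ₑ) := hm.enorm
  calc lpNorm p (mult χ u)
      ≤ (∫⁻ x, (∫⁻ y, ‖h x y‖ₑ ∂ν) ^ p.toReal) ^ (1 / p.toReal) := by
        rw [lpNorm_mult_eq_lintegral hp hpt]
        gcongr with x
        -- The hypothesis on u is used with the translated kernel as test function, which gives the
        -- value of the smooth representative at x.
        refine (hu _).trans_eq (lintegral_congr_ae ?_)
        filter_upwards [hh] with y hy
        rw [← hy]
        rfl
    _ ≤ ∫⁻ y, (∫⁻ x, ‖h x y‖ₑ ^ p.toReal) ^ (1 / p.toReal) ∂ν := lintegral_rpow_lintegral_le hp1 hF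
    _ = _ := by
        refine lintegral_congr_ae ?_
        filter_upwards [hh] with y hy
        simp only [lpNorm_mult_eq_lintegral hp hpt, hy]

end Families

/-! ### Pairings with bounded measurable multipliers -/

section Approximation

/-- A bounded measurable function of compact support is the almost everywhere limit of a uniformly
bounded sequence of Schwartz functions. -/
theorem exists_schwartz_tendsto_ae {v : Space n → ℂ} (hv : Measurable v) (hv1 : ∀ x, ‖v x‖ ≤ 1)
    (hvc : HasCompactSupport v) : ∃ φ : ℕ → 𝓢(Space n, ℂ), (∀ j x, ‖φ j x‖ ≤ 1) ∧
      ∀ᵐ x, Tendsto (fun j => φ j x) atTop (𝓝 (v x)) := by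
  have hint : Integrable v :=
    (integrableOn_iff_integrable_of_support_subset (subset_tsupport v)).1
      (Measure.integrableOn_of_bounded hvc.isCompact.measure_lt_top.ne hv.aestronglyMeasurable
        (ae_of_all _ hv1))
  -- The bounded ratio of the two radii is what almost everywhere convergence of the mollifications
  -- requires.
  set b : ℕ → ContDiffBump (0 : Space n) := fun j =>
    ⟨1 / (j + 1), 2 * (1 / (j + 1)), by positivity, by
      have : (0 : ℝ) < 1 / (j + 1) := by positivity
      linarith⟩ with hb
  have hlim : Tendsto (fun j => (b j).rOut) atTop (𝓝 0) := by
    simpa [hb] using tendsto_one_div_add_atTop_nhds_zero_nat.const_mul (2 : ℝ)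
  have hae := ContDiffBump.ae_convolution_tendsto_right_of_locallyIntegrable (μ := volume) (K := 2)
    hlim (Eventually.of_forall fun j => by simp [hb]) hint.locallyIntegrable
  set c : ℕ → Space n → ℂ := fun j =>
    convolution ((b j).normed volume) v (ContinuousLinearMap.lsmul ℝ ℝ) volume with hc
  have hcs : ∀ j, HasCompactSupport (c j) := fun j =>
    ((b j).hasCompactSupport_normed).convolution _ hvc
  have hcd : ∀ j, ContDiff ℝ (⊤ : ℕ∞) (c j) := fun j =>
    ((b j).hasCompactSupport_normed).contDiff_convolution_left _ (b j).contDiff_normed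
      hint.locallyIntegrable
  refine ⟨fun j => (hcs j).toSchwartzMap (hcd j), fun j x => ?_, hae⟩
  change ‖∫ y, (b j).normed volume y • v (x - y)‖ ≤ 1
  rw [← (b j).integral_normed (μ := volume)]
  refine norm_integral_le_of_norm_le (b j).integrable_normed (ae_of_all _ fun y => ?_)
  rw [norm_smul, Real.norm_of_nonneg ((b j).nonneg_normed y)]
  exact mul_le_of_le_one_right ((b j).nonneg_normed y) (hv1 _)

/-- If the pairings of `g y` with Schwartz functions are measurable in `y`, then so are its pairings
with Schwartz functions multiplied by bounded measurable functions. -/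
theorem aestronglyMeasurable_integral_mul {g : Y → Space n → ℂ}
    (hi : ∀ y, ∀ φ : 𝓢(Space n, ℂ), Integrable (fun ξ => φ ξ * g y ξ))
    (hg : ∀ φ : 𝓢(Space n, ℂ), AEStronglyMeasurable (fun y => ∫ ξ, φ ξ * g y ξ) ν)
    {v : Space n → ℂ} (hv : Measurable v) (hv1 : ∀ x, ‖v x‖ ≤ 1) (ψ : 𝓢(Space n, ℂ)) :
    AEStronglyMeasurable (fun y => ∫ ξ, ψ ξ * (v ξ * g y ξ)) ν := by
  -- Dominated convergence with majorant |ψ g_y|. It serves twice: to pass from cut-offs on balls to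
  -- v, and from Schwartz functions to these cut-offs.
  have key : ∀ (a : ℕ → Space n → ℂ) (b : Space n → ℂ), (∀ j x, ‖a j x‖ ≤ 1) →
      (∀ j, Measurable (a j)) → (∀ᵐ x, Tendsto (fun j => a j x) atTop (𝓝 (b x))) →
      (∀ j, AEStronglyMeasurable (fun y => ∫ ξ, ψ ξ * (a j ξ * g y ξ)) ν) →
      AEStronglyMeasurable (fun y => ∫ ξ, ψ ξ * (b ξ * g y ξ)) ν := by
    intro a b ha1 ham hab hj
    refine aestronglyMeasurable_of_tendsto_ae atTop hj (ae_of_all _ fun y => ?_)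
    have e : ∀ (z : Space n → ℂ) ξ, ψ ξ * (z ξ * g y ξ) = z ξ * (ψ ξ * g y ξ) := fun z ξ => by ring
    simp only [e]
    refine tendsto_integral_of_dominated_convergence (fun ξ => ‖ψ ξ * g y ξ‖)
      (fun j => (ham j).aestronglyMeasurable.mul (hi y ψ).1) (hi y ψ).norm
      (fun j => ae_of_all _ fun ξ => ?_) ?_
    · rw [norm_mul]
      exact mul_le_of_le_one_left (norm_nonneg _) (ha1 j ξ)
    · filter_upwards [hab] with ξ hξ using hξ.mul_const _
  set w : ℕ → Space n → ℂ := fun j => (Metric.closedBall 0 (j : ℝ)).indicator v with hw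
  have hwm : ∀ j, Measurable (w j) := fun j => hv.indicator measurableSet_closedBall
  have hw1 : ∀ j x, ‖w j x‖ ≤ 1 := fun j x => (norm_indicator_le_norm_self _ _).trans (hv1 x)
  refine key w v hw1 hwm (ae_of_all _ fun x => ?_) fun j => ?_
  · refine tendsto_const_nhds.congr' ?_
    filter_upwards [eventually_ge_atTop ⌈‖x‖⌉₊] with j hj
    rw [hw]
    simp only
    rw [indicator_of_mem]
    simpa using Nat.ceil_le.1 hj
  · have hc : HasCompactSupport (w j) :=
      HasCompactSupport.intro (isCompact_closedBall 0 (j : ℝ)) fun x hx => indicator_of_notMem hx _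
    obtain ⟨φ, hφ1, hφ⟩ := exists_schwartz_tendsto_ae (hwm j) (hw1 j) hc
    refine key (fun i => φ i) (w j) hφ1 (fun i => (φ i).continuous.measurable) hφ fun i => ?_
    refine (hg (prodS (φ i) ψ)).congr (ae_of_all _ fun y => ?_)
    refine integral_congr_ae (ae_of_all _ fun ξ => ?_)
    simp only [prodS_apply]
    ring

end Approximation

end ModSpace

namespace ModSpace

open MeasureTheory Set Filter Topology SchwartzMap

variable {n : ℕ} {P : Space n → ℝ}

/-! ### The propagator on the Fourier side -/

section Propagator

/-- The symbol of the propagator. -/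
def phase (P : Space n → ℝ) (t : ℝ) (ξ : Space n) : ℂ :=
  Complex.exp (Complex.I * ((t * P ((2 * Real.pi) • ξ) : ℝ) : ℂ))

theorem norm_phase (P : Space n → ℝ) (t : ℝ) (ξ : Space n) : ‖phase P t ξ‖ = 1 :=
  Complex.norm_exp_I_mul_ofReal _

theorem measurable_phase (hP : Measurable P) (t : ℝ) : Measurable (phase P t) := by
  unfold phase
  exact Complex.measurable_exp.comp ((Complex.measurable_ofReal.comp
    ((hP.comp (measurable_const_smul _)).const_mul t)).const_mul _)

theorem continuous_phase (P : Space n → ℝ) (ξ : Space n) : Continuous fun t => phase P t ξ := by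
  unfold phase
  fun_prop

theorem enorm_phase_mul (P : Space n → ℝ) (t : ℝ) (ξ : Space n) (z : ℂ) :
    ‖phase P t ξ * z‖ₑ = ‖z‖ₑ := by
  rw [enorm_mul, ← ofReal_norm (phase P t ξ), norm_phase, ENNReal.ofReal_one, one_mul]

/-- The density inside `IsPropagated` is existential; uniqueness of representatives lets it be
replaced by a prescribed one. -/
theorem IsPropagated.apply_eq {t : ℝ} {f u : 𝓢'(Space n, ℂ)} (h : IsPropagated P t f u)
    {g : Space n → ℂ} (hg : IsRepresentedBy (𝓕 f) g) (φ : 𝓢(Space n, ℂ)) :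
    u φ = ∫ ξ, (𝓕⁻ φ : 𝓢(Space n, ℂ)) ξ * (phase P t ξ * g ξ) := by
  obtain ⟨g', h1, h2, h3⟩ := h
  have hae := IsRepresentedBy.ae_eq (fun φ => ⟨h1 φ, h2 φ⟩ : IsRepresentedBy (𝓕 f) g') hg
  have h4 : (𝓕 u) (𝓕⁻ φ) = u φ := by
    rw [TemperedDistribution.fourier_apply, FourierTransform.fourier_fourierInv_eq]
  rw [← h4, h3]
  refine integral_congr_ae ?_
  filter_upwards [hae] with ξ hξ
  rw [hξ, phase]

theorem exists_isPropagated (hP : Measurable P) (t : ℝ) {f : 𝓢'(Space n, ℂ)} {g : Space n → ℂ}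
    (hg : IsRepresentedBy (𝓕 f) g) (hgm : AEStronglyMeasurable g volume) {N : ℕ}
    (hN : ∫⁻ ξ, wt N ξ * ‖g ξ‖ₑ < ⊤) : ∃ u, IsPropagated P t f u := by
  obtain ⟨D, hD⟩ := exists_isRepresentedBy_of_wt (g := fun ξ => phase P t ξ * g ξ) (N := N)
    ((measurable_phase hP t).aestronglyMeasurable.mul hgm) (by simpa only [enorm_phase_mul] using hN)
  refine ⟨𝓕⁻ D, g, fun φ => (hg φ).1, fun φ => (hg φ).2, fun φ => ?_⟩
  rw [FourierTransform.fourier_fourierInv_eq, (hD φ).2]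
  rfl

end Propagator

/-! ### Existence, uniqueness and measurability of the Duhamel integral -/

section Duhamel

/-- For almost every `τ` the Fourier transform of `f τ` is the function `g τ`, with a weighted
`L¹` norm that is bounded by the locally integrable function `A`. -/
structure IsFourierDensity (f : ℝ → 𝓢'(Space n, ℂ)) (g : ℝ → Space n → ℂ) (N : ℕ)
    (A : ℝ → ℝ) : Prop where
  aestronglyMeasurable : ∀ τ, AEStronglyMeasurable (g τ) volume
  lintegral_le : ∀ τ, ∫⁻ ξ, wt N ξ * ‖g τ ξ‖ₑ ≤ ENNReal.ofReal (A τ)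
  nonneg : ∀ τ, 0 ≤ A τ
  locallyIntegrable : LocallyIntegrable A
  isRepresentedBy : ∀ᵐ τ, IsRepresentedBy (𝓕 (f τ)) (g τ)

variable {f : ℝ → 𝓢'(Space n, ℂ)} {g : ℝ → Space n → ℂ} {N : ℕ} {A : ℝ → ℝ}

/-- The pairing of the propagated Fourier transform with a Schwartz function. -/
def pairing (P : Space n → ℝ) (g : ℝ → Space n → ℂ) (ψ : 𝓢(Space n, ℂ)) (s τ : ℝ) : ℂ :=
  ∫ ξ, ψ ξ * (phase P s ξ * g τ ξ)

namespace IsFourierDensity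

theorem lintegral_lt_top (h : IsFourierDensity f g N A) (τ : ℝ) :
    ∫⁻ ξ, wt N ξ * ‖g τ ξ‖ₑ < ⊤ := (h.lintegral_le τ).trans_lt ENNReal.ofReal_lt_top

theorem integrable (h : IsFourierDensity f g N A) (τ : ℝ) (φ : 𝓢(Space n, ℂ)) :
    Integrable (fun ξ => φ ξ * g τ ξ) :=
  integrable_schwartz_mul_of_wt (h.aestronglyMeasurable τ) (h.lintegral_lt_top τ) φ

theorem intervalIntegrable (h : IsFourierDensity f g N A) (a b : ℝ) :
    IntervalIntegrable A volume a b :=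
  (intervalIntegrable_iff' (by finiteness)).2 (h.locallyIntegrable.integrableOn_isCompact isCompact_uIcc)

theorem integrable_phase (h : IsFourierDensity f g N A) (hP : Measurable P) (s τ : ℝ)
    (φ : 𝓢(Space n, ℂ)) : Integrable (fun ξ => φ ξ * (phase P s ξ * g τ ξ)) :=
  integrable_schwartz_mul_of_wt (g := fun ξ => phase P s ξ * g τ ξ) (N := N)
    ((measurable_phase hP s).aestronglyMeasurable.mul (h.aestronglyMeasurable τ))
    (by simpa only [enorm_phase_mul] using h.lintegral_lt_top τ) φ

theorem norm_pairing_le (h : IsFourierDensity f g N A) {ψ : 𝓢(Space n, ℂ)} {B : ℝ} (hB : 0 ≤ B)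
    (hψ : ∀ x, (1 + ‖x‖) ^ N * ‖ψ x‖ ≤ B) (s τ : ℝ) : ‖pairing P g ψ s τ‖ ≤ B * A τ := by
  have h1 := (enorm_integral_le_lintegral_enorm (μ := volume)
    fun ξ => ψ ξ * (phase P s ξ * g τ ξ)).trans (lintegral_enorm_mul_le hB hψ _)
  simp only [enorm_phase_mul] at h1
  have h2 := h1.trans (mul_le_mul_right (h.lintegral_le τ) _)
  rwa [← ENNReal.ofReal_mul hB, ← ofReal_norm,
    ENNReal.ofReal_le_ofReal_iff (mul_nonneg hB (h.nonneg τ))] at h2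

theorem continuous_pairing (h : IsFourierDensity f g N A) (hP : Measurable P)
    (ψ : 𝓢(Space n, ℂ)) (τ : ℝ) : Continuous fun s => pairing P g ψ s τ := by
  refine continuous_of_dominated (bound := fun ξ => ‖ψ ξ * g τ ξ‖)
    (fun s => (h.integrable_phase hP s τ ψ).1) (fun s => ae_of_all _ fun ξ => ?_)
    (h.integrable τ ψ).norm
    (ae_of_all _ fun ξ => continuous_const.mul ((continuous_phase P ξ).mul continuous_const))
  rw [norm_mul, norm_mul, norm_mul, norm_phase, one_mul]

/-- With s and τ separated the pairing is measurable in τ and continuous in s; joint measurability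
then permits the substitution s = t - τ. -/
theorem aestronglyMeasurable_pairing (h : IsFourierDensity f g N A) (hP : Measurable P)
    (hf : TimeMeasurable f) (ψ : 𝓢(Space n, ℂ)) (t : ℝ) :
    AEStronglyMeasurable (fun τ => pairing P g ψ (t - τ) τ) := by
  have h1 : ∀ s, AEStronglyMeasurable (fun τ => pairing P g ψ s τ) := fun s => by
    refine aestronglyMeasurable_integral_mul (fun τ φ => h.integrable τ φ) (fun φ => ?_)
      (measurable_phase hP s) (fun ξ => (norm_phase P s ξ).le) ψ
    refine (hf (𝓕 φ)).congr ?_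
    filter_upwards [h.isRepresentedBy] with τ hτ
    exact (hτ φ).2
  obtain ⟨H, hH, hHe⟩ := exists_stronglyMeasurable_uncurry h1
    (ae_of_all _ fun τ => h.continuous_pairing hP ψ τ)
  refine ⟨fun τ => H (t - τ) τ, hH.comp_measurable
    ((measurable_const.sub measurable_id).prodMk measurable_id), ?_⟩
  filter_upwards [hHe] with τ hτ using hτ _

theorem intervalIntegrable_pairing (h : IsFourierDensity f g N A) (hP : Measurable P)
    (hf : TimeMeasurable f) (ψ : 𝓢(Space n, ℂ)) (t a b : ℝ) :
    IntervalIntegrable (fun τ => pairing P g ψ (t - τ) τ) volume a b := by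
  obtain ⟨B, hB, hψ⟩ := exists_pow_mul_norm_le ψ N
  refine ((h.intervalIntegrable _ _).const_mul B).mono_fun
    (h.aestronglyMeasurable_pairing hP hf ψ t).restrict (ae_of_all _ fun τ => ?_)
  beta_reduce
  rw [Real.norm_of_nonneg (mul_nonneg hB (h.nonneg τ))]
  exact h.norm_pairing_le hB hψ _ τ

theorem exists_isDuhamel (h : IsFourierDensity f g N A) (hP : Measurable P)
    (hf : TimeMeasurable f) : ∃ u, IsDuhamel P f u := by
  have hi := fun ψ t => h.intervalIntegrable_pairing hP hf ψ t 0 t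
  have hD : ∀ t : ℝ, ∃ D : 𝓢'(Space n, ℂ), ∀ ψ,
      D ψ = ∫ τ in (0 : ℝ)..t, pairing P g ψ (t - τ) τ := fun t => by
    refine exists_temperedDistribution _ (fun φ ψ => ?_) (fun a φ => ?_) N
      (∫ τ in uIoc 0 t, A τ) (integral_nonneg h.nonneg) fun φ B hB hφ => ?_
    · rw [← intervalIntegral.integral_add (hi φ t) (hi ψ t)]
      refine intervalIntegral.integral_congr fun τ _ => ?_
      simp only [pairing]
      rw [← integral_add (h.integrable_phase hP _ _ _) (h.integrable_phase hP _ _ _)]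
      simp [add_mul]
    · rw [← intervalIntegral.integral_const_mul]
      refine intervalIntegral.integral_congr fun τ _ => ?_
      simp only [pairing]
      rw [← integral_const_mul]
      simp [mul_assoc]
    · refine intervalIntegral.norm_integral_le_integral_norm_uIoc.trans ?_
      rw [mul_comm, ← integral_const_mul]
      have hA : IntegrableOn A (uIoc 0 t) :=
        intervalIntegrable_iff.1 (h.intervalIntegrable _ _)
      exact integral_mono (intervalIntegrable_iff.1 (hi φ t)).norm (hA.const_mul B)
        fun τ => h.norm_pairing_le hB hφ _ τ
  -- At the null set of τ where g τ does not represent the Fourier transform of f τ, the value 0 is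
  -- an arbitrary choice.
  have hw : ∀ t τ : ℝ, ∃ w, IsRepresentedBy (𝓕 (f τ)) (g τ) → IsPropagated P (t - τ) (f τ) w :=
    fun t τ => by
      by_cases hr : IsRepresentedBy (𝓕 (f τ)) (g τ)
      · obtain ⟨w, hw⟩ := exists_isPropagated hP (t - τ) hr (h.aestronglyMeasurable τ)
          (h.lintegral_lt_top τ)
        exact ⟨w, fun _ => hw⟩
      · exact ⟨0, fun h => absurd h hr⟩
  choose D hD using hD
  choose w hw using hw
  refine ⟨fun t => 𝓕⁻ (D t), w, fun t => ⟨?_, fun φ => ?_⟩⟩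
  · filter_upwards [ae_restrict_of_ae h.isRepresentedBy] with τ hτ using hw t τ hτ
  · have he : (fun τ => pairing P g (𝓕⁻ φ) (t - τ) τ) =ᵐ[volume] fun τ => w t τ φ := by
      filter_upwards [h.isRepresentedBy] with τ hτ
      exact ((hw t τ hτ).apply_eq hτ φ).symm
    refine ⟨(hi (𝓕⁻ φ) t).congr_ae (ae_restrict_of_ae he), ?_⟩
    rw [TemperedDistribution.fourierInv_apply, hD]
    exact intervalIntegral.integral_congr_ae (he.mono fun τ hτ _ => hτ)

/-- The family w in `IsDuhamel` is existential, but its pairings with test functions are forced for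
almost every τ; hence all Duhamel integrals of f coincide. -/
theorem duhamel_apply_eq (h : IsFourierDensity f g N A) {u : ℝ → 𝓢'(Space n, ℂ)}
    (hu : IsDuhamel P f u) (t : ℝ) (φ : 𝓢(Space n, ℂ)) :
    u t φ = ∫ τ in (0 : ℝ)..t, pairing P g (𝓕⁻ φ) (t - τ) τ := by
  obtain ⟨w, hw⟩ := hu
  rw [((hw t).2 φ).2]
  refine intervalIntegral.integral_congr_ae ?_
  filter_upwards [h.isRepresentedBy, (ae_restrict_iff' measurableSet_uIoc).1 (hw t).1] with τ hτ h1 h2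
  exact (h1 h2).apply_eq hτ φ

/-- The pairings of u t are even continuous in t, by domination with the locally integrable function
B * A τ. -/
theorem timeMeasurable_duhamel (h : IsFourierDensity f g N A) (hP : Measurable P)
    (hf : TimeMeasurable f) {u : ℝ → 𝓢'(Space n, ℂ)} (hu : IsDuhamel P f u) :
    TimeMeasurable u := fun φ => by
  obtain ⟨B, hB, hψ⟩ := exists_pow_mul_norm_le (𝓕⁻ φ : 𝓢(Space n, ℂ)) N
  refine Continuous.aestronglyMeasurable ?_
  simp only [h.duhamel_apply_eq hu]
  refine continuous_iff_continuousAt.2 fun t₀ => ?_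
  -- The time t occurs both as upper limit and in the phase, so joint continuity is composed with
  -- the diagonal. The reference interval has 0 and t₀ in its interior.
  have hc := intervalIntegral.continuousAt_parametric_primitive_of_dominated (μ := volume)
    (F := fun t τ => pairing P g (𝓕⁻ φ) (t - τ) τ) (fun τ => B * A τ) (-(|t₀| + 1)) (|t₀| + 1)
    (a₀ := 0) (b₀ := t₀) (x₀ := t₀)
    (fun t => (h.aestronglyMeasurable_pairing hP hf _ t).restrict)
    (Eventually.of_forall fun t => ae_of_all _ fun τ => h.norm_pairing_le hB hψ _ τ)
    ((h.intervalIntegrable _ _).const_mul B)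
    (ae_of_all _ fun τ => ((h.continuous_pairing hP _ τ).comp
      (continuous_id.sub continuous_const)).continuousAt)
    ⟨by linarith [abs_nonneg t₀], by linarith [abs_nonneg t₀]⟩
    ⟨by linarith [neg_abs_le t₀], by linarith [le_abs_self t₀]⟩ (measure_singleton _)
  exact hc.comp (f := fun t => (t, t)) (continuous_id.prodMk continuous_id).continuousAt

end IsFourierDensity

end Duhamel

end ModSpace

namespace ModSpace

open MeasureTheory Set Filter Topology SchwartzMap

variable {n : ℕ} {ρ P : Space n → ℝ}

/-! ### Homogeneity and Hölder for the mixed norms -/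

section Norms

theorem lintegral_const_mul_rpow {X : Type*} [MeasurableSpace X] {ν : Measure X} {r : ℝ}
    (hr : 0 < r) {c : ℝ≥0∞} (hc : c ≠ ⊤) (F : X → ℝ≥0∞) :
    (∫⁻ x, (c * F x) ^ r ∂ν) ^ (1 / r) = c * (∫⁻ x, F x ^ r ∂ν) ^ (1 / r) := by
  simp only [ENNReal.mul_rpow_of_nonneg _ _ hr.le]
  rw [lintegral_const_mul' _ _ (ENNReal.rpow_ne_top_of_nonneg hr.le hc),
    ENNReal.mul_rpow_of_nonneg _ _ (by positivity), ← ENNReal.rpow_mul, mul_one_div_cancel hr.ne',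
    ENNReal.rpow_one]

theorem tsum_const_mul_rpow {ι : Type*} {r : ℝ} (hr : 0 < r) (c : ℝ≥0∞) (a : ι → ℝ≥0∞) :
    (∑' i, (c * a i) ^ r) ^ (1 / r) = c * (∑' i, a i ^ r) ^ (1 / r) := by
  simp only [ENNReal.mul_rpow_of_nonneg _ _ hr.le]
  rw [ENNReal.tsum_mul_left, ENNReal.mul_rpow_of_nonneg _ _ (by positivity), ← ENNReal.rpow_mul,
    mul_one_div_cancel hr.ne', ENNReal.rpow_one]

theorem eLpNorm_eq_lintegral_rpow {X : Type*} [MeasurableSpace X] {ν : Measure X} {γ : ℝ≥0∞}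
    (h0 : γ ≠ 0) (ht : γ ≠ ⊤) (F : X → ℝ≥0∞) :
    eLpNorm F γ ν = (∫⁻ x, F x ^ γ.toReal ∂ν) ^ (1 / γ.toReal) := by
  simp [eLpNorm_eq_lintegral_rpow_enorm_toReal h0 ht]

theorem weightedSeqNorm_le_mul {s s' : ℝ} {q : ℝ≥0∞} (hq1 : 1 ≤ q) (hq : q ≠ ⊤)
    {a b : (Fin n → ℤ) → ℝ≥0∞} {K : ℝ≥0∞}
    (h : ∀ k, ENNReal.ofReal ((1 + ‖latticePoint k‖) ^ s) * a k ≤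
      K * (ENNReal.ofReal ((1 + ‖latticePoint k‖) ^ s') * b k)) :
    weightedSeqNorm s q a ≤ K * weightedSeqNorm s' q b := by
  have hq0 : 0 < q.toReal := ENNReal.toReal_pos (zero_lt_one.trans_le hq1).ne' hq
  rw [weightedSeqNorm_of_ne_top hq, weightedSeqNorm_of_ne_top hq, ← tsum_const_mul_rpow hq0]
  have := hq0.le
  exact ENNReal.rpow_le_rpow (ENNReal.tsum_le_tsum fun k => ENNReal.rpow_le_rpow (h k) this)
    (by positivity)

theorem ofReal_rpow_mul_ofReal_rpow (k : Fin n → ℤ) (a b : ℝ) :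
    ENNReal.ofReal ((1 + ‖latticePoint k‖) ^ a) * ENNReal.ofReal ((1 + ‖latticePoint k‖) ^ b) =
      ENNReal.ofReal ((1 + ‖latticePoint k‖) ^ (a + b)) := by
  rw [← ENNReal.ofReal_mul (by positivity), ← Real.rpow_add (by positivity)]

theorem lintegral_le_rpow_mul_measure {X : Type*} [MeasurableSpace X] {ν : Measure X} {r r' : ℝ}
    (hr : r.HolderConjugate r') {F : X → ℝ≥0∞} (hF : AEMeasurable F ν) :
    ∫⁻ x, F x ∂ν ≤ (∫⁻ x, F x ^ r ∂ν) ^ (1 / r) * ν univ ^ (1 / r') := by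
  have := ENNReal.lintegral_mul_le_Lp_mul_Lq ν hr hF (aemeasurable_const (b := (1 : ℝ≥0∞)))
  simpa using this

end Norms

/-! ### From block norms to a Fourier density -/

section Density

variable {f : ℝ → 𝓢'(Space n, ℂ)}

theorem IsCutoff.aemeasurable_lpNorm_box (hρ : IsCutoff ρ) {p : ℝ≥0∞} (hp : 1 ≤ p) (hpt : p ≠ ⊤)
    (hf : TimeMeasurable f) (k : Fin n → ℤ) : AEMeasurable fun τ => lpNorm p (box ρ k (f τ)) :=
  aemeasurable_lpNorm_mult hp hpt (hρ.symbol k) hf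

/-- Hölder's inequality in time makes each block norm locally integrable, and a sufficiently
negative polynomial weight makes the blocks summable. -/
theorem IsCutoff.exists_isFourierDensity (hρ : IsCutoff ρ) {p p' : ℝ≥0∞}
    [hpp : ENNReal.HolderConjugate p p'] (hp2 : p' ≤ 2) {r r' : ℝ} (hr : r.HolderConjugate r')
    (hf : TimeMeasurable f) {a : ℝ} {B : ℝ≥0∞} (hB : B ≠ ⊤)
    (hfB : ∀ k, ENNReal.ofReal ((1 + ‖latticePoint k‖) ^ a) *
      (∫⁻ τ, lpNorm p' (box ρ k (f τ)) ^ r) ^ (1 / r) ≤ B) :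
    ∃ g N A, IsFourierDensity f g N A := by
  have hp' : 1 ≤ p' := (ENNReal.HolderConjugate.symm (p := p) (q := p')).one_le
  have hpt' : p' ≠ ⊤ := (hp2.trans_lt ENNReal.ofNat_lt_top).ne
  -- With this N the weight (1+|k|)^(-N) splits into the factor (1+|k|)^a controlled by B and the
  -- summable factor (1+|k|)^(-a-N).
  obtain ⟨N, hN⟩ := summable_one_add_norm_latticePoint (n := n) (-a)
  obtain ⟨C, hC⟩ := hρ.exists_fourier_isRepresentedBy (p := p) hp2 N
  set A₀ : ℝ → ℝ≥0∞ := fun τ => ∑' k, wt N (latticePoint k) * lpNorm p' (box ρ k (f τ)) with hA₀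
  have hFm := hρ.aemeasurable_lpNorm_box hp' hpt' hf
  have hA₀m : AEMeasurable A₀ := AEMeasurable.tsum fun k => (hFm k).const_mul _
  have hloc : ∀ K : Set ℝ, IsCompact K → ∫⁻ τ in K, A₀ τ ≠ ⊤ := by
    intro K hK
    have hterm : ∀ k, ∫⁻ τ in K, wt N (latticePoint k) * lpNorm p' (box ρ k (f τ)) ≤
        ENNReal.ofReal ((1 + ‖latticePoint k‖) ^ (-a - N)) * (B * volume K ^ (1 / r')) := by
      intro k
      have hwt : wt N (latticePoint k) = ENNReal.ofReal ((1 + ‖latticePoint k‖) ^ (-a - N)) *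
          ENNReal.ofReal ((1 + ‖latticePoint k‖) ^ a) := by
        rw [ofReal_rpow_mul_ofReal_rpow, wt]
        congr 2
        ring
      rw [lintegral_const_mul' (wt N (latticePoint k)) _ ENNReal.ofReal_ne_top, hwt, mul_assoc]
      refine mul_le_mul_right ?_ _
      calc _ ≤ ENNReal.ofReal ((1 + ‖latticePoint k‖) ^ a) *
            ((∫⁻ τ in K, lpNorm p' (box ρ k (f τ)) ^ r) ^ (1 / r) * volume K ^ (1 / r')) := by
            gcongr
            simpa using lintegral_le_rpow_mul_measure hr (hFm k).restrict
        _ ≤ ENNReal.ofReal ((1 + ‖latticePoint k‖) ^ a) *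
            ((∫⁻ τ, lpNorm p' (box ρ k (f τ)) ^ r) ^ (1 / r) * volume K ^ (1 / r')) := by
            have := hr.pos
            gcongr
            exact Measure.restrict_le_self
        _ ≤ _ := by
            rw [← mul_assoc]
            exact mul_le_mul_left (hfB k) _
    rw [lintegral_tsum fun k => ((hFm k).const_mul _).restrict]
    refine ne_top_of_le_ne_top ?_ (ENNReal.tsum_le_tsum hterm)
    rw [ENNReal.tsum_mul_right]
    refine ENNReal.mul_ne_top hN.tsum_ofReal_ne_top (ENNReal.mul_ne_top hB ?_)
    exact ENNReal.rpow_ne_top_of_nonneg (one_div_nonneg.2 hr.symm.nonneg) hK.measure_lt_top.ne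
  have hfin : ∀ᵐ τ, A₀ τ < ⊤ := by
    have h1 : ∀ j : ℕ, ∀ᵐ τ ∂volume.restrict (Metric.closedBall (0 : ℝ) j), A₀ τ < ⊤ := fun j =>
      ae_lt_top' hA₀m.restrict (hloc _ (isCompact_closedBall _ _))
    have h2 := (ae_restrict_iUnion_iff _ _).2 h1
    rwa [Metric.iUnion_closedBall_nat, Measure.restrict_univ] at h2
  -- Where A₀ is infinite, g is 0 and `toReal` returns 0, so the bound holds for every τ.
  have hg : ∀ τ, ∃ g : Space n → ℂ, AEStronglyMeasurable g volume ∧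
      ∫⁻ ξ, wt N ξ * ‖g ξ‖ₑ ≤ ENNReal.ofReal (C * (A₀ τ).toReal) ∧
      (A₀ τ < ⊤ → IsRepresentedBy (𝓕 (f τ)) g) := fun τ => by
    by_cases h : A₀ τ < ⊤
    · obtain ⟨g, h1, h2, h3⟩ := hC (f τ) h
      refine ⟨g, h1, h3.trans_eq ?_, fun _ => h2⟩
      rw [ENNReal.ofReal_mul C.coe_nonneg, ENNReal.ofReal_toReal h.ne, ENNReal.ofReal_coe_nnreal]
    · exact ⟨0, aestronglyMeasurable_const, by simp, fun h' => absurd h' h⟩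
  choose g h1 h2 h3 using hg
  refine ⟨g, N, fun τ => C * (A₀ τ).toReal, h1, h2, fun τ => by positivity, ?_,
    hfin.mono fun τ hτ => h3 τ hτ⟩
  exact locallyIntegrable_iff.2 fun K hK =>
    (integrable_toReal_of_lintegral_ne_top hA₀m.restrict (hloc K hK)).const_mul _

end Density

/-! ### Convolution bound for the blocks -/

section Estimates

variable {f u : ℝ → 𝓢'(Space n, ℂ)}

theorem enorm_intervalIntegral_le (F : ℝ → ℂ) (a b : ℝ) :
    ‖∫ τ in a..b, F τ‖ₑ ≤ ∫⁻ τ in uIoc a b, ‖F τ‖ₑ := by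
  rw [← ofReal_norm, intervalIntegral.norm_intervalIntegral_eq, ofReal_norm]
  exact enorm_integral_le_lintegral_enorm _

/-- The time-convolution bound for each frequency block of the Duhamel integral. -/
theorem IsDuhamel.lpNorm_box_le (hρ : IsCutoff ρ) (hu : IsDuhamel P f u) {p p' : ℝ≥0∞}
    (hp : 1 ≤ p) (hpt : p ≠ ⊤) {δ μ : ℝ} {C : ℝ≥0}
    (hC : ∀ (k : Fin n → ℤ) (t : ℝ) (f w : 𝓢'(Space n, ℂ)), lpNorm p' (box ρ k f) < ⊤ →
      IsPropagated P t f w → lpNorm p (box ρ k w) ≤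
        C * decayKernel μ t * (ENNReal.ofReal ((1 + ‖latticePoint k‖) ^ δ) *
          lpNorm p' (box ρ k f)))
    {k : Fin n → ℤ} (hk : ∀ᵐ τ, lpNorm p' (box ρ k (f τ)) < ⊤) (t : ℝ) :
    lpNorm p (box ρ k (u t)) ≤ C * ENNReal.ofReal ((1 + ‖latticePoint k‖) ^ δ) *
      ∫⁻ τ, decayKernel μ (t - τ) * lpNorm p' (box ρ k (f τ)) := by
  obtain ⟨w, hw⟩ := hu
  obtain ⟨hw1, hw2⟩ := hw t
  calc lpNorm p (box ρ k (u t)) ≤ ∫⁻ τ in uIoc 0 t, lpNorm p (box ρ k (w t τ)) := by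
        refine lpNorm_mult_le_lintegral hp hpt (hρ.symbol k)
          (fun φ => (intervalIntegrable_iff.1 (hw2 φ).1).1) fun φ => ?_
        rw [(hw2 φ).2]
        exact enorm_intervalIntegral_le _ _ _
    _ ≤ ∫⁻ τ in uIoc 0 t, C * ENNReal.ofReal ((1 + ‖latticePoint k‖) ^ δ) *
          (decayKernel μ (t - τ) * lpNorm p' (box ρ k (f τ))) := by
        refine lintegral_mono_ae ?_
        filter_upwards [hw1, ae_restrict_of_ae hk] with τ h1 h2
        refine (hC k _ _ _ h2 h1).trans_eq ?_
        ring
    -- Enlarging the domain of integration to the whole line produces a convolution, for either sign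
    -- of t.
    _ ≤ ∫⁻ τ, C * ENNReal.ofReal ((1 + ‖latticePoint k‖) ^ δ) *
          (decayKernel μ (t - τ) * lpNorm p' (box ρ k (f τ))) := setLIntegral_le_lintegral _ _
    _ = _ := lintegral_const_mul' _ _ (ENNReal.mul_ne_top ENNReal.coe_ne_top ENNReal.ofReal_ne_top)

/-- Supplies the finiteness of the block norms at almost every time, which the block decay estimate
requires. -/
theorem ae_lt_top_of_rpow {F : ℝ → ℝ≥0∞} (hF : AEMeasurable F) {r : ℝ} (hr : 0 < r) {c : ℝ≥0∞}
    (hc : c ≠ 0) {B : ℝ≥0∞} (hB : B ≠ ⊤) (h : c * (∫⁻ τ, F τ ^ r) ^ (1 / r) ≤ B) :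
    ∀ᵐ τ, F τ < ⊤ := by
  have h1 : ∫⁻ τ, F τ ^ r ≠ ⊤ := fun e => by
    rw [e, ENNReal.top_rpow_of_pos (by positivity), ENNReal.mul_top hc] at h
    exact hB (top_le_iff.1 h)
  filter_upwards [ae_lt_top' (hF.pow_const r) h1] with τ hτ
  exact (ENNReal.rpow_lt_top_iff_of_pos hr).1 hτ

end Estimates

end ModSpace

namespace ModSpace

open MeasureTheory Set Filter Topology SchwartzMap

variable {n : ℕ} {ρ P : Space n → ℝ} {p p' q γ γ' : ℝ≥0∞} {α δ μ : ℝ}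

/-! ### The inhomogeneous Strichartz estimates -/

section Strichartz

theorem toReal_conjugate_eq (hμ0 : 0 < μ) (hμ1 : μ < 1) (hγ : γ = ENNReal.ofReal (2 / μ))
    (h : ENNReal.HolderConjugate γ γ') :
    γ.toReal = 2 / μ ∧ γ'.toReal = 2 / (2 - μ) ∧ γ'.toReal.HolderConjugate γ.toReal := by
  have h1 : γ.toReal = 2 / μ := by rw [hγ, ENNReal.toReal_ofReal (by positivity)]
  have h2 : 1 < γ.toReal := by rw [h1, one_lt_div hμ0]; linarith
  have h3 : γ.toReal.HolderConjugate γ'.toReal := ENNReal.HolderConjugate.toReal h2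
  refine ⟨h1, ?_, h3.symm⟩
  have : 2 / μ - 1 ≠ 0 := by rw [← h1]; linarith
  rw [h3.conjugate_eq, h1]
  have : 2 - μ ≠ 0 := by linarith
  field_simp

theorem lintegral_rpow_duhamel_le {C : ℝ≥0} (hμ0 : 0 < μ)
    (hC : ∀ g : ℝ → ℝ≥0∞, AEMeasurable g →
      (∫⁻ t, (∫⁻ τ, decayKernel μ (t - τ) * g τ) ^ (2 / μ)) ^ (1 / (2 / μ)) ≤
        C * (∫⁻ τ, g τ ^ (2 / (2 - μ))) ^ (1 / (2 / (2 - μ)))) {c : ℝ≥0∞} (hc : c ≠ ⊤)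
    {F G : ℝ → ℝ≥0∞} (hF : AEMeasurable F)
    (hG : ∀ t, G t ≤ c * ∫⁻ τ, decayKernel μ (t - τ) * F τ) :
    (∫⁻ t, G t ^ (2 / μ)) ^ (1 / (2 / μ)) ≤
      c * C * (∫⁻ τ, F τ ^ (2 / (2 - μ))) ^ (1 / (2 / (2 - μ))) := by
  have h0 : 0 < 2 / μ := by positivity
  calc _ ≤ (∫⁻ t, (c * ∫⁻ τ, decayKernel μ (t - τ) * F τ) ^ (2 / μ)) ^ (1 / (2 / μ)) := by
        gcongr with t
        exact hG t
    _ ≤ _ := by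
        rw [lintegral_const_mul_rpow h0 hc, mul_assoc]
        gcongr
        exact hC F hF

/-- Existence, measurability and frequency-localized bounds for the Duhamel integral. -/
theorem HasDecay.exists_duhamel_bound (hρ : IsCutoff ρ) (hP : Measurable P) (hp : 2 ≤ p)
    (hpt : p < ⊤) (hpp : ENNReal.HolderConjugate p p') (hq : 1 ≤ q) (hqt : q < ⊤)
    (hdecay : HasDecay ρ P p p' q α δ μ) {r r' : ℝ} (hr : r.HolderConjugate r') :
    ∃ C : ℝ≥0, ∀ f : ℝ → 𝓢'(Space n, ℂ), TimeMeasurable f → ∀ (a : ℝ) (B : ℝ≥0∞), B ≠ ⊤ →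
      (∀ k, ENNReal.ofReal ((1 + ‖latticePoint k‖) ^ a) *
        (∫⁻ τ, lpNorm p' (box ρ k (f τ)) ^ r) ^ (1 / r) ≤ B) →
      (∃ u, IsDuhamel P f u) ∧ ∀ u, IsDuhamel P f u → TimeMeasurable u ∧ ∀ k t,
        lpNorm p (box ρ k (u t)) ≤ C * ENNReal.ofReal ((1 + ‖latticePoint k‖) ^ δ) *
          ∫⁻ τ, decayKernel μ (t - τ) * lpNorm p' (box ρ k (f τ)) := by
  have hp1 : 1 ≤ p := one_le_two.trans hp
  have hp'1 : 1 ≤ p' := hpp.symm.one_le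
  have hp'2 : p' ≤ 2 := by
    have h1 : p'⁻¹ = 1 - p⁻¹ := by
      rw [← ENNReal.HolderConjugate.inv_add_inv_eq_one p p']
      exact (ENNReal.add_sub_cancel_left (ENNReal.inv_ne_top.2 (zero_lt_one.trans_le hp1).ne')).symm
    rw [← ENNReal.inv_le_inv, h1]
    calc (2 : ℝ≥0∞)⁻¹ = 1 - 2⁻¹ := ENNReal.one_sub_inv_two.symm
      _ ≤ 1 - p⁻¹ := by gcongr
  have hp't : p' ≠ ⊤ := (hp'2.trans_lt ENNReal.ofNat_lt_top).ne
  obtain ⟨C, hC⟩ := hdecay.exists_lpNorm_box_le hρ hp1 hp'1 hp't hq hqt.ne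
  refine ⟨C, fun f hf a B hB hfB => ?_⟩
  obtain ⟨g, N, A, hd⟩ := hρ.exists_isFourierDensity (p := p) hp'2 hr hf hB hfB
  refine ⟨hd.exists_isDuhamel hP hf, fun u hu => ⟨hd.timeMeasurable_duhamel hP hf hu, fun k t => ?_⟩⟩
  refine hu.lpNorm_box_le hρ hp1 hpt.ne hC ?_ t
  refine ae_lt_top_of_rpow (hρ.aemeasurable_lpNorm_box hp'1 hp't hf k) hr.pos ?_ hB (hfB k)
  exact (ENNReal.ofReal_pos.2 (by positivity)).ne'

/-- Hardy–Littlewood–Sobolev acts on each block before any summation; the loss (1+|k|)^δ is absorbed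
in the weight of exponent s + δ. -/
theorem HasDecay.exists_boxTimeNorm_le (hρ : IsCutoff ρ) (hP : Measurable P)
    (hp : 2 ≤ p) (hpt : p < ⊤) (hpp : ENNReal.HolderConjugate p p') (hq : 1 ≤ q) (hqt : q < ⊤)
    (hμ0 : 0 < μ) (hμ1 : μ < 1) (hγ : γ = ENNReal.ofReal (2 / μ))
    (hγγ' : ENNReal.HolderConjugate γ γ') (hdecay : HasDecay ρ P p p' q α δ μ) (s : ℝ) :
    ∃ C : ℝ≥0, ∀ f : ℝ → 𝓢'(Space n, ℂ), TimeMeasurable f →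
      boxTimeNorm ρ (s + δ) q γ' p' f < ⊤ → (∃ u, IsDuhamel P f u) ∧
        ∀ u, IsDuhamel P f u → TimeMeasurable u ∧
          boxTimeNorm ρ s q γ p u ≤ C * boxTimeNorm ρ (s + δ) q γ' p' f := by
  obtain ⟨e, e', hr⟩ := toReal_conjugate_eq hμ0 hμ1 hγ hγγ'
  obtain ⟨h0, ht⟩ := ENNReal.toReal_pos_iff.1 hr.symm.pos
  obtain ⟨h0', ht'⟩ := ENNReal.toReal_pos_iff.1 hr.pos
  have hL : ∀ F : ℝ → ℝ≥0∞, eLpNorm F γ volume = _ := eLpNorm_eq_lintegral_rpow h0.ne' ht.ne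
  have hL' : ∀ F : ℝ → ℝ≥0∞, eLpNorm F γ' volume = _ := eLpNorm_eq_lintegral_rpow h0'.ne' ht'.ne
  obtain ⟨C, hC⟩ := hdecay.exists_duhamel_bound hρ hP hp hpt hpp hq hqt hr
  obtain ⟨C', hC'⟩ := hardyLittlewoodSobolev hμ0 hμ1
  have hp't : p' ≠ ⊤ := ((ENNReal.HolderConjugate.lt_top_iff_one_lt p' p).2
    (ENNReal.one_lt_two.trans_le hp)).ne
  refine ⟨C * C', fun f hf hfin => ?_⟩
  obtain ⟨hex, hall⟩ := hC f hf (s + δ) _ hfin.ne fun k => by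
    rw [← hL']
    exact le_weightedSeqNorm hq hqt.ne _ k
  refine ⟨hex, fun u hu => ⟨(hall u hu).1, ?_⟩⟩
  rw [ENNReal.coe_mul]
  refine weightedSeqNorm_le_mul hq hqt.ne fun k => ?_
  have h1 := lintegral_rpow_duhamel_le hμ0 hC'
    (ENNReal.mul_ne_top ENNReal.coe_ne_top ENNReal.ofReal_ne_top)
    (hρ.aemeasurable_lpNorm_box hpp.symm.one_le hp't hf k) fun t => (hall u hu).2 k t
  rw [hL, hL', e, e', ← ofReal_rpow_mul_ofReal_rpow]
  refine (mul_le_mul_right h1 _).trans_eq ?_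
  ring

/-- The ℓ^q norm is taken at fixed t and moved inside the convolution by Minkowski's inequality, so
Hardy–Littlewood–Sobolev is needed only for the scalar modulation norm. -/
theorem HasDecay.exists_timeModNorm_le (hρ : IsCutoff ρ) (hP : Measurable P)
    (hp : 2 ≤ p) (hpt : p < ⊤) (hpp : ENNReal.HolderConjugate p p') (hq : 1 ≤ q) (hqt : q < ⊤)
    (hμ0 : 0 < μ) (hμ1 : μ < 1) (hγ : γ = ENNReal.ofReal (2 / μ))
    (hγγ' : ENNReal.HolderConjugate γ γ') (hdecay : HasDecay ρ P p p' q α δ μ) (s : ℝ) :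
    ∃ C : ℝ≥0, ∀ f : ℝ → 𝓢'(Space n, ℂ), TimeMeasurable f →
      timeModNorm ρ γ' (s + δ) p' q f < ⊤ → (∃ u, IsDuhamel P f u) ∧
        ∀ u, IsDuhamel P f u → TimeMeasurable u ∧
          timeModNorm ρ γ s p q u ≤ C * timeModNorm ρ γ' (s + δ) p' q f := by
  obtain ⟨e, e', hr⟩ := toReal_conjugate_eq hμ0 hμ1 hγ hγγ'
  obtain ⟨h0, ht⟩ := ENNReal.toReal_pos_iff.1 hr.symm.pos
  obtain ⟨h0', ht'⟩ := ENNReal.toReal_pos_iff.1 hr.pos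
  have hL : ∀ F : ℝ → ℝ≥0∞, eLpNorm F γ volume = _ := eLpNorm_eq_lintegral_rpow h0.ne' ht.ne
  have hL' : ∀ F : ℝ → ℝ≥0∞, eLpNorm F γ' volume = _ := eLpNorm_eq_lintegral_rpow h0'.ne' ht'.ne
  have hq0 : 0 < q.toReal := ENNReal.toReal_pos (zero_lt_one.trans_le hq).ne' hqt.ne
  have hq1 : 1 ≤ q.toReal := by simpa using ENNReal.toReal_mono hqt.ne hq
  obtain ⟨C, hC⟩ := hdecay.exists_duhamel_bound hρ hP hp hpt hpp hq hqt hr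
  obtain ⟨C', hC'⟩ := hardyLittlewoodSobolev hμ0 hμ1
  have hp't : p' ≠ ⊤ := ((ENNReal.HolderConjugate.lt_top_iff_one_lt p' p).2
    (ENNReal.one_lt_two.trans_le hp)).ne
  refine ⟨C * C', fun f hf hfin => ?_⟩
  have hFm := hρ.aemeasurable_lpNorm_box hpp.symm.one_le hp't hf
  -- At each τ a weighted block is at most the full modulation norm, which gives the bound, uniform
  -- in k, needed for existence.
  obtain ⟨hex, hall⟩ := hC f hf (s + δ) _ hfin.ne fun k => by
    rw [timeModNorm, hL', ← lintegral_const_mul_rpow hr.pos ENNReal.ofReal_ne_top]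
    have := hr.pos
    gcongr with τ
    exact le_weightedSeqNorm hq hqt.ne _ k
  refine ⟨hex, fun u hu => ⟨(hall u hu).1, ?_⟩⟩
  have hmod : AEMeasurable fun τ => modNorm ρ (s + δ) p' q (f τ) := by
    simp only [modNorm, weightedSeqNorm_of_ne_top hqt.ne]
    exact (AEMeasurable.tsum fun k => ((hFm k).const_mul _).pow_const _).pow_const _
  rw [ENNReal.coe_mul, timeModNorm, timeModNorm, hL, hL', e, e']
  refine lintegral_rpow_duhamel_le hμ0 hC' ENNReal.coe_ne_top hmod fun t => ?_
  have hdk : AEMeasurable fun τ => decayKernel μ (t - τ) :=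
    ((measurable_decayKernel μ).comp (measurable_const.sub measurable_id)).aemeasurable
  set G : (Fin n → ℤ) → ℝ → ℝ≥0∞ := fun k τ => decayKernel μ (t - τ) *
    (ENNReal.ofReal ((1 + ‖latticePoint k‖) ^ (s + δ)) * lpNorm p' (box ρ k (f τ))) with hG
  have hGm : ∀ k, AEMeasurable (G k) := fun k => hdk.mul ((hFm k).const_mul _)
  calc modNorm ρ s p q (u t)
      ≤ (∑' k, (C * ∫⁻ τ, G k τ) ^ q.toReal) ^ (1 / q.toReal) := by
        rw [modNorm, weightedSeqNorm_of_ne_top hqt.ne]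
        refine ENNReal.rpow_le_rpow (ENNReal.tsum_le_tsum fun k =>
          ENNReal.rpow_le_rpow ?_ hq0.le) (by positivity)
        refine (mul_le_mul_right ((hall u hu).2 k t) _).trans_eq ?_
        have : ∫⁻ τ, G k τ = ENNReal.ofReal ((1 + ‖latticePoint k‖) ^ (s + δ)) *
            ∫⁻ τ, decayKernel μ (t - τ) * lpNorm p' (box ρ k (f τ)) := by
          rw [← lintegral_const_mul' _ _ ENNReal.ofReal_ne_top]
          refine lintegral_congr fun τ => ?_
          rw [hG]
          ring
        rw [this, ← ofReal_rpow_mul_ofReal_rpow]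
        ring
    _ = C * (∑' k, (∫⁻ τ, G k τ) ^ q.toReal) ^ (1 / q.toReal) := tsum_const_mul_rpow hq0 _ _
    _ ≤ C * ∫⁻ τ, (∑' k, G k τ ^ q.toReal) ^ (1 / q.toReal) := by
        gcongr
        exact tsum_rpow_lintegral_le hq1 hGm
    _ = _ := by
        congr 1
        refine lintegral_congr fun τ => ?_
        rw [modNorm, weightedSeqNorm_of_ne_top hqt.ne, hG, tsum_const_mul_rpow hq0]

end Strichartz

end ModSpace

end

theorem mainTheorem11 {n : ℕ} (ρ : ModSpace.Space n → ℝ) (hρ : ModSpace.IsCutoff ρ)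
    (P : ModSpace.Space n → ℝ) (hP : Measurable P)
    (p p' q γ γ' : ℝ≥0∞) (α δ μ : ℝ)
    (hp : 2 ≤ p) (hp_top : p < ⊤) (hpp' : ENNReal.HolderConjugate p p')
    (hq : 1 ≤ q) (hq_top : q < ⊤)
    (hμ0 : 0 < μ) (hμ1 : μ < 1)
    (hγ : γ = ENNReal.ofReal (2 / μ)) (hγγ' : ENNReal.HolderConjugate γ γ')
    (hdecay : ModSpace.HasDecay ρ P p p' q α δ μ) (s : ℝ) :
    (∃ C : ℝ≥0, ∀ f : ℝ → 𝓢'(ModSpace.Space n, ℂ), ModSpace.TimeMeasurable f →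
      ModSpace.boxTimeNorm ρ (s + δ) q γ' p' f < ⊤ →
        (∃ u, ModSpace.IsDuhamel P f u) ∧
        ∀ u, ModSpace.IsDuhamel P f u → ModSpace.TimeMeasurable u ∧
          ModSpace.boxTimeNorm ρ s q γ p u ≤ C * ModSpace.boxTimeNorm ρ (s + δ) q γ' p' f) ∧
    (γ' ≤ q → q ≤ γ →
      ∃ C : ℝ≥0, ∀ f : ℝ → 𝓢'(ModSpace.Space n, ℂ), ModSpace.TimeMeasurable f →
        ModSpace.timeModNorm ρ γ' (s + δ) p' q f < ⊤ →
          (∃ u, ModSpace.IsDuhamel P f u) ∧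
          ∀ u, ModSpace.IsDuhamel P f u → ModSpace.TimeMeasurable u ∧
            ModSpace.timeModNorm ρ γ s p q u ≤
              C * ModSpace.timeModNorm ρ γ' (s + δ) p' q f) := by
  exact ⟨hdecay.exists_boxTimeNorm_le hρ hP hp hp_top hpp' hq hq_top hμ0 hμ1 hγ hγγ' s,
    fun _ _ => hdecay.exists_timeModNorm_le hρ hP hp hp_top hpp' hq hq_top hμ0 hμ1 hγ hγγ' s⟩
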